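/- All graphs are finite, simple and undirected. For a graph $X$, let $BX$ be its canonical bipartite double cover: $V(BX)=V(X)\times\{0,1\}$, with $(v,0)$ adjacent to $(w,1)$ iff $v$ is adjacent to $w$ in $X$. The graph $X$ is *unstable* if $\operatorname{Aut} BX\neq \operatorname{Aut}X\times S_2$ (with $S_2$ permuting $\{0,1\}$). It is *nontrivially unstable* if it is unstable, connected, nonbipartite and twin-free (no two distinct vertices have the same set of neighbours), and *trivially unstable* if it is unstable but not nontrivially unstable. For $S=-S\subseteq\mathbb Z_n$ let $\mathrm{Cay}(\mathbb Z_n,S)$ be the graph on $\mathbb Z_n$ in which $v$ is adjacent to $w$ iff $w-v\in S$; $|a|$ denotes the order of $a$ in $\mathbb Z_n$. For $n$ even, put $S_e=S\cap 2\mathbb Z_n$ and $S_o=S\setminus S_e$. The graph $\mathrm{Cay}(\mathbb Z_n,S)$ has Wilson type * C.1 if there is a nonzero $h\in2\mathbb Z_n$ with $h+S_e=S_e$; * C.2$'$ if $4\mid n$ and there is $h\in1+2\mathbb Z_n$ with $2h+S_o=S_o$ and such that $s+h\in S$ for every $s\in S$ with $s\equiv 0$ or $-h\pmod 4$; * C.3$'$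 if there is a subgroup $H\le\mathbb Z_n$ such that $R=\{s\in S: s+H\not\subseteq S\}$ is nonempty and, with $d=\gcd(R\cup\{n\})$, the number $n/d$ is even, $r/d$ is odd for every $r\in R$, and either $H\not\subseteq d\mathbb Z_n$ or $H\subseteq2d\mathbb Z_n$; * C.4 if there is $m\in\mathbb Z_n^\times$ with $(n/2)+mS=S$. **Corollary 5.2.** A circulant graph $X=\mathrm{Cay}(\mathbb Z_n,\{\pm a,\pm b,\pm c\})$ of valency $6$ is unstable if and only if either it is trivially unstable, or it is one of the following (for some positive integer $k$ and integers $a,b,c,m$, which may differ from the $a,b,c$ in the given description of $X$): 1. $\mathrm{Cay}(\mathbb Z_{8k},\{\pm a,\pm b,\pm 2k\})$, where $a$ and $b$ are odd; 2. $\mathrm{Cay}(\mathbb Z_{4k},\{\pm a,\pm b,\pm b+2k\})$, where $a$ is odd and $b$ is even; 3. $\mathrm{Cay}(\mathbb Z_{4k},\{\pm a,\pm(a+k),\pm(a-k)\})$, where $a\equiv0\pmod4$ and $k$ is odd; 4. $\mathrm{Cay}(\mathbb Z_{8k},\{\pm a,\pm b,\pm b+4k\})$, where $a$ is even and $|a|$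 is divisible by $4$; 5. $\mathrm{Cay}(\mathbb Z_{8k},\{\pm a,\pm k,\pm 3k\})$, where $a\equiv4\pmod8$ and $k$ is odd; 6. $\mathrm{Cay}(\mathbb Z_{4k},\{\pm a,\pm b,\pm mb+2k\})$, where $\gcd(m,4k)=1$, $(m-1)a\equiv2k\pmod{4k}$, and either $m^2\equiv1\pmod{4k}$ or $(m^2+1)b\equiv0\pmod{4k}$; 7. $\mathrm{Cay}(\mathbb Z_{8k},\{\pm a,\pm b,\pm c\})$, where there exists $m\in\mathbb Z$ with $\gcd(m,8k)=1$, $m^2\equiv1\pmod{8k}$ and $(m-1)a\equiv(m+1)b\equiv(m+1)c\equiv4k\pmod{8k}$. Moreover, the graphs of valency $6$ in families 1 and 2 have Wilson type C.1, those in family 3 have type C.2$'$, the twin-free ones in family 4 and all those in family 5 have type C.3$'$, and those in families 6 and 7 have type C.4. -/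

import Mathlib

open scoped Pointwise

namespace CirculantDoubleCover

section Graphs

/-- The automorphism of the canonical bipartite double cover `BX` (whose vertex set is
`V ⊕ V`, i.e. two copies of `V` indexed by `Bool`) induced by an automorphism `α` of `X` and
a permutation `σ` of the two-element index set: it sends `(v, i)` to `(α v, σ i)`. -/
def prodAut {V : Type*} (X : SimpleGraph V) (α : X ≃g X) (σ : Equiv.Perm Bool) :
    X.bipartiteDoubleCover ≃g X.bipartiteDoubleCover where
  toEquiv := ((Equiv.boolProdEquivSum V).symm.trans (σ.prodCongr α.toEquiv)).trans
    (Equiv.boolProdEquivSum V)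
  map_rel_iff' := by
    have hα : ∀ v w, X.Adj (α v) (α w) ↔ X.Adj v w := fun v w => α.map_rel_iff
    have hinj : σ false ≠ σ true := fun h => by simpa using σ.injective h
    rintro (v | v) (w | w) <;>
      rcases h0 : σ false with _ | _ <;> rcases h1 : σ true with _ | _ <;>
      simp_all [Equiv.boolProdEquivSum]

/-- The natural homomorphism `Aut X × S₂ → Aut BX`. -/
def prodAutHom {V : Type*} (X : SimpleGraph V) :
    (X ≃g X) × Equiv.Perm Bool →*
      (X.bipartiteDoubleCover ≃g X.bipartiteDoubleCover) where
  toFun p := prodAut X p.1 p.2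
  map_one' := by
    ext x
    rcases x with v | v <;> rfl
  map_mul' p q := by
    ext x
    change Equiv.boolProdEquivSum V ((p.2 * q.2).prodCongr (p.1 * q.1).toEquiv
        ((Equiv.boolProdEquivSum V).symm x)) =
      Equiv.boolProdEquivSum V (p.2.prodCongr p.1.toEquiv ((Equiv.boolProdEquivSum V).symm
        (Equiv.boolProdEquivSum V (q.2.prodCongr q.1.toEquiv
          ((Equiv.boolProdEquivSum V).symm x)))))
    rw [Equiv.symm_apply_apply]
    rfl

/-- `X` is unstable: `Aut BX ≠ Aut X × S₂`. -/
def Unstable {V : Type*} (X : SimpleGraph V) : Prop :=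
  (prodAutHom X).range ≠ ⊤

/-- No two distinct vertices have the same set of neighbours. -/
def TwinFree {V : Type*} (X : SimpleGraph V) : Prop :=
  ∀ v w : V, X.neighborSet v = X.neighborSet w → v = w

/-- Connected, nonbipartite, twin-free and unstable. -/
def NontriviallyUnstable {V : Type*} (X : SimpleGraph V) : Prop :=
  X.Connected ∧ ¬ X.IsBipartite ∧ TwinFree X ∧ Unstable X

/-- Unstable, but not nontrivially unstable. -/
def TriviallyUnstable {V : Type*} (X : SimpleGraph V) : Prop :=
  Unstable X ∧ ¬ NontriviallyUnstable X

end Graphs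

section Circulants

/-- The circulant graph `Cay(ℤ_n, S)`. -/
abbrev cay {n : ℕ} (S : Finset (ZMod n)) : SimpleGraph (ZMod n) :=
  SimpleGraph.circulantGraph (S : Set (ZMod n))

/-- The set `{±a, ±b, ±c}`. -/
def pm {n : ℕ} (a b c : ZMod n) : Finset (ZMod n) := {a, -a, b, -b, c, -c}

end Circulants

section WilsonTypes

open Classical in
/-- `S_e = S ∩ 2ℤ_n` (in an additive group, `Even x` says `x = r + r` for some `r`). -/
noncomputable def evenPart {n : ℕ} (S : Finset (ZMod n)) : Finset (ZMod n) :=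
  S.filter (fun s => Even s)

open Classical in
/-- `S_o = S \ S_e`. -/
noncomputable def oddPart {n : ℕ} (S : Finset (ZMod n)) : Finset (ZMod n) :=
  S.filter (fun s => ¬ Even s)

/-- Wilson type C.1: there is a nonzero `h ∈ 2ℤ_n` with `h + S_e = S_e`. -/
def WilsonC1 {n : ℕ} (S : Finset (ZMod n)) : Prop :=
  Even n ∧ ∃ h : ZMod n, h ≠ 0 ∧ Even h ∧ h +ᵥ evenPart S = evenPart S

/-- Wilson type C.2′. For `4 ∣ n`, an element of `ℤ_n` is `≡ 0 (mod 4)` exactly when it is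
divisible by `4` in the ring `ℤ_n`. -/
def WilsonC2' {n : ℕ} (S : Finset (ZMod n)) : Prop :=
  4 ∣ n ∧ ∃ h : ZMod n, Even (h - 1) ∧
    (2 * h) +ᵥ oddPart S = oddPart S ∧
    ∀ s ∈ S, ((4 : ZMod n) ∣ s ∨ (4 : ZMod n) ∣ s + h) → s + h ∈ S

open Classical in
/-- `R = {s ∈ S | s + H ⊄ S}`. -/
noncomputable def wilsonR {n : ℕ} (S : Finset (ZMod n)) (H : AddSubgroup (ZMod n)) :
    Finset (ZMod n) :=
  S.filter (fun s => ¬ ∀ h ∈ H, s + h ∈ S)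

/-- `d = gcd (R ∪ {n})`, computed with the representatives in `{0, …, n - 1}`. -/
noncomputable def wilsonD {n : ℕ} (S : Finset (ZMod n)) (H : AddSubgroup (ZMod n)) : ℕ :=
  Nat.gcd n ((wilsonR S H).gcd ZMod.val)

/-- Wilson type C.3′. -/
def WilsonC3' {n : ℕ} (S : Finset (ZMod n)) : Prop :=
  Even n ∧ ∃ H : AddSubgroup (ZMod n),
    (wilsonR S H).Nonempty ∧
    Even (n / wilsonD S H) ∧
    (∀ r ∈ wilsonR S H, Odd (r.val / wilsonD S H)) ∧
    (¬ H ≤ AddSubgroup.zmultiples ((wilsonD S H : ℕ) : ZMod n) ∨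
      H ≤ AddSubgroup.zmultiples ((2 * wilsonD S H : ℕ) : ZMod n))

/-- Wilson type C.4: `n/2 + mS = S` for some `m ∈ ℤ_nˣ`. -/
def WilsonC4 {n : ℕ} (S : Finset (ZMod n)) : Prop :=
  Even n ∧ ∃ m : (ZMod n)ˣ, ((n / 2 : ℕ) : ZMod n) +ᵥ (m • S) = S

end WilsonTypes

section Families

/-- `Cay(ℤ_{8k}, {±a, ±b, ±2k})` with `a` and `b` odd. -/
def Family1 (n : ℕ) (S : Finset (ZMod n)) : Prop :=
  ∃ (k : ℕ) (a b : ℤ), n = 8 * k ∧ S = pm (a : ZMod n) (b : ZMod n) (2 * k : ZMod n) ∧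
    Odd a ∧ Odd b

/-- `Cay(ℤ_{4k}, {±a, ±b, ±b + 2k})` with `a` odd and `b` even. -/
def Family2 (n : ℕ) (S : Finset (ZMod n)) : Prop :=
  ∃ (k : ℕ) (a b : ℤ), n = 4 * k ∧
    S = {(a : ZMod n), -(a : ZMod n), (b : ZMod n), -(b : ZMod n),
      (b : ZMod n) + 2 * k, -(b : ZMod n) + 2 * k} ∧
    Odd a ∧ Even b

/-- `Cay(ℤ_{4k}, {±a, ±(a + k), ±(a - k)})` with `a ≡ 0 (mod 4)` and `k` odd. -/
def Family3 (n : ℕ) (S : Finset (ZMod n)) : Prop :=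
  ∃ (k : ℕ) (a : ℤ), n = 4 * k ∧
    S = pm (a : ZMod n) ((a : ZMod n) + k) ((a : ZMod n) - k) ∧
    a ≡ 0 [ZMOD 4] ∧ Odd k

/-- `Cay(ℤ_{8k}, {±a, ±b, ±b + 4k})` with `a` even and `|a|` divisible by `4`, where `|a|` is
the order of `a` in `ℤ_{8k}`. -/
def Family4 (n : ℕ) (S : Finset (ZMod n)) : Prop :=
  ∃ (k : ℕ) (a b : ℤ), n = 8 * k ∧
    S = {(a : ZMod n), -(a : ZMod n), (b : ZMod n), -(b : ZMod n),
      (b : ZMod n) + 4 * k, -(b : ZMod n) + 4 * k} ∧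
    Even a ∧ 4 ∣ addOrderOf (a : ZMod n)

/-- `Cay(ℤ_{8k}, {±a, ±k, ±3k})` with `a ≡ 4 (mod 8)` and `k` odd. -/
def Family5 (n : ℕ) (S : Finset (ZMod n)) : Prop :=
  ∃ (k : ℕ) (a : ℤ), n = 8 * k ∧
    S = pm (a : ZMod n) (k : ZMod n) (3 * k : ZMod n) ∧
    a ≡ 4 [ZMOD 8] ∧ Odd k

/-- `Cay(ℤ_{4k}, {±a, ±b, ±mb + 2k})` with `gcd(m, 4k) = 1`, `(m - 1)a ≡ 2k (mod 4k)`, and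
either `m² ≡ 1` or `(m² + 1)b ≡ 0 (mod 4k)`. -/
def Family6 (n : ℕ) (S : Finset (ZMod n)) : Prop :=
  ∃ (k : ℕ) (a b m : ℤ), n = 4 * k ∧
    S = {(a : ZMod n), -(a : ZMod n), (b : ZMod n), -(b : ZMod n),
      (m : ZMod n) * b + 2 * k, -((m : ZMod n) * b) + 2 * k} ∧
    Int.gcd m (4 * k) = 1 ∧ (m - 1) * a ≡ 2 * k [ZMOD 4 * k] ∧
    (m ^ 2 ≡ 1 [ZMOD 4 * k] ∨ (m ^ 2 + 1) * b ≡ 0 [ZMOD 4 * k])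

/-- `Cay(ℤ_{8k}, {±a, ±b, ±c})` such that, for some `m` with `gcd(m, 8k) = 1` and
`m² ≡ 1 (mod 8k)`, we have `(m - 1)a ≡ (m + 1)b ≡ (m + 1)c ≡ 4k (mod 8k)`. -/
def Family7 (n : ℕ) (S : Finset (ZMod n)) : Prop :=
  ∃ (k : ℕ) (a b c : ℤ), n = 8 * k ∧
    S = pm (a : ZMod n) (b : ZMod n) (c : ZMod n) ∧
    ∃ m : ℤ, Int.gcd m (8 * k) = 1 ∧ m ^ 2 ≡ 1 [ZMOD 8 * k] ∧
      (m - 1) * a ≡ 4 * k [ZMOD 8 * k] ∧ (m + 1) * b ≡ 4 * k [ZMOD 8 * k] ∧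
      (m + 1) * c ≡ 4 * k [ZMOD 8 * k]

end Families

end CirculantDoubleCover

/-! For connected nonbipartite `X`, an automorphism of `BX` keeps or swaps the two layers, so
instability means that there are distinct permutations `γ 0`, `γ 1` of the vertices with `v ~ w` iff
`γ 0 v ~ γ 1 w`. For a circulant, `BX` is a Cayley graph of `ℤ_n × ℤ₂`, and `Inv γ i A` says that
`γ` preserves the Cayley relation of `A × {i}`. Invariant sets are closed under Boolean operations,
sums and transporters and, by Schur's multiplier argument, under "multiplication by `p`, modulo `p`"
(`Inv.frobenius`). Everything is derived from `S` in grade 1; reaching `{0}` in grade 1 is a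
contradiction, since it says `γ 0 = γ 1`.

The aim is to show that `γ` carries translation by each generator to a translation. Then `γ` is
affine and `mS + n/2 = S` for some unit `m` (`exists_unit`), and the possible actions of `x ↦ m x +
n/2` on the pairs `±a`, `±b`, `±c` give families 6 and 7 (`family_of_affine`). Translations go to
translations as soon as `γ` preserves the parallelograms spanned by generators (`Inv.parallelogram`,
`Inv.parallelogram_of_sum`). That can fail only if the generators satisfy a short relation: `2x =
2y`, `4x = 0`, `y = 3x` or `2x = y + z`. Each relation is either refuted, mostly with Frobenius for
`p = 2, 3, 5`, or treated directly.

Three situations arise. Some pair `{±s}` may be invariant (`family_of_pair`), which gives families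
2, 4, 5, 6, 7. If none is, two generators may differ by the element of order two
(`two_mul_eq_add_of_half`, `family_of_half_of_add`), which gives families 2 and 3; otherwise all
short relations are excluded (`family_of_generic`), which gives families 6 and 7. Family 1 need not
appear in this direction: it is contained in family 7, with `m = 4k - 1`.

Conversely, each family has an explicit pair of permutations: those attached to types C.1 and C.4
for families 1, 2, 6, 7, and shifts depending on a residue class for families 3, 4, 5
(`unstable_of_residue`). -/

namespace CirculantDoubleCover

/-! ### Sets invariant under a pair of permutations, graded by `ℤ₂`. -/

section TwoFold

variable {G : Type*} [AddCommGroup G] (γ : ZMod 2 → Equiv.Perm G)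

/-- The set `A` is invariant in grade `i` under the pair of permutations `γ`: the Cayley relation
of `A` between the copies `j` and `j + i` of `G` is preserved. -/
def Inv (i : ZMod 2) (A : Set G) : Prop :=
  ∀ j v w, γ (j + i) w - γ j v ∈ A ↔ w - v ∈ A

/-- Translation by `(x, i)` is carried by `γ` to translation by `(y, i)`. -/
def Lin (x : G) (i : ZMod 2) (y : G) : Prop :=
  ∀ j v, γ (j + i) (v + x) = γ j v + y

variable {γ} {i k : ZMod 2} {A B : Set G}

theorem grade_add_self (j i : ZMod 2) : j + i + i = j := by
  rw [add_assoc, CharTwo.add_self_eq_zero, add_zero]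

namespace Inv

theorem compl (hA : Inv γ i A) : Inv γ i Aᶜ := fun j v w => not_congr (hA j v w)

theorem inter (hA : Inv γ i A) (hB : Inv γ i B) : Inv γ i (A ∩ B) :=
  fun j v w => and_congr (hA j v w) (hB j v w)

theorem union (hA : Inv γ i A) (hB : Inv γ i B) : Inv γ i (A ∪ B) :=
  fun j v w => or_congr (hA j v w) (hB j v w)

theorem diff (hA : Inv γ i A) (hB : Inv γ i B) : Inv γ i (A \ B) :=
  hA.inter hB.compl

theorem congr (hA : Inv γ i A) (h : A = B) : Inv γ i B := h ▸ hA

/-- A step in `A + B` is a path through a vertex of the layer `j + i`, and surjectivity of `γ (j +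
i)` lets such paths be pulled back as well as pushed forward. -/
theorem add (hA : Inv γ i A) (hB : Inv γ k B) : Inv γ (i + k) (A + B) := by
  intro j v w
  simp only [Set.mem_add]
  constructor
  · rintro ⟨a, ha, b, hb, hab⟩
    obtain ⟨x, hx⟩ := (γ (j + i)).surjective (γ j v + a)
    have hxa : x - v ∈ A := by rw [← hA j, hx]; simpa using ha
    have hxb : w - x ∈ B := by
      rw [← hB (j + i), hx, add_assoc]
      convert hb using 1
      rw [sub_add_eq_sub_sub, ← hab]; abel
    exact ⟨_, hxa, _, hxb, by abel⟩
  · rintro ⟨a, ha, b, hb, hab⟩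
    have hxa : γ (j + i) (v + a) - γ j v ∈ A := by rw [hA]; simpa using ha
    have hxb : γ (j + (i + k)) w - γ (j + i) (v + a) ∈ B := by
      rw [← add_assoc, hB]
      convert hb using 1
      rw [sub_add_eq_sub_sub, ← hab]; abel
    exact ⟨_, hxa, _, hxb, by abel⟩

/-- The set of elements with two representations in `A + B`. -/
theorem add_two (hA : Inv γ i A) (hB : Inv γ k B) :
    Inv γ (i + k) {x | ∃ a ∈ A, ∃ a' ∈ A, a ≠ a' ∧ x - a ∈ B ∧ x - a' ∈ B} := by
  intro j v w
  simp only [Set.mem_ofPred_eq]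
  constructor
  · rintro ⟨a, ha, a', ha', hne, hb, hb'⟩
    obtain ⟨x, hx⟩ := (γ (j + i)).surjective (γ j v + a)
    obtain ⟨x', hx'⟩ := (γ (j + i)).surjective (γ j v + a')
    refine ⟨x - v, ?_, x' - v, ?_, ?_, ?_, ?_⟩
    · rw [← hA j, hx]; simpa using ha
    · rw [← hA j, hx']; simpa using ha'
    · intro h
      have : x = x' := by simpa using h
      subst this
      exact hne (by simpa using hx.symm.trans hx')
    · rw [sub_sub_sub_cancel_right, ← hB (j + i), hx, add_assoc, ← sub_sub]; exact hb
    · rw [sub_sub_sub_cancel_right, ← hB (j + i), hx', add_assoc, ← sub_sub]; exact hb'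
  · rintro ⟨a, ha, a', ha', hne, hb, hb'⟩
    refine ⟨γ (j + i) (v + a) - γ j v, ?_, γ (j + i) (v + a') - γ j v, ?_, ?_, ?_, ?_⟩
    · rw [hA]; simpa using ha
    · rw [hA]; simpa using ha'
    · simpa using hne
    · rw [sub_sub_sub_cancel_right, ← add_assoc, hB, ← sub_sub]; exact hb
    · rw [sub_sub_sub_cancel_right, ← add_assoc, hB, ← sub_sub]; exact hb'

/-- The set of elements translating `B` into `A`. -/
theorem transporter (hA : Inv γ i A) (hB : Inv γ k B) :
    Inv γ (i + k) {x | ∀ u ∈ B, x + u ∈ A} := by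
  intro j v w
  simp only [Set.mem_ofPred_eq]
  constructor
  · intro H u hu
    -- Grades have order two, so a `B`-step from the layer `j + i + k` returns to the layer `j + i`.
    have h1 : γ (j + (i + k) + k) (w + u) - γ (j + (i + k)) w ∈ B := by rw [hB]; simpa using hu
    have h2 := H _ h1
    rw [← add_assoc, grade_add_self, sub_add_sub_cancel', hA] at h2
    rwa [sub_add_eq_add_sub]
  · intro H u hu
    obtain ⟨z, hz⟩ := (γ (j + i)).surjective (γ (j + (i + k)) w + u)
    have h1 : z - w ∈ B := by
      rw [← hB (j + (i + k)), ← add_assoc, grade_add_self, hz, add_assoc]; simpa using hu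
    have h2 := H _ h1
    rw [sub_add_sub_cancel', ← hA j, hz] at h2
    rwa [sub_add_eq_add_sub]

end Inv

theorem Inv.lin_of_singleton {x : G} (h : Inv γ i {x}) : Lin γ x i x := by
  intro j v
  have := (h j v (v + x)).2 (by simp)
  rw [Set.mem_singleton_iff, sub_eq_iff_eq_add] at this
  rw [this, add_comm]

namespace Lin

variable {x y x' y' : G}

theorem inv (h : Lin γ x i y) : Inv γ i {z | z = x} ↔ x = y := by
  constructor
  · intro h'
    have := (h' 0 0 (0 + x)).2 (by simp)
    rw [Set.mem_ofPred_eq, h 0 0] at this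
    simpa using this.symm
  · rintro rfl j v w
    simp only [Set.mem_ofPred_eq, sub_eq_iff_eq_add']
    rw [← h, (γ (j + i)).injective.eq_iff]

theorem zero : Lin γ 0 0 0 := fun j v => by simp

theorem add (h : Lin γ x i y) (h' : Lin γ x' k y') : Lin γ (x + x') (i + k) (y + y') := by
  intro j v
  rw [← add_assoc, ← add_assoc, h', h, add_assoc]

theorem neg (h : Lin γ x i y) : Lin γ (-x) i (-y) := by
  intro j v
  have := h (j + i) (v + -x)
  rw [grade_add_self, neg_add_cancel_right] at this
  rw [this, add_neg_cancel_right]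

end Lin

/-- If `{x, -x}` is invariant, then `γ` preserves two-step paths in direction `x`. -/
theorem Inv.straight {x : G} (h : Inv γ i {x, -x}) (hx : x ≠ -x) (j : ZMod 2) (v : G) :
    γ (j + i + i) (v + x + x) - γ (j + i) (v + x) = γ (j + i) (v + x) - γ j v := by
  have key : ∀ j v, γ (j + i) (v + x) - γ j v = x ∨ γ (j + i) (v + x) - γ j v = -x := by
    intro j v
    simpa using (h j v (v + x)).2 (by simp)
  -- Both image steps are `±x`; opposite signs would lead back to the start, although `v + 2x ≠ v`.
  have hne : γ (j + i + i) (v + x + x) ≠ γ j v := by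
    rw [grade_add_self, Ne, (γ j).injective.eq_iff, add_assoc, add_eq_left,
      ← eq_neg_iff_add_eq_zero]
    exact hx
  rcases key j v with h1 | h1 <;> rcases key (j + i) (v + x) with h2 | h2
  · rw [h1, h2]
  · refine absurd ?_ hne
    have := congrArg₂ (· + ·) h1 h2
    simpa [sub_eq_zero] using this
  · refine absurd ?_ hne
    have := congrArg₂ (· + ·) h1 h2
    simpa [sub_eq_zero] using this
  · rw [h1, h2]

/-- If `{x, -x}` is invariant, then `γ` maps lines in direction `x` to lines in direction `x`. -/
theorem Inv.line {x : G} (h : Inv γ i {x, -x}) (hx : x ≠ -x) (j : ZMod 2) (v : G) (m : ℕ) :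
    γ (j + m * i) (v + m • x) - γ j v = m • (γ (j + i) (v + x) - γ j v) := by
  have step : ∀ m : ℕ, γ (j + (m * i + i)) (v + (m • x + x)) - γ (j + m * i) (v + m • x) =
      γ (j + i) (v + x) - γ j v := by
    intro m
    induction m with
    | zero => simp
    | succ m ih =>
      have := h.straight hx (j + m * i) (v + m • x)
      rw [succ_nsmul, Nat.cast_succ, add_mul, one_mul, ← ih]
      simpa only [add_assoc] using this
  induction m with
  | zero => simp
  | succ m ih =>
    rw [succ_nsmul, succ_nsmul, ← ih, Nat.cast_succ, add_mul, one_mul, ← step m]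
    abel

/-- Two directions, the first of which is an invariant pair whose double is not a difference of
elements of the second invariant set, span parallelograms preserved by `γ`. -/
theorem Inv.parallelogram {x y : G} (h : Inv γ i {x, -x}) (hB : Inv γ k B) (hy : y ∈ B)
    (hd : ∀ t ∈ B, ∀ t' ∈ B, t - t' ≠ x + x) (j : ZMod 2) (v : G) :
    γ (j + k + i) (v + y + x) - γ (j + k) (v + y) = γ (j + i) (v + x) - γ j v ∧
      γ (j + i + k) (v + x + y) - γ (j + i) (v + x) = γ (j + k) (v + y) - γ j v := by
  have key : ∀ j v, γ (j + i) (v + x) - γ j v = x ∨ γ (j + i) (v + x) - γ j v = -x := by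
    intro j v
    simpa using (h j v (v + x)).2 (by simp)
  have keyB : ∀ j v, γ (j + k) (v + y) - γ j v ∈ B := fun j v => (hB j v _).2 (by simpa)
  have e1 : γ (j + k + i) (v + y + x) = γ (j + i + k) (v + x + y) := by
    rw [add_right_comm j, add_right_comm v]
  have h3 := keyB j v
  have h4 := keyB (j + i) (v + x)
  -- The two `x`-sides have images `±x`. If the signs differed, the images of the other two sides
  -- would be elements of `B` differing by `2x`, which `hd` forbids.
  suffices hs : γ (j + k + i) (v + y + x) - γ (j + k) (v + y) = γ (j + i) (v + x) - γ j v by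
    refine ⟨hs, ?_⟩
    rw [← e1, sub_eq_iff_eq_add.1 hs]
    abel
  rcases key j v with h1 | h1 <;> rcases key (j + k) (v + y) with h2 | h2
  · rw [h1, h2]
  · refine absurd ?_ (hd _ h3 _ h4)
    rw [← e1, sub_eq_iff_eq_add.1 h2, sub_eq_iff_eq_add.1 h1]
    abel
  · refine absurd ?_ (hd _ h4 _ h3)
    rw [← e1, sub_eq_iff_eq_add.1 h2, sub_eq_iff_eq_add.1 h1]
    abel
  · rw [h1, h2]

/-- If twice an element of `A` is a sum of two elements of `A` only trivially, and any four
elements of `A` include two that are equal or opposite, then any four elements of `A` with sum zero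
include two opposite ones. -/
theorem exists_opposite_of_sum_eq_zero
    (hQ : ∀ s ∈ A, ∀ u ∈ A, ∀ w ∈ A, s + s = u + w → u = s) (hneg : ∀ s ∈ A, -s ∈ A)
    (hp : ∀ s ∈ A, ∀ t ∈ A, ∀ u ∈ A, ∀ w ∈ A, (s = t ∨ s = -t) ∨ (s = u ∨ s = -u) ∨
      (s = w ∨ s = -w) ∨ (t = u ∨ t = -u) ∨ (t = w ∨ t = -w) ∨ (u = w ∨ u = -w))
    {s t u w : G} (hs : s ∈ A) (ht : t ∈ A) (hu : u ∈ A) (hw : w ∈ A) (h : s + t + u + w = 0) :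
    s = -t ∨ s = -u ∨ s = -w ∨ t = -u ∨ t = -w ∨ u = -w := by
  -- Two equal terms turn the relation into `2x = (-y) + (-z)`, and `hQ` then produces an opposite
  -- pair.
  have key : ∀ x ∈ A, ∀ y ∈ A, ∀ z ∈ A, x + x + y + z = 0 → x = -y := by
    intro x hx y hy z hz h
    refine (hQ x hx _ (hneg y hy) _ (hneg z hz) ?_).symm
    rw [← sub_eq_zero, ← h]; abel
  rcases hp s hs t ht u hu w hw with (e | e) | (e | e) | (e | e) | (e | e) | (e | e) | e | e <;>
    try tauto
  · subst e; exact Or.inr (Or.inl (key s hs u hu w hw h))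
  · subst e; exact Or.inl (key s hs t ht w hw (by rw [← h]; abel))
  · subst e; exact Or.inl (key s hs t ht u hu (by rw [← h]; abel))
  · subst e; exact Or.inr (Or.inr (Or.inr (Or.inr (Or.inl (key t ht w hw s hs
      (by rw [← h]; abel))))))
  · subst e; exact Or.inr (Or.inr (Or.inr (Or.inl (key t ht u hu s hs (by rw [← h]; abel)))))
  · subst e; exact Or.inr (Or.inr (Or.inr (Or.inl
      (neg_eq_iff_eq_neg.1 (key u hu t ht s hs (by rw [← h]; abel)).symm |>.trans (by simp)))))

/-- Suppose that twice an element of `A` is a sum of two elements of `A` only trivially, and that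
any four elements of `A` include two equal or two opposite ones. Then `γ` preserves
the parallelograms spanned by elements of `A`. -/
theorem Inv.parallelogram_of_sum (hA : Inv γ 1 A)
    (hQ : ∀ s ∈ A, ∀ u ∈ A, ∀ w ∈ A, s + s = u + w → u = s) (hneg : ∀ s ∈ A, -s ∈ A)
    (hp : ∀ s ∈ A, ∀ t ∈ A, ∀ u ∈ A, ∀ w ∈ A, (s = t ∨ s = -t) ∨ (s = u ∨ s = -u) ∨
      (s = w ∨ s = -w) ∨ (t = u ∨ t = -u) ∨ (t = w ∨ t = -w) ∨ (u = w ∨ u = -w))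
    {s t : G} (hs : s ∈ A) (ht : t ∈ A) (j : ZMod 2) (v : G) :
    γ (j + 1 + 1) (v + t + s) - γ (j + 1) (v + t) = γ (j + 1) (v + s) - γ j v := by
  have key : ∀ j v, ∀ s ∈ A, γ (j + 1) (v + s) - γ j v ∈ A :=
    fun j v s hs => (hA j v _).2 (by simpa)
  -- Taking the two image steps in the other order passes through a point whose preimage `z` is also
  -- a midpoint between `v` and `v + 2s`. By `hQ` there is only one midpoint, so the two steps
  -- agree.
  have straight : ∀ j v, γ (j + 1 + 1) (v + s + s) - γ (j + 1) (v + s) =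
      γ (j + 1) (v + s) - γ j v := by
    intro j v
    set u := γ (j + 1) (v + s) - γ j v with hu
    set w := γ (j + 1 + 1) (v + s + s) - γ (j + 1) (v + s) with hw
    obtain ⟨z, hz⟩ := (γ (j + 1)).surjective (γ j v + w)
    have hzA : z - v ∈ A := by
      rw [← hA j, hz]; simpa using key (j + 1) (v + s) s hs
    have hzA' : v + s + s - z ∈ A := by
      rw [← hA (j + 1), hz]
      convert key j v s hs using 1
      rw [hw]; abel
    have := hQ s hs _ hzA _ hzA' (by abel)
    have hzv : z = v + s := by rw [← this]; abel
    rw [hu, ← hzv, hz]; abel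
  by_cases h1 : s = t
  · subst h1; exact straight j v
  by_cases h2 : s = -t
  · have := straight (j + 1) (v + t)
    subst h2
    simpa [grade_add_self j 1] using this.symm
  have e1 : γ (j + 1 + 1) (v + t + s) = γ (j + 1 + 1) (v + s + t) := by rw [add_right_comm v]
  have hne : γ (j + 1 + 1) (v + t + s) ≠ γ j v := by
    rw [grade_add_self, Ne, (γ j).injective.eq_iff, add_assoc, add_eq_left,
      add_comm, ← eq_neg_iff_add_eq_zero]
    exact h2
  have hne' : γ (j + 1) (v + s) ≠ γ (j + 1) (v + t) := by
    rw [Ne, (γ (j + 1)).injective.eq_iff]; simpa using h1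
  -- The sides of the image quadrilateral are four elements of `A` with sum zero. Each opposite pair
  -- either gives the claim or identifies the images of two distinct vertices.
  rcases exists_opposite_of_sum_eq_zero hQ hneg hp (key j v s hs) (key (j + 1) (v + s) t ht)
    (hneg _ (key j v t ht)) (hneg _ (key (j + 1) (v + t) s hs)) (by rw [e1]; abel) with h | h | h | h | h | h
  · refine absurd ?_ hne
    rw [e1, ← sub_eq_zero, ← sub_eq_zero.2 h]; abel
  · refine absurd ?_ hne'
    rw [← sub_eq_zero, ← sub_eq_zero.2 h]; abel
  · rw [h]; abel
  · rw [← sub_eq_zero, e1, ← sub_eq_zero.2 h]; abel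
  · refine absurd ?_ hne'
    rw [← sub_eq_zero, ← sub_eq_zero.2 h.symm, e1]; abel
  · refine absurd ?_ hne
    rw [← sub_eq_zero, ← sub_eq_zero.2 h.symm]; abel

end TwoFold

/-! ### Schur's multiplier argument in the group algebra modulo a prime. -/

section Frobenius

variable {G : Type*} [AddCommGroup G] [Fintype G] {γ : ZMod 2 → Equiv.Perm G}
  {i k : ZMod 2} {R : Type*} [CommSemiring R]

/-- Grade `i` invariance of an element of the group algebra. -/
def InvCoeff (γ : ZMod 2 → Equiv.Perm G) (i : ZMod 2) (F : AddMonoidAlgebra R G) : Prop :=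
  ∀ j v w, F.coeff (γ (j + i) w - γ j v) = F.coeff (w - v)

theorem coeff_mul_eq_sum (E F : AddMonoidAlgebra R G) (v w : G) :
    (E * F).coeff (w - v) = ∑ x, E.coeff (x - v) * F.coeff (w - x) := by
  rw [AddMonoidAlgebra.coeff_mul_apply_left, Finsupp.sum_fintype _ _ (by simp),
    ← (Equiv.subRight v).sum_comp]
  refine Finset.sum_congr rfl fun x _ => ?_
  simp only [Equiv.subRight_apply]
  congr 2
  abel

/-- A coefficient of the product is a sum over midpoints `x`, and `γ (j + i)` merely permutes these.
-/
theorem InvCoeff.mul {E F : AddMonoidAlgebra R G} (hE : InvCoeff γ i E) (hF : InvCoeff γ k F) :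
    InvCoeff γ (i + k) (E * F) := by
  intro j v w
  rw [coeff_mul_eq_sum, coeff_mul_eq_sum, ← Equiv.sum_comp (γ (j + i))]
  refine Finset.sum_congr rfl fun x _ => ?_
  rw [hE, ← add_assoc, hF]

theorem InvCoeff.pow {F : AddMonoidAlgebra R G} (hF : InvCoeff γ i F) (m : ℕ) :
    InvCoeff γ (m * i) (F ^ m) := by
  induction m with
  | zero =>
    classical
    intro j v w
    simp [AddMonoidAlgebra.one_def, Finsupp.single_apply, eq_comm (a := (0 : G)), sub_eq_zero]
  | succ m ih =>
    rw [Nat.cast_succ, add_mul, one_mul, pow_succ]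
    exact ih.mul hF

/-- Modulo a prime `p`, the `p`-th power of the sum of the elements of `A` in the group algebra
is the sum of their multiples by `p`. -/
theorem Inv.frobenius [DecidableEq G] (p : ℕ) [Fact p.Prime] {A : Finset G} (hA : Inv γ i (A : Set G)) :
    Inv γ (p * i) {x | ¬ p ∣ (A.filter fun s => p • s = x).card} := by
  classical
  let F : AddMonoidAlgebra (ZMod p) G := ∑ s ∈ A, AddMonoidAlgebra.single s 1
  have hF : ∀ x, F.coeff x = if x ∈ A then 1 else 0 := by
    intro x
    simp [F, AddMonoidAlgebra.coeff_sum, Finsupp.single_apply]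
  have hinv : InvCoeff γ i F := by
    intro j v w
    rw [hF, hF]
    exact if_congr (hA j v w) rfl rfl
  have hpow : ∀ x, (F ^ p).coeff x = ((A.filter fun s => p • s = x).card : ZMod p) := by
    intro x
    have : CharP (AddMonoidAlgebra (ZMod p) G) p :=
      charP_of_injective_algebraMap (algebraMap (ZMod p) _).injective p
    rw [sum_pow_char p]
    simp [AddMonoidAlgebra.single_pow, AddMonoidAlgebra.coeff_sum, Finsupp.single_apply]
  intro j v w
  have := hinv.pow p j v w
  rw [hpow, hpow] at this
  simp only [Set.mem_ofPred_eq, ← ZMod.natCast_eq_zero_iff]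
  rw [this]

end Frobenius

end CirculantDoubleCover

namespace CirculantDoubleCover

/-! ### Automorphisms of the double cover as pairs of permutations. -/

section Graphs

variable {V : Type*} {X : SimpleGraph V}

/-- The automorphism of the double cover acting by `α` on the first copy of the vertex set and
by `β` on the second. -/
def pairAut (α β : Equiv.Perm V) (h : ∀ v w, X.Adj (α v) (β w) ↔ X.Adj v w) :
    X.bipartiteDoubleCover ≃g X.bipartiteDoubleCover where
  toEquiv := Equiv.sumCongr α β
  map_rel_iff' := by
    rintro (v | v) (w | w)
    · simp
    · simpa using h v w
    · simpa [X.adj_comm] using h w v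
    · simp

theorem prodAut_inl (ρ : X ≃g X) (σ : Equiv.Perm Bool) (v : V) :
    prodAut X ρ σ (.inl v) = if σ false then .inr (ρ v) else .inl (ρ v) := rfl

theorem prodAut_inr (ρ : X ≃g X) (σ : Equiv.Perm Bool) (v : V) :
    prodAut X ρ σ (.inr v) = if σ true then .inr (ρ v) else .inl (ρ v) := rfl

/-- A member of `Aut X × S₂` that keeps the layers acts on both by the same permutation. -/
theorem unstable_of_pair (α β : Equiv.Perm V) (h : ∀ v w, X.Adj (α v) (β w) ↔ X.Adj v w)
    (hne : α ≠ β) : Unstable X := by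
  intro htop
  have hmem : pairAut α β h ∈ (prodAutHom X).range := htop ▸ Subgroup.mem_top _
  obtain ⟨⟨ρ, σ⟩, hρ⟩ := hmem
  have key : ∀ x, prodAut X ρ σ x = pairAut α β h x := fun x => DFunLike.congr_fun hρ x
  refine hne (Equiv.ext fun v => ?_)
  have h0 : _ = Sum.inl (α v) := key (.inl v)
  have h1 : _ = Sum.inr (β v) := key (.inr v)
  rw [prodAut_inl] at h0
  rw [prodAut_inr] at h1
  cases hs0 : σ false <;> cases hs1 : σ true <;> simp_all

/-- An automorphism of the double cover of a connected nonbipartite graph either preserves or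
exchanges the two copies of the vertex set. -/
theorem isLeft_const (hc : X.Connected) (hb : ¬ X.IsBipartite)
    (φ : X.bipartiteDoubleCover ≃g X.bipartiteDoubleCover) :
    ∃ e : Bool, ∀ v, (φ (.inl v)).isLeft = e ∧ (φ (.inr v)).isLeft = !e := by
  have hadj : ∀ x y, X.bipartiteDoubleCover.Adj x y → y.isLeft = !x.isLeft := by
    rintro (v | v) (w | w) h <;> simp_all
  have step : ∀ v w, X.Adj v w → (φ (.inr w)).isLeft = !(φ (.inl v)).isLeft := by
    intro v w h
    exact hadj _ _ (φ.map_rel_iff.2 (by simpa using h))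
  have hconst : ∀ f : V → Bool, (∀ v w, X.Adj v w → f v = f w) → ∀ v w, f v = f w := by
    intro f hf v w
    obtain ⟨p⟩ := hc.preconnected v w
    induction p with
    | nil => rfl
    | cons h _ ih => exact (hf _ _ h).trans ih
  obtain ⟨v₀⟩ := hc.nonempty
  -- `f v` and `g v` record the layers that receive the two copies of `v`. Along an edge `g w = !f
  -- v`, so `xor (f v) (g v)` is constant; hence either `f` is constant or `f` is a proper
  -- 2-colouring.
  obtain ⟨f, hf⟩ : ∃ f : V → Bool, f = fun v => (φ (.inl v)).isLeft := ⟨_, rfl⟩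
  obtain ⟨g, hg⟩ : ∃ g : V → Bool, g = fun v => (φ (.inr v)).isLeft := ⟨_, rfl⟩
  have hf' : ∀ v, (φ (.inl v)).isLeft = f v := fun v => by rw [hf]
  have hg' : ∀ v, (φ (.inr v)).isLeft = g v := fun v => by rw [hg]
  simp only [hf', hg'] at step ⊢
  have hd := hconst (fun v => xor (f v) (g v)) (by
    intro v w h
    simp only [step v w h, step w v h.symm]
    cases f v <;> cases f w <;> rfl)
  by_cases h0 : xor (f v₀) (g v₀) = true
  · have h1 : ∀ v, g v = !f v := by
      intro v
      have := (hd v v₀).trans h0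
      revert this
      cases f v <;> cases g v <;> simp
    have h2 := hconst f (by
      intro v w h
      have := step v w h
      rw [h1] at this
      simpa using this.symm)
    exact ⟨f v₀, fun v => ⟨h2 v v₀, by rw [h1, h2 v v₀]⟩⟩
  · refine absurd ?_ hb
    have h1 : ∀ v, g v = f v := by
      intro v
      have := hd v v₀
      revert this h0
      cases xor (f v₀) (g v₀) <;> cases f v <;> cases g v <;> simp
    have C : X.Coloring Bool := SimpleGraph.Coloring.mk f (by
      intro v w h he
      have := step v w h
      rw [h1, he] at this
      cases f w <;> simp at this)
    simpa using C.colorable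

/-- A layer-preserving automorphism is a pair of this kind. If such pairs were always diagonal, it
would come from `Aut X`, and composing with the swap would settle the layer-reversing automorphisms.
-/
theorem exists_pair_of_unstable (hc : X.Connected) (hb : ¬ X.IsBipartite) (hu : Unstable X) :
    ∃ α β : Equiv.Perm V, (∀ v w, X.Adj (α v) (β w) ↔ X.Adj v w) ∧ α ≠ β := by
  classical
  by_contra! hcon
  refine hu ?_
  have hpres : ∀ φ : X.bipartiteDoubleCover ≃g X.bipartiteDoubleCover,
      (∀ v, (φ (.inl v)).isLeft = true ∧ (φ (.inr v)).isLeft = false) →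
      ∃ ρ : X ≃g X, prodAut X ρ 1 = φ := by
    intro φ hφ
    have h1 : ∀ v, ∃ w, φ (.inl v) = .inl w := fun v => Sum.isLeft_iff.1 (hφ v).1
    have h2 : ∀ v, ∃ w, φ (.inr v) = .inr w := fun v =>
      Sum.isRight_iff.1 (by simpa using (hφ v).2)
    choose α hα using h1
    choose β hβ using h2
    have hαb : α.Bijective := by
      constructor
      · intro v w h
        have : φ (.inl v) = φ (.inl w) := by rw [hα, hα, h]
        exact Sum.inl_injective (φ.injective this)
      · intro w
        obtain ⟨v | v, hv⟩ := φ.surjective (.inl w)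
        · exact ⟨v, Sum.inl_injective ((hα v).symm.trans hv)⟩
        · exact absurd ((hβ v).symm.trans hv) Sum.inr_ne_inl
    have hβb : β.Bijective := by
      constructor
      · intro v w h
        have : φ (.inr v) = φ (.inr w) := by rw [hβ, hβ, h]
        exact Sum.inr_injective (φ.injective this)
      · intro w
        obtain ⟨v | v, hv⟩ := φ.surjective (.inr w)
        · exact absurd ((hα v).symm.trans hv) Sum.inl_ne_inr
        · exact ⟨v, Sum.inr_injective ((hβ v).symm.trans hv)⟩
    have hadj : ∀ v w, X.Adj (α v) (β w) ↔ X.Adj v w := by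
      intro v w
      have := φ.map_rel_iff (a := .inl v) (b := .inr w)
      rw [hα, hβ] at this
      simpa using this
    have heq := hcon (Equiv.ofBijective α hαb) (Equiv.ofBijective β hβb) hadj
    have heq' : ∀ v, α v = β v := fun v => DFunLike.congr_fun heq v
    refine ⟨⟨Equiv.ofBijective α hαb, ?_⟩, ?_⟩
    · intro v w
      have := hadj v w
      rwa [← heq'] at this
    · refine RelIso.ext ?_
      rintro (v | v)
      · rw [hα]; rfl
      · rw [hβ, ← heq']; rfl
  have hswap : ∀ ρ : X ≃g X, ∀ φ : X.bipartiteDoubleCover ≃g X.bipartiteDoubleCover,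
      prodAut X ρ 1 = prodAut X 1 (Equiv.boolNot) * φ → φ = prodAut X ρ Equiv.boolNot := by
    intro ρ φ h
    refine RelIso.ext fun x => ?_
    have hinv : ∀ y, prodAut X 1 Equiv.boolNot (prodAut X 1 Equiv.boolNot y) = y := by
      rintro (v | v) <;> rfl
    have h3 : prodAut X ρ 1 x = prodAut X 1 Equiv.boolNot (φ x) := DFunLike.congr_fun h x
    rw [← hinv (φ x), ← h3]
    rcases x with v | v <;> rfl
  rw [eq_top_iff]
  intro φ _
  obtain ⟨e, he⟩ := isLeft_const hc hb φ
  cases e with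
  | true =>
    obtain ⟨ρ, hρ⟩ := hpres φ he
    exact ⟨(ρ, 1), hρ⟩
  | false =>
    obtain ⟨ρ, hρ⟩ := hpres (prodAut X 1 Equiv.boolNot * φ) (by
      intro v
      obtain ⟨h1, h2⟩ := he v
      have h3 : ∀ y, (prodAut X 1 Equiv.boolNot y).isLeft = !y.isLeft := by
        rintro (v | v) <;> rfl
      constructor
      · exact (h3 _).trans (congrArg not h1)
      · exact (h3 _).trans (congrArg not h2))
    exact ⟨(ρ, Equiv.boolNot), (hswap ρ φ hρ).symm⟩

end Graphs

/-! ### Connection sets `{±a, ±b, ±c}`. -/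

section Circulants

variable {n : ℕ} {a b c : ZMod n} {S : Finset (ZMod n)}

theorem mem_pm {x : ZMod n} :
    x ∈ pm a b c ↔ x = a ∨ x = -a ∨ x = b ∨ x = -b ∨ x = c ∨ x = -c := by
  simp [pm]

theorem neg_mem_pm {x : ZMod n} (hx : x ∈ pm a b c) : -x ∈ pm a b c := by
  rw [mem_pm] at *
  rcases hx with rfl | rfl | rfl | rfl | rfl | rfl <;> simp

theorem pm_swap_left : pm a b c = pm b a c := by
  ext x; simp only [mem_pm]; tauto

theorem pm_swap_right : pm a b c = pm a c b := by
  ext x; simp only [mem_pm]; tauto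

theorem pm_neg_left : pm a b c = pm (-a) b c := by
  ext x; simp only [mem_pm, neg_neg]; tauto

theorem pm_neg_mid : pm a b c = pm a (-b) c := by
  ext x; simp only [mem_pm, neg_neg]; tauto

theorem pm_neg_right : pm a b c = pm a b (-c) := by
  ext x; simp only [mem_pm, neg_neg]; tauto

/-- The elements `±a, ±b, ±c` are distinct. -/
def Distinct (a b c : ZMod n) : Prop :=
  [a, -a, b, -b, c, -c].Nodup

theorem distinct_of_card (h : (pm a b c).card = 6) : Distinct a b c := by
  have h1 : pm a b c = ([a, -a, b, -b, c, -c] : List (ZMod n)).toFinset := by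
    ext x; simp [mem_pm]
  rw [h1] at h
  have := (Multiset.toFinset_card_eq_card_iff_nodup
    (m := (([a, -a, b, -b, c, -c] : List (ZMod n)) : Multiset (ZMod n)))).1 (by simpa using h)
  simpa [Distinct] using this

/-- `circulantGraph` ignores loops, so valency six leaves no room for `0` or for coincidences among
the six listed elements. -/
theorem card_of_regular [NeZero n] (h : (cay (pm a b c)).IsRegularOfDegree 6) :
    (pm a b c).card = 6 ∧ 0 ∉ pm a b c := by
  classical
  have h0 := h 0
  rw [← SimpleGraph.card_neighborSet_eq_degree] at h0
  have hS : (cay (pm a b c)).neighborSet 0 = ((pm a b c).erase 0 : Finset (ZMod n)) := by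
    ext x
    simp only [SimpleGraph.mem_neighborSet, SimpleGraph.circulantGraph_adj, zero_sub, sub_zero,
      Finset.coe_erase, Set.mem_sdiff, Finset.mem_coe, Set.mem_singleton_iff]
    constructor
    · rintro ⟨h1, h2 | h2⟩
      · exact ⟨by simpa using neg_mem_pm h2, fun h => h1 h.symm⟩
      · exact ⟨h2, fun h => h1 h.symm⟩
    · rintro ⟨h1, h2⟩
      exact ⟨fun h => h2 h.symm, Or.inr h1⟩
  have h1 : ((pm a b c).erase 0).card = 6 := by
    rw [← h0, ← Nat.card_eq_fintype_card, hS, Nat.card_coe_set_eq, Set.ncard_coe_finset]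
  have h2 : (pm a b c).card ≤ 6 := Finset.card_le_six
  have h3 := Finset.card_le_card (Finset.erase_subset 0 (pm a b c))
  refine ⟨by omega, fun h4 => ?_⟩
  have := Finset.card_erase_of_mem h4
  omega

theorem cay_adj (hneg : ∀ s ∈ S, -s ∈ S) (h0 : 0 ∉ S) (v w : ZMod n) :
    (cay S).Adj v w ↔ w - v ∈ S := by
  rw [SimpleGraph.circulantGraph_adj]
  simp only [Finset.mem_coe]
  constructor
  · rintro ⟨_, h | h⟩
    · simpa using hneg _ h
    · exact h
  · intro h
    refine ⟨?_, Or.inr h⟩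
    rintro rfl
    simp [h0] at h

/-- A pair of distinct permutations carrying every edge to an edge shows instability. -/
theorem unstable_of_mapsTo [NeZero n] (hneg : ∀ s ∈ S, -s ∈ S) (h0 : 0 ∉ S)
    (α β : Equiv.Perm (ZMod n)) (h : ∀ v w, w - v ∈ S → β w - α v ∈ S) (hne : α ≠ β) :
    Unstable (cay S) := by
  refine unstable_of_pair α β (fun v w => ?_) hne
  rw [cay_adj hneg h0, cay_adj hneg h0]
  refine ⟨fun hw => ?_, h v w⟩
  -- The edge map at `v` is an injection of the finite set `S` into itself, hence onto; this gives
  -- the converse implication.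
  let f : ZMod n → ZMod n := fun s => β (v + s) - α v
  have hf : Set.MapsTo f (S : Set (ZMod n)) S := fun s hs => h v (v + s) (by simpa using hs)
  have hinj : Set.InjOn f (S : Set (ZMod n)) := by
    intro s _ t _ hst
    simpa [f] using hst
  obtain ⟨s, hs, hs'⟩ := Finset.surjOn_of_injOn_of_card_le f hf hinj le_rfl hw
  have : v + s = w := by simpa [f] using hs'
  rw [← this]
  simpa using hs

end Circulants

end CirculantDoubleCover

/-! ### The pair of permutations of a nontrivially unstable circulant. -/

namespace CirculantDoubleCover

variable {n : ℕ} {a b c : ZMod n} {S : Finset (ZMod n)} {γ : ZMod 2 → Equiv.Perm (ZMod n)}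

theorem Distinct.ne (h : Distinct a b c) :
    a ≠ -a ∧ b ≠ -b ∧ c ≠ -c ∧ a ≠ b ∧ a ≠ -b ∧ a ≠ c ∧ a ≠ -c ∧ b ≠ c ∧ b ≠ -c := by
  unfold Distinct at h
  simp only [List.nodup_cons, List.mem_cons, List.not_mem_nil, not_or] at h
  tauto

theorem Distinct.card_filter (h : Distinct a b c) (P : ZMod n → Prop) [DecidablePred P] :
    ((pm a b c).filter P).card = (if P a then 1 else 0) + (if P (-a) then 1 else 0) +
      (if P b then 1 else 0) + (if P (-b) then 1 else 0) +
      (if P c then 1 else 0) + (if P (-c) then 1 else 0) := by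
  unfold Distinct at h
  simp only [List.nodup_cons, List.mem_cons, List.not_mem_nil, or_false] at h
  obtain ⟨h1, h2, h3, h4, h5, -⟩ := h
  rw [Finset.card_filter, pm, Finset.sum_insert (by simpa using h1),
    Finset.sum_insert (by simpa using h2), Finset.sum_insert (by simpa using h3),
    Finset.sum_insert (by simpa using h4), Finset.sum_insert (by simpa using h5),
    Finset.sum_singleton]
  ring

/-- The data extracted from a nontrivially unstable circulant graph of valency six: a pair of
distinct permutations carrying edges to edges, for a connection set that is symmetric, generating,
not bipartite and without periods. -/
structure UnstablePair (S : Finset (ZMod n)) (γ : ZMod 2 → Equiv.Perm (ZMod n)) : Prop where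
  inv : Inv γ 1 (S : Set (ZMod n))
  ne : ¬ Lin γ 0 1 0
  card : S.card = 6
  neg : ∀ s ∈ S, -s ∈ S
  gen : AddSubgroup.closure (S : Set (ZMod n)) = ⊤
  nonbip : ∀ K : AddSubgroup (ZMod n), (∀ s ∈ S, s ∉ K) → ¬ ∀ s ∈ S, ∀ t ∈ S, s - t ∈ K
  twinFree : ∀ x, (∀ s ∈ S, x + s ∈ S) → x = 0

theorem exists_unstablePair [NeZero n] (hcard : S.card = 6) (hneg : ∀ s ∈ S, -s ∈ S)
    (h0 : 0 ∉ S) (h : NontriviallyUnstable (cay S)) : ∃ γ, UnstablePair S γ := by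
  classical
  obtain ⟨hc, hb, ht, hu⟩ := h
  obtain ⟨α, β, hadj, hne⟩ := exists_pair_of_unstable hc hb hu
  have hgen : AddSubgroup.closure (S : Set (ZMod n)) = ⊤ := by
    rw [eq_top_iff]
    intro x _
    have key : ∀ v w, (cay S).Reachable v w → w - v ∈ AddSubgroup.closure (S : Set (ZMod n)) := by
      rintro v w ⟨p⟩
      induction p with
      | nil => simp
      | @cons u v w h _ ih =>
        rw [cay_adj hneg h0] at h
        have := add_mem ih (AddSubgroup.subset_closure (Finset.mem_coe.2 h))
        simpa using this
    simpa using key 0 x (hc.preconnected 0 x)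
  refine ⟨fun j => if j = 0 then α else β, ?_, ?_, hcard, hneg, hgen, ?_, ?_⟩
  · intro j v w
    have h1 : ∀ v w, β w - α v ∈ S ↔ w - v ∈ S := by
      intro v w
      rw [← cay_adj hneg h0, ← cay_adj hneg h0]; exact hadj v w
    have h2 : ∀ s, s ∈ S ↔ -s ∈ S := fun s => ⟨hneg s, fun h => by simpa using hneg _ h⟩
    have h3 : j = 0 ∨ j = 1 := by revert j; decide
    rcases h3 with rfl | rfl
    · simpa using h1 v w
    · have := h1 w v
      rw [h2, h2 (v - w)] at this
      simpa [CharTwo.add_self_eq_zero] using this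
  · intro hL
    refine hne (Equiv.ext fun v => ?_)
    simpa using (hL 0 v).symm
  · intro K hK hKK
    -- Every vertex lies in `K` or in the coset of `K` that contains `S`, so membership in `K` is a
    -- proper 2-colouring.
    have hcov : ∀ v, v ∈ K ∨ ∀ s ∈ S, v - s ∈ K := by
      intro v
      have hv : v ∈ AddSubgroup.closure (S : Set (ZMod n)) := hgen ▸ AddSubgroup.mem_top _
      induction hv using AddSubgroup.closure_induction with
      | mem x hx => exact Or.inr fun s hs => hKK x hx s hs
      | zero => exact Or.inl K.zero_mem
      | add x y _ _ hx hy =>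
        rcases hx with hx | hx <;> rcases hy with hy | hy
        · exact Or.inl (add_mem hx hy)
        · exact Or.inr fun s hs => by rw [add_sub_assoc]; exact add_mem hx (hy s hs)
        · exact Or.inr fun s hs => by rw [add_sub_right_comm]; exact add_mem (hx s hs) hy
        · by_cases hE : ∃ s, s ∈ S
          · obtain ⟨s, hs⟩ := hE
            have := add_mem (hx s hs) (hy (-s) (hneg s hs))
            exact Or.inl (by simpa using this)
          · exact Or.inr fun s hs => absurd ⟨s, hs⟩ hE
      | neg x _ hx =>
        rcases hx with hx | hx
        · exact Or.inl (neg_mem hx)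
        · refine Or.inr fun s hs => ?_
          have := neg_mem (hx (-s) (hneg s hs))
          rw [neg_sub, sub_eq_add_neg, add_comm] at this
          simpa [sub_eq_add_neg] using this
    refine hb ?_
    have C : (cay S).Coloring Bool := SimpleGraph.Coloring.mk (fun v => decide (v ∈ K)) (by
      intro v w h he
      rw [cay_adj hneg h0] at h
      simp only [decide_eq_decide] at he
      rcases hcov v with hv | hv
      · exact hK _ h (sub_mem (he.1 hv) hv)
      · have hw : w ∈ K := by simpa using hv _ (hneg _ h)
        exact hK _ h (sub_mem hw (he.2 hw)))
    simpa using C.colorable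
  · intro x hx
    refine (ht 0 x ?_).symm
    have hsub : ∀ s, x + s ∈ S ↔ s ∈ S := by
      intro s
      refine ⟨fun h => ?_, hx s⟩
      obtain ⟨t, ht, hts⟩ := Finset.surjOn_of_injOn_of_card_le (fun s => x + s)
        (s := S) (t := S) hx (by intro s _ t _ h; simpa using h) le_rfl h
      have : t = s := by simpa using hts
      exact this ▸ ht
    ext w
    simp only [SimpleGraph.mem_neighborSet, cay_adj hneg h0]
    rw [← hsub (w - x)]
    simp

namespace UnstablePair

variable (U : UnstablePair S γ)
include U

theorem distinct (hS : S = pm a b c) : Distinct a b c := distinct_of_card (hS ▸ U.card)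

/-- A function on two copies of `ℤ_n` that is periodic under the edges of the double cover is
constant. -/
theorem const {Y : Type*} (ψ : ZMod 2 → ZMod n → Y)
    (h : ∀ s ∈ S, ∀ j v, ψ (j + 1) (v + s) = ψ j v) (j v) : ψ j v = ψ 0 0 := by
  -- The periods `(i, x)` of `ψ` form a subgroup of `ℤ₂ × ℤ_n` containing `{1} × S`. It contains
  -- `(1, 0)`, since otherwise `S` would lie in a nontrivial coset of its grade-zero part `K`,
  -- against `nonbip`.
  let P : ZMod 2 → ZMod n → Prop := fun i x => ∀ j v, ψ (j + i) (v + x) = ψ j v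
  have hadd : ∀ i k x y, P i x → P k y → P (i + k) (x + y) := by
    intro i k x y hx hy j v
    rw [← add_assoc, ← add_assoc, hy, hx]
  have hneg : ∀ i x, P i x → P i (-x) := by
    intro i x hx j v
    have := hx (j + i) (v + -x)
    rwa [grade_add_self, neg_add_cancel_right, eq_comm] at this
  have hzero : P 0 0 := fun j v => by simp
  let K : AddSubgroup (ZMod n) :=
    { carrier := {x | P 0 x}
      zero_mem' := hzero
      add_mem' := fun {x y} hx hy => by simpa using hadd 0 0 x y hx hy
      neg_mem' := fun {x} hx => hneg 0 x hx }
  have h2 : ∀ x y, P 1 x → P 1 y → P 0 (x + y) := by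
    intro x y hx hy
    have := hadd 1 1 x y hx hy
    rwa [show (1 : ZMod 2) + 1 = 0 from rfl] at this
  have h11 : P 1 0 := by
    by_contra hP
    refine U.nonbip K (fun s hs hsK => hP ?_) fun s hs t ht => ?_
    · have := hadd 1 0 s (-s) (h s hs) (hneg 0 s hsK)
      simpa using this
    · rw [sub_eq_add_neg]
      exact h2 s (-t) (h s hs) (hneg 1 t (h t ht))
  have hK : K = ⊤ := by
    rw [eq_top_iff, ← U.gen, AddSubgroup.closure_le]
    intro s hs
    have := h2 s 0 (h s hs) h11
    rwa [add_zero] at this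
  have h0 : ∀ x, P 0 x := fun x => (hK ▸ AddSubgroup.mem_top x : x ∈ K)
  have h3 := h0 v 0 0
  rw [zero_add, zero_add] at h3
  have h4 : j = 0 ∨ j = 1 := by revert j; decide
  rcases h4 with rfl | rfl
  · exact h3
  · have := h11 0 v
    rw [zero_add, add_zero] at this
    rw [this, h3]

/-- If `γ` carries every translation by a connecting element to a translation, then the
connection set is fixed by an affine map `x ↦ m x + t` with `t` of order two. -/
theorem exists_unit [NeZero n] (h : ∀ s ∈ S, ∃ y, Lin γ s 1 y) :
    ∃ (m : (ZMod n)ˣ) (t : ZMod n), t ≠ 0 ∧ t + t = 0 ∧ ∀ s ∈ S, m * s + t ∈ S := by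
  -- Displacements by `x` and the gap between the layers do not change along edges, so they are
  -- constant. Thus `γ 0` is affine with slope `γ 0 1 - γ 0 0`, and `γ 1` is its translate by `t`.
  have hD : ∀ x j v, γ j (v + x) - γ j v = γ 0 x - γ 0 0 := by
    intro x j v
    have := U.const (fun j v => γ j (v + x) - γ j v) (by
      intro s hs j v
      obtain ⟨y, hy⟩ := h s hs
      rw [add_right_comm, hy, hy]
      abel) j v
    simpa using this
  have ht : ∀ j v, γ (j + 1) v - γ j v = γ 1 0 - γ 0 0 := by
    intro j v
    have := U.const (fun j v => γ (j + 1) v - γ j v) (by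
      intro s hs j v
      obtain ⟨y, hy⟩ := h s hs
      rw [hy, hy]
      abel) j v
    simpa using this
  have hmul : ∀ k : ℕ, γ 0 (k : ZMod n) - γ 0 0 = (γ 0 1 - γ 0 0) * k := by
    intro k
    induction k with
    | zero => simp
    | succ k ih =>
      have := hD 1 0 k
      rw [Nat.cast_succ, mul_add, ← ih, mul_one, ← this]
      abel
  have hmul' : ∀ x, γ 0 x - γ 0 0 = (γ 0 1 - γ 0 0) * x := by
    intro x
    simpa using hmul x.val
  obtain ⟨z, hz⟩ := (γ 0).surjective (γ 0 0 + 1)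
  have hunit : (γ 0 1 - γ 0 0) * z = 1 := by rw [← hmul', hz]; abel
  refine ⟨⟨γ 0 1 - γ 0 0, z, hunit, by rw [mul_comm, hunit]⟩, γ 1 0 - γ 0 0, ?_, ?_, ?_⟩
  · intro h0
    refine U.ne fun j v => ?_
    rw [add_zero, add_zero]
    exact sub_eq_zero.1 ((ht j v).trans h0)
  · have h1 := ht 1 0
    rw [show (1 : ZMod 2) + 1 = 0 from rfl] at h1
    nth_rewrite 1 [← h1]
    abel
  · intro s hs
    have h1 : γ (0 + 1) s - γ 0 0 ∈ (S : Set (ZMod n)) := (U.inv 0 0 s).2 (by simpa)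
    have h2 := ht 0 s
    have h3 := hmul' s
    rw [Finset.mem_coe] at h1
    convert h1 using 1
    rw [sub_eq_iff_eq_add] at h2
    simp only
    rw [h2, ← h3]
    abel

/-- Parity: the generators do not all have the same parity. -/
theorem parity_ne (hn : 2 ∣ n) (hS : S = pm a b c) :
    ¬ (ZMod.castHom hn (ZMod 2) a = ZMod.castHom hn (ZMod 2) b ∧
      ZMod.castHom hn (ZMod 2) b = ZMod.castHom hn (ZMod 2) c) := by
  rintro ⟨hab, hbc⟩
  set χ := ZMod.castHom hn (ZMod 2) with hχ
  have hall : ∀ s ∈ S, χ s = χ a := by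
    intro s hs
    rw [hS, mem_pm] at hs
    rcases hs with rfl | rfl | rfl | rfl | rfl | rfl <;>
      simp [hab, hbc, CharTwo.neg_eq]
  -- A common even parity contradicts generation, a common odd parity contradicts nonbipartiteness.
  by_cases h0 : χ a = 0
  · have hle : AddSubgroup.closure (S : Set (ZMod n)) ≤ χ.toAddMonoidHom.ker := by
      rw [AddSubgroup.closure_le]
      intro s hs
      have := hall s hs
      rw [h0] at this
      exact this
    rw [U.gen, top_le_iff] at hle
    have h1 : (1 : ZMod n) ∈ χ.toAddMonoidHom.ker := hle ▸ AddSubgroup.mem_top _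
    have h2 : χ 1 = 0 := h1
    rw [map_one] at h2
    exact one_ne_zero h2
  · refine U.nonbip χ.toAddMonoidHom.ker (fun s hs h => h0 ?_) fun s hs t ht => ?_
    · rw [← hall s hs]; exact h
    · have : χ (s - t) = 0 := by rw [map_sub, hall s hs, hall t ht, sub_self]
      exact this

/-- There are no nontrivially unstable circulant graphs of odd order. -/
theorem even [NeZero n] : 2 ∣ n := by
  by_contra hn
  have hodd : Nat.Coprime 2 n := (Nat.Prime.coprime_iff_not_dvd Nat.prime_two).2 hn
  let u : (ZMod n)ˣ := ZMod.unitOfCoprime 2 hodd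
  have hu : (u : ZMod n) = 2 := by simp [u, ZMod.coe_unitOfCoprime]
  -- Frobenius for `p = 2` puts `2S` into grade 0. As `2` is a unit, this can be iterated up to the
  -- order of `2`, when `S` itself comes back, now in grade 0.
  have hstep : ∀ m : ℕ, Inv γ 0 {x : ZMod n | ((u⁻¹ ^ (m + 1) : (ZMod n)ˣ) : ZMod n) * x ∈ S} := by
    have key : ∀ i, ∀ A : Finset (ZMod n), Inv γ i (A : Set (ZMod n)) →
        Inv γ 0 {x : ZMod n | ((u⁻¹ : (ZMod n)ˣ) : ZMod n) * x ∈ A} := by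
      intro i A hA
      have : Fact (Nat.Prime 2) := ⟨Nat.prime_two⟩
      have h1 := hA.frobenius 2
      rw [show ((2 : ℕ) : ZMod 2) = 0 from rfl, zero_mul] at h1
      refine h1.congr ?_
      ext x
      have h2 : ∀ s : ZMod n, 2 • s = x ↔ s = ((u⁻¹ : (ZMod n)ˣ) : ZMod n) * x := by
        intro s
        rw [nsmul_eq_mul, Nat.cast_ofNat, ← hu, Units.eq_inv_mul_iff_mul_eq]
      simp only [h2, Set.mem_ofPred_eq, Finset.filter_eq']
      split_ifs with h <;> simp [h]
    intro m
    induction m with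
    | zero => simpa using key 1 S U.inv
    | succ m ih =>
      have := key 0 (S.image fun s => ((u ^ (m + 1) : (ZMod n)ˣ) : ZMod n) * s) (by
        refine ih.congr ?_
        ext x
        simp only [Set.mem_ofPred_eq, Finset.coe_image, Set.mem_image, Finset.mem_coe]
        constructor
        · intro h
          refine ⟨_, h, ?_⟩
          rw [← mul_assoc, ← Units.val_mul, inv_pow, mul_inv_cancel, Units.val_one, one_mul]
        · rintro ⟨s, hs, rfl⟩
          rw [← mul_assoc, ← Units.val_mul, inv_pow, inv_mul_cancel, Units.val_one, one_mul]
          exact hs)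
      refine this.congr ?_
      ext x
      simp only [Set.mem_ofPred_eq, Finset.mem_image]
      constructor
      · rintro ⟨s, hs, hsx⟩
        rw [pow_succ, Units.val_mul, mul_assoc, ← hsx, ← mul_assoc, ← Units.val_mul, inv_pow,
          inv_mul_cancel, Units.val_one, one_mul]
        exact hs
      · intro h
        refine ⟨_, h, ?_⟩
        rw [← mul_assoc, ← Units.val_mul, pow_succ u⁻¹, ← mul_assoc, inv_pow, mul_inv_cancel,
          one_mul]
  obtain ⟨m, hm⟩ := Nat.exists_eq_succ_of_ne_zero (orderOf_pos u⁻¹).ne'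
  have h0 : Inv γ 0 (S : Set (ZMod n)) := by
    have := hstep m
    rw [← Nat.succ_eq_add_one, ← hm, pow_orderOf_eq_one] at this
    simpa using this
  refine U.ne fun j v => ?_
  rw [add_zero, add_zero]
  -- With `S` invariant in both grades, `γ j v` and `γ (j + 1) v` have the same neighbours, so they
  -- differ by a period of `S`.
  have htw := U.twinFree (γ j v - γ (j + 1) v) (by
    intro s hs
    obtain ⟨w, hw⟩ := (γ (j + 1)).surjective (γ (j + 1) v + -s)
    have h1 : w - v ∈ (S : Set (ZMod n)) := by
      rw [← h0 (j + 1), add_zero, hw]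
      simpa using U.neg s hs
    have h2 := (U.inv j v w).2 h1
    rw [hw] at h2
    have h3 := U.neg _ h2
    convert h3 using 1
    abel)
  exact (sub_eq_zero.1 htw).symm

end UnstablePair

end CirculantDoubleCover

/-! ### Affine symmetries of the connection set: families 6 and 7. -/

namespace CirculantDoubleCover

section Arithmetic

variable {n : ℕ} [NeZero n]

theorem eq_half_of_add_self {t : ZMod n} (h0 : t ≠ 0) (h : t + t = 0) :
    2 * t.val = n ∧ t = ((n / 2 : ℕ) : ZMod n) := by
  have h1 : n ∣ 2 * t.val := by
    rw [← ZMod.natCast_eq_zero_iff]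
    push_cast
    rw [ZMod.natCast_zmod_val, two_mul, h]
  have h2 := t.val_lt
  have h3 : t.val ≠ 0 := fun h => h0 ((ZMod.val_eq_zero t).1 h)
  obtain ⟨q, hq⟩ := h1
  have h4 : q = 1 := by
    rcases q with _ | _ | q
    · omega
    · rfl
    · exfalso
      have : n * (q + 2) = n * q + 2 * n := by ring
      have h5 : 0 ≤ n * q := Nat.zero_le _
      nlinarith
  subst h4
  refine ⟨by omega, ?_⟩
  rw [show n / 2 = t.val by omega, ZMod.natCast_zmod_val]

theorem half_unique {t t' : ZMod n} (h0 : t ≠ 0) (h : t + t = 0) (h0' : t' ≠ 0)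
    (h' : t' + t' = 0) : t = t' :=
  (eq_half_of_add_self h0 h).2.trans (eq_half_of_add_self h0' h').2.symm

theorem eq_zero_or_half {t x : ZMod n} (h0 : t ≠ 0) (h : t + t = 0) (hx : x + x = 0) :
    x = 0 ∨ x = t := by
  by_cases h1 : x = 0
  · exact Or.inl h1
  · exact Or.inr (half_unique h1 hx h0 h)

theorem unit_mul_half (m : (ZMod n)ˣ) {t : ZMod n} (h0 : t ≠ 0) (h : t + t = 0) : m * t = t := by
  refine half_unique ?_ ?_ h0 h
  · rwa [Ne, Units.mul_right_eq_zero]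
  · rw [← mul_add, h, mul_zero]

/-- If `m x + t = x` for a unit `m` and the element `t` of order two, then `4` divides the
modulus. -/
theorem four_dvd_of_affine_fixed (m : (ZMod n)ˣ) {t x : ZMod n} (h0 : t ≠ 0) (h : t + t = 0)
    (hx : m * x + t = x) : 4 ∣ n := by
  have ht := (eq_half_of_add_self h0 h)
  have hn : 2 ∣ n := ⟨_, ht.1.symm⟩
  have h1 := congrArg (ZMod.castHom hn (ZMod 2)) hx
  have hm : ZMod.castHom hn (ZMod 2) (m : ZMod n) = 1 := by
    have : IsUnit (ZMod.castHom hn (ZMod 2) (m : ZMod n)) := m.isUnit.map _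
    revert this
    generalize ZMod.castHom hn (ZMod 2) (m : ZMod n) = z
    revert z; decide
  rw [map_add, map_mul, hm, one_mul, add_eq_left, ht.2, map_natCast,
    ZMod.natCast_eq_zero_iff] at h1
  omega

/-- Modulo 4 the unit is `1` or `-1`. The first equation kills `t` in one case and the second in the
other, so `4 ∣ n/2`. -/
theorem eight_dvd_of_affine (m : (ZMod n)ˣ) {t x y : ZMod n} (h0 : t ≠ 0) (h : t + t = 0)
    (hx : m * x + t = x) (hy : m * y + t = -y) : 8 ∣ n := by
  have hn : 4 ∣ n := four_dvd_of_affine_fixed m h0 h hx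
  have ht := (eq_half_of_add_self h0 h)
  have h1 := congrArg (ZMod.castHom hn (ZMod 4)) hx
  have h2 := congrArg (ZMod.castHom hn (ZMod 4)) hy
  have hm : IsUnit (ZMod.castHom hn (ZMod 4) (m : ZMod n)) := m.isUnit.map _
  rw [map_add, map_mul] at h1 h2
  rw [map_neg] at h2
  have h3 : ZMod.castHom hn (ZMod 4) t = 0 := by
    revert h1 h2 hm
    generalize ZMod.castHom hn (ZMod 4) (m : ZMod n) = z
    generalize ZMod.castHom hn (ZMod 4) x = x
    generalize ZMod.castHom hn (ZMod 4) y = y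
    generalize ZMod.castHom hn (ZMod 4) t = t
    revert z x y t
    decide
  rw [ht.2, map_natCast, ZMod.natCast_eq_zero_iff] at h3
  omega

end Arithmetic

variable {n : ℕ} [NeZero n] {a b c : ZMod n} {S : Finset (ZMod n)}
  {γ : ZMod 2 → Equiv.Perm (ZMod n)}

/-- If the map exchanges `b` and `c`, then `m² - 1` kills all generators and so is zero; if it sends
`c` to `-b`, then `m² + 1` kills `b`. Both use `mt = t`. -/
theorem family6_of_affine (hgen : AddSubgroup.closure (S : Set (ZMod n)) = ⊤)
    (hS : S = pm a b c) (m : (ZMod n)ˣ) {t : ZMod n} (h0 : t ≠ 0) (h : t + t = 0)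
    (ha : m * a + t = a) (hb : m * b + t = c) (hc : m * c + t = b ∨ m * c + t = -b) :
    Family6 n S := by
  have hmt := unit_mul_half m h0 h
  have hm2 : (m : ZMod n) ^ 2 = 1 ∨ ((m : ZMod n) ^ 2 + 1) * b = 0 := by
    rcases hc with hc | hc
    · left
      let f : ZMod n →+ ZMod n := AddMonoidHom.mulLeft ((m : ZMod n) ^ 2 - 1)
      have hle : AddSubgroup.closure (S : Set (ZMod n)) ≤ f.ker := by
        rw [AddSubgroup.closure_le]
        intro s hs
        have hfa : f a = 0 := by
          simp only [f, AddMonoidHom.coe_mulLeft]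
          linear_combination (m + 1 : ZMod n) * ha - hmt - h
        have hfb : f b = 0 := by
          simp only [f, AddMonoidHom.coe_mulLeft]
          linear_combination (m : ZMod n) * hb - hmt + hc - h
        have hfc : f c = 0 := by
          simp only [f, AddMonoidHom.coe_mulLeft]
          linear_combination (m : ZMod n) * hc - hmt + hb - h
        rw [hS, Finset.mem_coe, mem_pm] at hs
        rw [SetLike.mem_coe, AddMonoidHom.mem_ker]
        rcases hs with rfl | rfl | rfl | rfl | rfl | rfl <;> simp [hfa, hfb, hfc]
      rw [hgen, top_le_iff] at hle
      have h1 : (1 : ZMod n) ∈ f.ker := hle ▸ AddSubgroup.mem_top _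
      rw [AddMonoidHom.mem_ker] at h1
      simp only [f, AddMonoidHom.coe_mulLeft] at h1
      linear_combination h1
    · right
      linear_combination (m : ZMod n) * hb - hmt + hc - h
  have h4 := four_dvd_of_affine_fixed m h0 h ha
  have hcop := ZMod.val_coe_unit_coprime m
  have ht := (eq_half_of_add_self h0 h).2
  obtain ⟨k, hk⟩ := h4
  have ht' : t = 2 * (k : ZMod n) := by
    rw [ht, hk, show 4 * k / 2 = 2 * k by omega]; push_cast; ring
  have hn : (4 * k : ℤ) = (n : ℤ) := by rw [hk]; push_cast; ring
  refine ⟨k, a.val, b.val, (m : ZMod n).val, hk, ?_, ?_, ?_, ?_⟩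
  · simp only [Int.cast_natCast, ZMod.natCast_zmod_val]
    rw [hS, ← ht', ← hb]
    ext x
    rw [mem_pm]
    simp only [Finset.mem_insert, Finset.mem_singleton]
    rw [show -((m : ZMod n) * b + t) = -(m * b) + t by linear_combination -h]
  · rw [hn]; exact hcop
  · rw [hn, ← ZMod.intCast_eq_intCast_iff]
    push_cast
    rw [ZMod.natCast_zmod_val, ZMod.natCast_zmod_val, ← ht']
    linear_combination ha - h
  · rw [hn, ← ZMod.intCast_eq_intCast_iff, ← ZMod.intCast_eq_intCast_iff]
    push_cast
    rw [ZMod.natCast_zmod_val, ZMod.natCast_zmod_val]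
    exact hm2

theorem family7_of_affine (hgen : AddSubgroup.closure (S : Set (ZMod n)) = ⊤)
    (hS : S = pm a b c) (m : (ZMod n)ˣ) {t : ZMod n} (h0 : t ≠ 0) (h : t + t = 0)
    (ha : m * a + t = a) (hb : m * b + t = -b) (hc : m * c + t = -c) :
    Family7 n S := by
  have hmt := unit_mul_half m h0 h
  have hm2 : (m : ZMod n) ^ 2 = 1 := by
    let f : ZMod n →+ ZMod n := AddMonoidHom.mulLeft ((m : ZMod n) ^ 2 - 1)
    have hle : AddSubgroup.closure (S : Set (ZMod n)) ≤ f.ker := by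
      rw [AddSubgroup.closure_le]
      intro s hs
      have hfa : f a = 0 := by
        simp only [f, AddMonoidHom.coe_mulLeft]
        linear_combination (m + 1 : ZMod n) * ha - hmt - h
      have hfb : f b = 0 := by
        simp only [f, AddMonoidHom.coe_mulLeft]
        linear_combination (m - 1 : ZMod n) * hb - hmt
      have hfc : f c = 0 := by
        simp only [f, AddMonoidHom.coe_mulLeft]
        linear_combination (m - 1 : ZMod n) * hc - hmt
      rw [hS, Finset.mem_coe, mem_pm] at hs
      rw [SetLike.mem_coe, AddMonoidHom.mem_ker]
      rcases hs with rfl | rfl | rfl | rfl | rfl | rfl <;> simp [hfa, hfb, hfc]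
    rw [hgen, top_le_iff] at hle
    have h1 : (1 : ZMod n) ∈ f.ker := hle ▸ AddSubgroup.mem_top _
    rw [AddMonoidHom.mem_ker] at h1
    simp only [f, AddMonoidHom.coe_mulLeft] at h1
    linear_combination h1
  have h4 := eight_dvd_of_affine m h0 h ha hb
  have hcop := ZMod.val_coe_unit_coprime m
  have ht := (eq_half_of_add_self h0 h).2
  obtain ⟨k, hk⟩ := h4
  have ht' : t = 4 * (k : ZMod n) := by
    rw [ht, hk, show 8 * k / 2 = 4 * k by omega]; push_cast; ring
  have hn : (8 * k : ℤ) = (n : ℤ) := by rw [hk]; push_cast; ring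
  refine ⟨k, a.val, b.val, c.val, hk, ?_, (m : ZMod n).val, ?_, ?_, ?_, ?_, ?_⟩
  · simp only [Int.cast_natCast, ZMod.natCast_zmod_val]
    exact hS
  · rw [hn]; exact hcop
  all_goals
    rw [hn, ← ZMod.intCast_eq_intCast_iff]
    push_cast
    simp only [ZMod.natCast_zmod_val, ← ht']
  · exact hm2
  · linear_combination ha - h
  · linear_combination hb - h
  · linear_combination hc - h

namespace UnstablePair

variable (U : UnstablePair S γ)
include U

/-- With `a` fixed, the map permutes the pairs `±b` and `±c`. Exchanging them gives family 6. If it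
fixes `a`, `b` and `c`, then `S` lies in a nontrivial coset of the kernel of `m - 1`, against
nonbipartiteness. Otherwise, after replacing `m` by `-m` if necessary, one generator is fixed and
two are negated, which is family 7. -/
theorem family_of_affine_fixed (hS : S = pm a b c) (m : (ZMod n)ˣ) {t : ZMod n} (h0 : t ≠ 0)
    (h : t + t = 0) (hm : ∀ s ∈ S, m * s + t ∈ S) (ha : m * a + t = a) :
    Family6 n S ∨ Family7 n S := by
  obtain ⟨ha0, hb0, hc0, hab, hab', hac, hac', hbc, hbc'⟩ := (U.distinct hS).ne
  have hinj : ∀ x y : ZMod n, m * x + t = m * y + t → x = y := by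
    intro x y hxy
    exact m.mul_right_inj.1 (add_right_cancel hxy)
  have hng : ∀ x y : ZMod n, m * x + t = y → m * (-x) + t = -y := by
    intro x y hxy
    linear_combination -hxy + h
  have hng' : ∀ x y : ZMod n, m * x + t = y → ((-m : (ZMod n)ˣ) : ZMod n) * x + t = -y := by
    intro x y hxy
    rw [Units.val_neg]
    linear_combination -hxy + h
  have hb := hm b (by simp [hS, mem_pm])
  have hc := hm c (by simp [hS, mem_pm])
  rw [hS, mem_pm] at hb hc
  have hb' : m * b + t = b ∨ m * b + t = -b ∨ m * b + t = c ∨ m * b + t = -c := by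
    rcases hb with hb | hb | hb
    · exact absurd (hinj _ _ (ha.trans hb.symm)) hab
    · exact absurd (hinj _ _ (hb.trans (hng _ _ ha).symm)) (fun h => hab' (by rw [h, neg_neg]))
    · exact hb
  have hc' : m * c + t = b ∨ m * c + t = -b ∨ m * c + t = c ∨ m * c + t = -c := by
    rcases hc with hc | hc | hc
    · exact absurd (hinj _ _ (ha.trans hc.symm)) hac
    · exact absurd (hinj _ _ (hc.trans (hng _ _ ha).symm)) (fun h => hac' (by rw [h, neg_neg]))
    · exact hc
  rcases hb' with hb | hb | hb | hb
  · rcases hc' with hc | hc | hc | hc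
    · exact absurd (hinj _ _ (hb.trans hc.symm)) hbc
    · exact absurd (hinj _ _ ((hng _ _ hb).trans hc.symm)) (fun h => hbc' (by rw [← h, neg_neg]))
    · exfalso
      let K := (AddMonoidHom.mulLeft ((m : ZMod n) - 1)).ker
      have hall : ∀ s ∈ S, ((m : ZMod n) - 1) * s = t := by
        intro s hs
        rw [hS, mem_pm] at hs
        rcases hs with rfl | rfl | rfl | rfl | rfl | rfl
        · linear_combination ha - h
        · linear_combination -ha
        · linear_combination hb - h
        · linear_combination -hb
        · linear_combination hc - h
        · linear_combination -hc
      refine U.nonbip K (fun s hs hK => h0 ?_) fun s hs s' hs' => ?_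
      · rw [← hall s hs]; exact hK
      · rw [AddMonoidHom.mem_ker, AddMonoidHom.coe_mulLeft, mul_sub, hall s hs, hall s' hs',
          sub_self]
    · refine Or.inr (family7_of_affine (a := c) (b := a) (c := b) U.gen ?_ (-m) h0 h ?_ ?_ ?_)
      · rw [hS, pm_swap_right, pm_swap_left]
      · simpa using hng' _ _ hc
      · exact hng' _ _ ha
      · exact hng' _ _ hb
  · rcases hc' with hc | hc | hc | hc
    · exact absurd (hinj _ _ ((hng _ _ hb).trans (by rw [neg_neg, hc])))
        (fun h => hbc' (by rw [← h, neg_neg]))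
    · exact absurd (hinj _ _ (hb.trans hc.symm)) hbc
    · refine Or.inr (family7_of_affine (a := b) (b := a) (c := c) U.gen ?_ (-m) h0 h ?_ ?_ ?_)
      · rw [hS, pm_swap_left]
      · simpa using hng' _ _ hb
      · exact hng' _ _ ha
      · exact hng' _ _ hc
    · exact Or.inr (family7_of_affine U.gen hS m h0 h ha hb hc)
  · refine Or.inl (family6_of_affine U.gen hS m h0 h ha hb ?_)
    rcases hc' with hc | hc | hc | hc
    · exact Or.inl hc
    · exact Or.inr hc
    · exact absurd (hinj _ _ (hb.trans hc.symm)) hbc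
    · exact absurd (hinj _ _ ((hng _ _ hb).trans hc.symm)) (fun h => hbc' (by rw [← h, neg_neg]))
  · refine Or.inl (family6_of_affine (c := -c) U.gen (hS.trans pm_neg_right) m h0 h ha hb ?_)
    rcases hc' with hc | hc | hc | hc
    · exact Or.inr (hng _ _ hc)
    · exact Or.inl (by simpa using hng _ _ hc)
    · exact absurd (hinj _ _ ((hng _ _ hb).trans (by rw [neg_neg, hc])))
        (fun h => hbc' (by rw [← h, neg_neg]))
    · exact absurd (hinj _ _ (hb.trans hc.symm)) hbc

theorem family_of_affine_fixed_pair (hS : S = pm a b c) (m : (ZMod n)ˣ) {t : ZMod n} (h0 : t ≠ 0)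
    (h : t + t = 0) (hm : ∀ s ∈ S, m * s + t ∈ S) (ha : m * a + t = a ∨ m * a + t = -a) :
    Family6 n S ∨ Family7 n S := by
  rcases ha with ha | ha
  · exact U.family_of_affine_fixed hS m h0 h hm ha
  · refine U.family_of_affine_fixed hS (-m) h0 h (fun s hs => ?_) ?_
    · have := U.neg _ (hm s hs)
      convert this using 1
      rw [Units.val_neg]
      linear_combination h
    · rw [Units.val_neg]
      linear_combination -ha + h

/-- If no pair is fixed, the three pairs are permuted cyclically. The cube of the map has slope `m ^
3` and, because `mt = t` and `3t = t`, the same constant term; it fixes the pair `±a`. -/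
theorem family_of_affine (hS : S = pm a b c) (m : (ZMod n)ˣ) {t : ZMod n} (h0 : t ≠ 0)
    (h : t + t = 0) (hm : ∀ s ∈ S, m * s + t ∈ S) : Family6 n S ∨ Family7 n S := by
  obtain ⟨ha0, hb0, hc0, hab, hab', hac, hac', hbc, hbc'⟩ := (U.distinct hS).ne
  by_cases ha : m * a + t = a ∨ m * a + t = -a
  · exact U.family_of_affine_fixed_pair hS m h0 h hm ha
  by_cases hb : m * b + t = b ∨ m * b + t = -b
  · exact U.family_of_affine_fixed_pair (hS.trans pm_swap_left) m h0 h hm hb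
  by_cases hc : m * c + t = c ∨ m * c + t = -c
  · exact U.family_of_affine_fixed_pair (hS.trans (pm_swap_right.trans pm_swap_left)) m h0 h hm hc
  have hmt := unit_mul_half m h0 h
  have hinj : ∀ x y : ZMod n, m * x + t = m * y + t → x = y := by
    intro x y hxy
    exact m.mul_right_inj.1 (add_right_cancel hxy)
  have hng : ∀ x y : ZMod n, m * x + t = y → m * (-x) + t = -y := by
    intro x y hxy
    linear_combination -hxy + h
  have h1 : ∀ x ∈ S, m * x + t ∈ S := hm
  have hcube : ∀ x : ZMod n, ((m ^ 3 : (ZMod n)ˣ) : ZMod n) * x + t =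
      m * (m * (m * x + t) + t) + t := by
    intro x
    rw [Units.val_pow_eq_pow_val]
    linear_combination (-(m : ZMod n) - 2) * hmt - h
  refine U.family_of_affine_fixed_pair hS (m ^ 3) h0 h (fun s hs => ?_) ?_
  · rw [hcube]
    exact hm _ (hm _ (hm _ hs))
  rw [hcube]
  have ha1 := hm a (by simp [hS, mem_pm])
  have hb1 := hm b (by simp [hS, mem_pm])
  have hc1 := hm c (by simp [hS, mem_pm])
  rw [hS, mem_pm] at ha1 hb1 hc1
  have dj : ∀ x y z : ZMod n, x ≠ y → x ≠ -y → (m * x + t = z ∨ m * x + t = -z) →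
      (m * y + t = z ∨ m * y + t = -z) → False := by
    intro x y z h1 h2 hx hy
    rcases hx with hx | hx <;> rcases hy with hy | hy
    · exact h1 (hinj _ _ (hx.trans hy.symm))
    · exact h2 (hinj _ _ (hx.trans (by rw [hng _ _ hy, neg_neg])))
    · exact h2 (hinj _ _ (hx.trans (hng _ _ hy).symm))
    · exact h1 (hinj _ _ (hx.trans hy.symm))
  have fwd : ∀ x y z : ZMod n, (m * x + t = y ∨ m * x + t = -y) →
      (m * y + t = z ∨ m * y + t = -z) →
      (m * (m * x + t) + t = z ∨ m * (m * x + t) + t = -z) := by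
    intro x y z hx hy
    rcases hx with hx | hx <;> rcases hy with hy | hy <;> rw [hx]
    · exact Or.inl hy
    · exact Or.inr hy
    · exact Or.inr (hng _ _ hy)
    · exact Or.inl (by rw [hng _ _ hy, neg_neg])
  have ha2 : (m * a + t = b ∨ m * a + t = -b) ∨ (m * a + t = c ∨ m * a + t = -c) := by
    rcases ha1 with h | h | h | h | h | h
    exacts [absurd (Or.inl h) ha, absurd (Or.inr h) ha, .inl (.inl h), .inl (.inr h), .inr (.inl h), .inr (.inr h)]
  have hb2 : (m * b + t = a ∨ m * b + t = -a) ∨ (m * b + t = c ∨ m * b + t = -c) := by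
    rcases hb1 with h | h | h | h | h | h
    exacts [.inl (.inl h), .inl (.inr h), absurd (Or.inl h) hb, absurd (Or.inr h) hb, .inr (.inl h), .inr (.inr h)]
  have hc2 : (m * c + t = a ∨ m * c + t = -a) ∨ (m * c + t = b ∨ m * c + t = -b) := by
    rcases hc1 with h | h | h | h | h | h
    exacts [.inl (.inl h), .inl (.inr h), .inr (.inl h), .inr (.inr h), absurd (Or.inl h) hc, absurd (Or.inr h) hc]
  rcases ha2 with ha2 | ha2
  · have hc3 := hc2.resolve_right (dj _ _ _ hac hac' ha2)
    have hb3 := hb2.resolve_left fun hb3 => dj _ _ _ hbc hbc' hb3 hc3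
    have := fwd _ _ _ ha2 hb3
    rw [or_comm] at this
    rcases this with h5 | h5 <;> rw [h5]
    · rcases hc3 with hc3 | hc3
      · exact Or.inr (hng _ _ hc3)
      · exact Or.inl (by rw [hng _ _ hc3, neg_neg])
    · exact hc3
  · have hb3 := hb2.resolve_right (dj _ _ _ hab hab' ha2)
    have hc3 := hc2.resolve_left (dj _ _ _ hbc hbc' hb3)
    have := fwd _ _ _ ha2 hc3
    rcases this with h5 | h5 <;> rw [h5]
    · exact hb3
    · rcases hb3 with hb3 | hb3
      · exact Or.inr (hng _ _ hb3)
      · exact Or.inl (by rw [hng _ _ hb3, neg_neg])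

theorem family_of_lin (hS : S = pm a b c) (h : ∀ s ∈ S, ∃ y, Lin γ s 1 y) :
    Family6 n S ∨ Family7 n S := by
  obtain ⟨m, t, h0, ht, hm⟩ := U.exists_unit h
  exact U.family_of_affine hS m h0 ht hm

end UnstablePair

end CirculantDoubleCover

/-! ### An invariant pair `±a` with `2b = 2c`: families 2, 4 and 5. -/

namespace CirculantDoubleCover

/-- The set `{±b, ±c}`. -/
def quad {n : ℕ} (b c : ZMod n) : Finset (ZMod n) := {b, -b, c, -c}

theorem mem_quad {n : ℕ} {b c x : ZMod n} :
    x ∈ quad b c ↔ x = b ∨ x = -b ∨ x = c ∨ x = -c := by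
  simp [quad]

theorem neg_mem_quad {n : ℕ} {b c x : ZMod n} (hx : x ∈ quad b c) : -x ∈ quad b c := by
  rw [mem_quad] at *
  rcases hx with rfl | rfl | rfl | rfl <;> simp

theorem Distinct.card_filter_quad {n : ℕ} {a b c : ZMod n} (h : Distinct a b c)
    (P : ZMod n → Prop) [DecidablePred P] :
    ((quad b c).filter P).card = (if P b then 1 else 0) + (if P (-b) then 1 else 0) +
      (if P c then 1 else 0) + (if P (-c) then 1 else 0) := by
  unfold Distinct at h
  simp only [List.nodup_cons, List.mem_cons, List.not_mem_nil, or_false] at h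
  obtain ⟨-, -, h3, h4, h5, -⟩ := h
  rw [Finset.card_filter, quad, Finset.sum_insert (by simpa using h3),
    Finset.sum_insert (by simpa using h4), Finset.sum_insert (by simpa using h5),
    Finset.sum_singleton]
  ring

variable {n : ℕ} [NeZero n] {a b c : ZMod n} {S : Finset (ZMod n)}
  {γ : ZMod 2 → Equiv.Perm (ZMod n)}

theorem castHom_two_eq_val (hn : 2 ∣ n) (x : ZMod n) :
    ZMod.castHom hn (ZMod 2) x = (x.val : ZMod 2) := by
  conv_lhs => rw [← ZMod.natCast_zmod_val x]
  rw [map_natCast]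

omit [NeZero n] in
theorem Inv.zero_singleton : Inv γ 0 ({0} : Set (ZMod n)) :=
  Lin.zero.inv.2 rfl

namespace UnstablePair

variable (U : UnstablePair S γ)
include U

omit [NeZero n] in
theorem inv_quad (hS : S = pm a b c) (hA : Inv γ 1 {a, -a}) :
    Inv γ 1 (quad b c : Set (ZMod n)) := by
  obtain ⟨ha0, hb0, hc0, hab, hab', hac, hac', hbc, hbc'⟩ := (U.distinct hS).ne
  refine (U.inv.diff hA).congr ?_
  ext x
  simp only [Set.mem_sdiff, Finset.mem_coe, hS, mem_pm, mem_quad, Set.mem_insert_iff,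
    Set.mem_singleton_iff]
  constructor
  · tauto
  · intro h
    refine ⟨Or.inr (Or.inr h), ?_⟩
    rintro (h1 | h1) <;> rcases h with h | h | h | h
    · exact hab (h1.symm.trans h)
    · exact hab' (h1.symm.trans h)
    · exact hac (h1.symm.trans h)
    · exact hac' (h1.symm.trans h)
    · exact hab' (by rw [← h, h1, neg_neg])
    · exact hab (neg_injective (h1.symm.trans h))
    · exact hac' (by rw [← h, h1, neg_neg])
    · exact hac (neg_injective (h1.symm.trans h))

omit [NeZero n] in
theorem not_lin_zero_one {t : ZMod n} (ht : t + t = 0) (h0 : Lin γ t 0 t) (h1 : Lin γ t 1 t) :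
    False := by
  have := h0.add h1
  rw [ht, zero_add] at this
  exact U.ne this

/-- If `{a, -a}` is invariant, then `a` has even order, and the behaviour of `γ` with respect to
translation by the element of order two is determined by the order of `a`. -/
theorem exists_half (hS : S = pm a b c) (hA : Inv γ 1 {a, -a}) :
    ∃ (t : ZMod n) (k : ℕ), t ≠ 0 ∧ t + t = 0 ∧ k • a = t ∧ addOrderOf a = 2 * k ∧
      Lin γ t k t := by
  have ha0 := (U.distinct hS).ne.1
  have key : ∀ j v, γ (j + 1) (v + a) - γ j v = a ∨ γ (j + 1) (v + a) - γ j v = -a := by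
    intro j v
    simpa using (hA j v (v + a)).2 (by simp)
  have hpos : 0 < addOrderOf a := addOrderOf_pos a
  rcases Nat.even_or_odd' (addOrderOf a) with ⟨k, hk | hk⟩
  · refine ⟨k • a, k, ?_, ?_, rfl, hk, ?_⟩
    · intro h
      have := addOrderOf_dvd_iff_nsmul_eq_zero.2 h
      have := Nat.le_of_dvd (by omega) this
      omega
    · rw [← add_nsmul, ← two_mul, ← hk, addOrderOf_nsmul_eq_zero]
    · intro j v
      -- After `k` steps the image has moved by `±t`, and the sign is irrelevant because `t = -t`.
      -- The parity of `k` decides the layer reached.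
      have h1 := hA.line ha0 j v k
      rw [mul_one] at h1
      rw [sub_eq_iff_eq_add'.1 h1]
      rcases key j v with h | h <;> rw [h]
      congr 1
      rw [smul_neg, neg_eq_iff_add_eq_zero, ← add_nsmul, ← two_mul, ← hk,
        addOrderOf_nsmul_eq_zero]
  · exfalso
    -- A closed walk of odd length along the line ends over the same vertex but in the other layer,
    -- which would make `γ 0 = γ 1`.
    refine U.ne fun j v => ?_
    have h1 := hA.line ha0 j v (addOrderOf a)
    have h2 : ((addOrderOf a : ℕ) : ZMod 2) = 1 := by
      rw [hk]; push_cast; rw [show (2 : ZMod 2) = 0 from rfl, zero_mul, zero_add]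
    rw [addOrderOf_nsmul_eq_zero, h2, mul_one, sub_eq_iff_eq_add] at h1
    rw [h1, add_comm]
    congr 1
    rcases key j v with h | h <;> rw [h]
    · exact addOrderOf_nsmul_eq_zero a
    · rw [smul_neg, addOrderOf_nsmul_eq_zero, neg_zero]

/-- The case in which `{±a}` is invariant, its order is divisible by four, and the other two
generators differ by the element of order two. -/
theorem family_of_half_even (hS : S = pm a b c) {t : ZMod n} {k : ℕ}
    (h0 : t ≠ 0) (ht : t + t = 0) (hk : addOrderOf a = 2 * k) (hke : Even k) (hc : c = b + t) :
    Family2 n S ∨ Family4 n S := by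
  have hn2 := U.even
  obtain ⟨l, hl⟩ := hke
  have h4 : 4 ∣ addOrderOf a := ⟨l, by omega⟩
  have hcard : addOrderOf a ∣ n := by
    rw [addOrderOf_dvd_iff_nsmul_eq_zero, nsmul_eq_mul, CharP.cast_eq_zero, zero_mul]
  obtain ⟨q, hq⟩ := h4.trans hcard
  have htv := (eq_half_of_add_self h0 ht).2
  have ht2 : t = 2 * (q : ZMod n) := by
    rw [htv, hq, show 4 * q / 2 = 2 * q by omega]; push_cast; ring
  have hSeq : ∀ u : ZMod n, u = t → S = {a, -a, b, -b, b + u, -b + u} := by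
    rintro u rfl
    rw [hS, hc]
    ext x
    simp only [mem_pm, Finset.mem_insert, Finset.mem_singleton]
    rw [show -(b + u) = -b + u by linear_combination -ht]
  have hpar := U.parity_ne hn2 hS
  have hct : ZMod.castHom hn2 (ZMod 2) c = ZMod.castHom hn2 (ZMod 2) b := by
    rw [hc, map_add, ht2, map_mul, map_ofNat, show (2 : ZMod 2) = 0 from rfl, zero_mul, add_zero]
  rw [hct] at hpar
  simp only [castHom_two_eq_val, and_true] at hpar
  rcases Nat.even_or_odd a.val with hae | hao
  · right
    -- An even `a` has order dividing `n/2 = 2q`; since `4` divides that order, `8 ∣ n`.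
    have h8 : addOrderOf a ∣ 2 * q := by
      obtain ⟨r, hr⟩ := hae
      rw [addOrderOf_dvd_iff_nsmul_eq_zero, nsmul_eq_mul, ← ZMod.natCast_zmod_val a, hr,
        ← Nat.cast_mul, ZMod.natCast_eq_zero_iff]
      exact ⟨r, by rw [hq]; ring⟩
    have h9 : 2 ∣ q := by
      obtain ⟨z, hz⟩ := (show 4 ∣ addOrderOf a from ⟨l, by omega⟩).trans h8
      exact ⟨z, by omega⟩
    obtain ⟨r, hr⟩ := h9
    refine ⟨r, a.val, b.val, by omega, ?_, ?_, ?_⟩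
    · simp only [Int.cast_natCast, ZMod.natCast_zmod_val]
      refine hSeq _ ?_
      rw [ht2, hr]; push_cast; ring
    · exact_mod_cast hae
    · simpa using (show 4 ∣ addOrderOf a from ⟨l, by omega⟩)
  · left
    refine ⟨q, a.val, b.val, hq, ?_, ?_, ?_⟩
    · simp only [Int.cast_natCast, ZMod.natCast_zmod_val]
      exact hSeq _ ht2.symm
    · exact_mod_cast hao
    · have : Even b.val := by
        by_contra hb
        rw [Nat.not_even_iff_odd] at hb
        exact hpar (by rw [ZMod.natCast_eq_one_iff_odd.2 hao, ZMod.natCast_eq_one_iff_odd.2 hb])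
      exact_mod_cast this

/-- The stabilizer of `{±b, ±(b + t)}` is generated by the element `t` of order two. -/
theorem lin_of_quad_half (hS : S = pm a b c) (hA : Inv γ 1 {a, -a}) {t : ZMod n}
    (h0 : t ≠ 0) (ht : t + t = 0) (hc : c = b + t) (hb4 : b + b + b + b ≠ t) : Lin γ t 0 t := by
  obtain ⟨ha0, hb0, hc0, hab, hab', hac, hac', hbc, hbc'⟩ := (U.distinct hS).ne
  have hT := U.inv_quad hS hA
  have hst := hT.transporter hT
  rw [show (1 : ZMod 2) + 1 = 0 from rfl] at hst
  refine Inv.lin_of_singleton ((hst.diff Inv.zero_singleton).congr ?_)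
  have hb40 : b + b + b + b ≠ 0 := by
    intro h
    rcases eq_zero_or_half h0 ht (x := b + b) (by linear_combination h) with h1 | h1
    · exact hb0 (by linear_combination h1)
    · exact hbc' (by linear_combination h1 + hc + ht)
  ext x
  simp only [Set.mem_sdiff, Set.mem_ofPred_eq, Finset.mem_coe, Set.mem_singleton_iff]
  constructor
  · rintro ⟨hx, hx0⟩
    have h1 := hx b (by simp [mem_quad])
    have h2 := hx (-b) (by simp [mem_quad])
    rw [mem_quad] at h1 h2
    subst hc
    rcases h1 with h1 | h1 | h1 | h1
    · exact absurd (by linear_combination h1) hx0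
    · exfalso
      rcases h2 with h2 | h2 | h2 | h2
      · exact hb40 (by linear_combination h1 - h2)
      · exact hb0 (by linear_combination h1 - h2)
      · exact hb4 (by linear_combination h1 - h2 - ht)
      · exact hbc' (by linear_combination h1 - h2 + ht)
    · linear_combination h1
    · exfalso
      rcases h2 with h2 | h2 | h2 | h2
      · exact hb4 (by linear_combination h1 - h2 - ht)
      · exact hbc' (by linear_combination h1 - h2)
      · exact hb40 (by linear_combination h1 - h2 - ht)
      · exact hb0 (by linear_combination h1 - h2)
  · rintro rfl
    refine ⟨fun u hu => ?_, h0⟩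
    rw [mem_quad] at hu ⊢
    subst hc
    rcases hu with rfl | rfl | rfl | rfl
    · right; right; left; ring
    · right; right; right; linear_combination ht
    · left; linear_combination ht
    · right; left; ring

/-- The case in which `{±a}` is invariant and the order of `a` is not divisible by four, while
`b` has order eight and `c = b + t = -3 b`. -/
theorem family5_of_order_eight (hS : S = pm a b c) {t : ZMod n} {k : ℕ}
    (h0 : t ≠ 0) (ht : t + t = 0) (hka : k • a = t) (hko : Odd k)
    (hc : c = b + t) (hb4 : b + b + b + b = t) : Family5 n S := by
  have hn2 := U.even
  have hpar := U.parity_ne hn2 hS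
  have h8 : 8 ∣ n := by
    have : addOrderOf b = 2 ^ (2 + 1) := by
      have : Fact (Nat.Prime 2) := ⟨Nat.prime_two⟩
      apply addOrderOf_eq_prime_pow
      · intro h
        rw [nsmul_eq_mul] at h
        push_cast at h
        exact h0 (by linear_combination h - hb4)
      · rw [nsmul_eq_mul]
        push_cast
        linear_combination 2 * hb4 + ht
    have h1 : addOrderOf b ∣ n := by
      rw [addOrderOf_dvd_iff_nsmul_eq_zero, nsmul_eq_mul, CharP.cast_eq_zero, zero_mul]
    rw [this] at h1
    exact h1
  obtain ⟨q, hq⟩ := h8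
  have hqpos : 0 < q := by
    rcases Nat.eq_zero_or_pos q with h | h
    · exact absurd (by rw [hq, h, mul_zero]) (NeZero.ne n)
    · exact h
  have htv := (eq_half_of_add_self h0 ht).2
  have ht4 : t = 4 * (q : ZMod n) := by
    rw [htv, hq, show 8 * q / 2 = 4 * q by omega]; push_cast; ring
  have h8q : 8 * (q : ZMod n) = 0 := by linear_combination ht - 2 * ht4
  have hbq : q ∣ b.val := by
    have h1 : ((8 * b.val : ℕ) : ZMod n) = 0 := by
      push_cast
      rw [ZMod.natCast_zmod_val]
      linear_combination 2 * hb4 + ht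
    rw [ZMod.natCast_eq_zero_iff] at h1
    exact Nat.dvd_of_mul_dvd_mul_left (by norm_num) (hq.symm.dvd.trans h1)
  obtain ⟨j, hj⟩ := hbq
  have hbj : b = (q : ZMod n) * j := by
    rw [← Nat.cast_mul, ← hj, ZMod.natCast_zmod_val]
  have hj8 : j < 8 := by
    have := b.val_lt
    rw [hj, hq, mul_comm 8] at this
    exact lt_of_mul_lt_mul_left this (Nat.zero_le _)
  -- `q` generates the subgroup of order eight, so `b` and `c = b + 4q` are odd multiples of `q`,
  -- one of them `±q` and the other `±3q`.
  have hjo : Odd j := by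
    rw [← Nat.not_even_iff_odd]
    rintro ⟨i, hi⟩
    refine h0 ?_
    rw [← hb4, hbj, hi]
    push_cast
    linear_combination i * h8q
  have ha8 : (4 : ZMod 8) * (q : ZMod 8) = (k : ZMod 8) * (a.val : ZMod 8) := by
    have h1 := congrArg (ZMod.castHom (⟨q, hq⟩ : 8 ∣ n) (ZMod 8)) (hka.trans ht4)
    rw [← ZMod.natCast_zmod_val a, nsmul_eq_mul] at h1
    simp only [map_mul, map_natCast, map_ofNat] at h1
    exact h1.symm
  have odd8 : ∀ m : ℕ, Odd m → (4 : ZMod 8) * (m : ZMod 8) = 4 := by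
    rintro m ⟨i, rfl⟩
    push_cast
    have : (8 : ZMod 8) = 0 := rfl
    linear_combination i * this
  have ha4 : ∀ z k a : ZMod 8, 4 * k = 4 → z = k * a → (z = 0 → a = 0) ∧ (z = 4 → a = 4) := by
    decide
  have hk8 := odd8 k hko
  -- For even `q`, all of `a`, `b`, `c` would be even.
  have hqo : Odd q := by
    rw [← Nat.not_even_iff_odd]
    rintro ⟨i, hi⟩
    have h1 : (4 : ZMod 8) * (q : ZMod 8) = 0 := by
      rw [hi]; push_cast
      have : (8 : ZMod 8) = 0 := rfl
      linear_combination i * this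
    have h2 := (ha4 _ _ _ hk8 ha8).1 h1
    rw [ZMod.natCast_eq_zero_iff] at h2
    have ha2 : ZMod.castHom hn2 (ZMod 2) a = 0 := by
      rw [castHom_two_eq_val, ZMod.natCast_eq_zero_iff]; omega
    have hb2 : ZMod.castHom hn2 (ZMod 2) b = 0 := by
      rw [castHom_two_eq_val, ZMod.natCast_eq_zero_iff, hj, hi]
      exact ⟨i * j, by ring⟩
    have hc2 : ZMod.castHom hn2 (ZMod 2) c = 0 := by
      rw [hc, map_add, hb2, ht4, map_mul, map_ofNat, show (4 : ZMod 2) = 0 from rfl]; simp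
    exact hpar ⟨ha2.trans hb2.symm, hb2.trans hc2.symm⟩
  have ha48 := (ha4 _ _ _ hk8 ha8).2 (odd8 q hqo)
  refine ⟨q, a.val, hq, ?_, ?_, hqo⟩
  · simp only [Int.cast_natCast, ZMod.natCast_zmod_val]
    rw [hS, hc, ht4, hbj]
    obtain ⟨i, hi⟩ := hjo
    have hi4 : i < 4 := by omega
    subst hi
    interval_cases i
    · rw [pm_neg_right (a := a)]
      congr 1
      · simp
      · push_cast; linear_combination -h8q
    · rw [pm_swap_right, pm_neg_mid]
      congr 1
      · push_cast; linear_combination -h8q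
      · push_cast; ring
    · rw [pm_swap_right, pm_neg_right]
      congr 1
      · push_cast; linear_combination h8q
      · push_cast; linear_combination -h8q
    · rw [pm_neg_mid]
      congr 1
      · push_cast; linear_combination -h8q
      · push_cast; linear_combination h8q
  · have h1 : ((a.val : ℤ) : ZMod 8) = ((4 : ℤ) : ZMod 8) := by
      push_cast; exact ha48
    exact (ZMod.intCast_eq_intCast_iff _ _ 8).1 h1

/-- The case in which `{±a}` is invariant and the other two generators differ by the element of
order two. -/
theorem family_of_half (hS : S = pm a b c) (hA : Inv γ 1 {a, -a}) (hbc2 : b + b = c + c) :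
    Family2 n S ∨ Family4 n S ∨ Family5 n S := by
  obtain ⟨ha0, hb0, hc0, hab, hab', hac, hac', hbc, hbc'⟩ := (U.distinct hS).ne
  obtain ⟨t, k, h0, ht, hka, hk, hL⟩ := U.exists_half hS hA
  have hc : c = b + t := by
    rcases eq_zero_or_half h0 ht (x := c - b) (by linear_combination -hbc2) with h | h
    · exact absurd (by linear_combination -h) hbc
    · linear_combination h
  rcases Nat.even_or_odd k with hke | hko
  · rcases U.family_of_half_even hS h0 ht hk hke hc with h | h
    · exact Or.inl h
    · exact Or.inr (Or.inl h)
  -- For odd `k`, translation by `t` is preserved in grade 1. Unless `b` has order eight, the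
  -- stabilizer of `{±b, ±c}` preserves it in grade 0 too, and composing the two yields `{0}` in
  -- grade 1.
  · by_cases hb4 : b + b + b + b = t
    · exact Or.inr (Or.inr (U.family5_of_order_eight hS h0 ht hka hko hc hb4))
    · rw [ZMod.natCast_eq_one_iff_odd.2 hko] at hL
      exact (U.not_lin_zero_one ht (U.lin_of_quad_half hS hA h0 ht hc hb4) hL).elim

end UnstablePair

end CirculantDoubleCover

/-! ### An invariant pair `±a`: short relations and parallelograms. -/

namespace CirculantDoubleCover

variable {n : ℕ} {a b c : ZMod n} {S : Finset (ZMod n)} {γ : ZMod 2 → Equiv.Perm (ZMod n)}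

theorem quad_subset_pm {x : ZMod n} (h : x ∈ quad b c) : x ∈ pm a b c := by
  rw [mem_quad] at h
  rw [mem_pm]
  exact Or.inr (Or.inr h)

/-- Any four elements of `{±a, ±b, ±c}` include two that are equal or opposite. -/
theorem pigeonhole_pm {s t u w : ZMod n} (hs : s ∈ pm a b c) (ht : t ∈ pm a b c)
    (hu : u ∈ pm a b c) (hw : w ∈ pm a b c) :
    (s = t ∨ s = -t) ∨ (s = u ∨ s = -u) ∨ (s = w ∨ s = -w) ∨ (t = u ∨ t = -u) ∨
      (t = w ∨ t = -w) ∨ (u = w ∨ u = -w) := by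
  have hcls : ∀ x ∈ pm a b c, ∃ i : Fin 3, x = ![a, b, c] i ∨ x = -![a, b, c] i := by
    intro x hx
    rw [mem_pm] at hx
    rcases hx with h | h | h | h | h | h
    exacts [⟨0, Or.inl h⟩, ⟨0, Or.inr h⟩, ⟨1, Or.inl h⟩, ⟨1, Or.inr h⟩, ⟨2, Or.inl h⟩,
      ⟨2, Or.inr h⟩]
  have hpair : ∀ (x y : ZMod n) (i j : Fin 3), (x = ![a, b, c] i ∨ x = -![a, b, c] i) →
      (y = ![a, b, c] j ∨ y = -![a, b, c] j) → i = j → (x = y ∨ x = -y) := by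
    rintro x y i j (rfl | rfl) (rfl | rfl) rfl <;> simp
  obtain ⟨i, hi⟩ := hcls s hs
  obtain ⟨j, hj⟩ := hcls t ht
  obtain ⟨k, hk⟩ := hcls u hu
  obtain ⟨l, hl⟩ := hcls w hw
  have hfin : ∀ i j k l : Fin 3, i = j ∨ i = k ∨ i = l ∨ j = k ∨ j = l ∨ k = l := by decide
  rcases hfin i j k l with h | h | h | h | h | h
  · exact Or.inl (hpair _ _ _ _ hi hj h)
  · exact Or.inr (Or.inl (hpair _ _ _ _ hi hk h))
  · exact Or.inr (Or.inr (Or.inl (hpair _ _ _ _ hi hl h)))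
  · exact Or.inr (Or.inr (Or.inr (Or.inl (hpair _ _ _ _ hj hk h))))
  · exact Or.inr (Or.inr (Or.inr (Or.inr (Or.inl (hpair _ _ _ _ hj hl h)))))
  · exact Or.inr (Or.inr (Or.inr (Or.inr (Or.inr (hpair _ _ _ _ hk hl h)))))

/-- Makes the sets produced by Frobenius symmetric, as the separation arguments require. -/
theorem card_filter_nsmul_neg {A : Finset (ZMod n)} (hA : ∀ s ∈ A, -s ∈ A) (p : ℕ) (x : ZMod n) :
    (A.filter fun s => p • s = -x).card = (A.filter fun s => p • s = x).card := by
  refine Finset.card_nbij' (fun s => -s) (fun s => -s) ?_ ?_ (fun s _ => neg_neg s)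
    (fun s _ => neg_neg s) <;>
  · intro s hs
    simp only [Finset.coe_filter, Set.mem_ofPred_eq] at hs ⊢
    exact ⟨hA _ hs.1, by rw [smul_neg, hs.2]; try rw [neg_neg]⟩

/-- Twice an element of `{±b, ±c}` is a sum of two elements only trivially, if there are no
relations of length four between `b` and `c`. -/
theorem quad_two_mul_eq_add (hb : b ≠ -b) (hc : c ≠ -c)
    (h4b : b + b + b + b ≠ 0) (h4c : c + c + c + c ≠ 0) (h2 : b + b ≠ c + c)
    (h2' : b + b ≠ -(c + c)) (h3 : c ≠ b + b + b) (h3' : -c ≠ b + b + b) (h3c : b ≠ c + c + c)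
    (h3c' : -b ≠ c + c + c) :
    ∀ s ∈ (quad b c : Set (ZMod n)), ∀ u ∈ (quad b c : Set (ZMod n)),
      ∀ w ∈ (quad b c : Set (ZMod n)), s + s = u + w → u = s := by
  intro s hs u hu w hw h
  rw [Finset.mem_coe, mem_quad] at hs hu hw
  rcases hs with hs | hs | hs | hs <;> rcases hu with hu | hu | hu | hu <;>
    rcases hw with hw | hw | hw | hw <;> subst hs <;> rw [hw, hu] at h <;>
    first
    | exact hu
    | grind

variable [NeZero n]

namespace UnstablePair

variable (U : UnstablePair S γ)
include U

/-- If `±b` and `±c` cannot be separated by an invariant set and `b` has order four, then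
`b = ±3c`. -/
theorem eq_three_mul_of_order_four (hS : S = pm a b c) (hA : Inv γ 1 {a, -a})
    (hsym : ∀ D : Set (ZMod n), Inv γ 1 D → (∀ x ∈ D, -x ∈ D) → c ∈ D → b ∈ D)
    (h2 : b + b ≠ c + c) (h4 : b + b + b + b = 0) : b = c + c + c ∨ -b = c + c + c := by
  have hd := U.distinct hS
  obtain ⟨ha0, hb0, hc0, hab, hab', hac, hac', hbc, hbc'⟩ := hd.ne
  have hT := U.inv_quad hS hA
  have : Fact (Nat.Prime 2) := ⟨Nat.prime_two⟩
  have h4c : c + c ≠ -(c + c) := by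
    intro h
    refine h2 (half_unique ?_ ?_ ?_ ?_)
    · intro h'; exact hb0 (by linear_combination h')
    · linear_combination h4
    · intro h'; exact hc0 (by linear_combination h')
    · linear_combination h
  have h2' : b + b ≠ -(c + c) := by
    intro h'
    exact h2 (by linear_combination h4 - h')
  -- Here `b` and `-b` have the same double and cancel modulo 2, so only `±2c` survive.
  have hE : Inv γ 0 ({c + c, -(c + c)} : Set (ZMod n)) := by
    have h1 := hT.frobenius 2
    rw [show ((2 : ℕ) : ZMod 2) = 0 from rfl, zero_mul] at h1
    refine h1.congr ?_
    ext x
    simp only [Set.mem_ofPred_eq, hd.card_filter_quad, two_nsmul, Set.mem_insert_iff,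
      Set.mem_singleton_iff]
    rw [show -b + -b = b + b by linear_combination -h4, show -c + -c = -(c + c) by ring]
    by_cases hx1 : b + b = x
    · subst hx1
      simp [Ne.symm h2, h2, h2', Ne.symm h2', -neg_add_rev]
    · by_cases hx2 : c + c = x
      · subst hx2
        simp [h2, Ne.symm h4c, -neg_add_rev]
      · by_cases hx3 : -(c + c) = x
        · subst hx3
          simp [h2', h4c, -neg_add_rev]
        · simp [hx1, hx2, hx3, Ne.symm hx2, Ne.symm hx3, -neg_add_rev]
  have hD := hT.add hE
  rw [add_zero] at hD
  -- `c = -c + 2c` lies in the sum set, hence so does `b`.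
  have hmem := hsym _ hD (by
    rintro x ⟨t, ht, e, he, rfl⟩
    refine ⟨-t, neg_mem_quad ht, -e, ?_, by simp only; ring⟩
    rcases he with rfl | he
    · exact Or.inr rfl
    · left; rw [he, neg_neg])
    ⟨-c, by simp [mem_quad], c + c, by simp, by simp only; ring⟩
  obtain ⟨t, ht, e, he, hte⟩ := hmem
  simp only [Finset.mem_coe, mem_quad, Set.mem_insert_iff, Set.mem_singleton_iff] at ht he hte
  clear hD hE hT hsym U hS hd hA
  rcases ht with rfl | rfl | rfl | rfl <;> rcases he with rfl | rfl <;> grind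

/-- If `±b` and `±c` cannot be separated by an invariant set, then `c ≠ 3b`, unless
`2c = -2b`. -/
theorem ne_three_mul (hS : S = pm a b c) (hA : Inv γ 1 {a, -a})
    (hsym : ∀ D : Set (ZMod n), Inv γ 1 D → (∀ x ∈ D, -x ∈ D) → c ∈ D → b ∈ D)
    (h2' : b + b ≠ -(c + c)) : c ≠ b + b + b := by
  intro hc
  have hd := U.distinct hS
  obtain ⟨ha0, hb0, hc0, hab, hab', hac, hac', hbc, hbc'⟩ := hd.ne
  have hT := U.inv_quad hS hA
  have : Fact (Nat.Prime 3) := ⟨Nat.prime_three⟩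
  have : Fact (Nat.Prime 5) := ⟨Nat.prime_five⟩
  have h3 := hT.frobenius 3
  rw [show ((3 : ℕ) : ZMod 2) = 1 from rfl, one_mul] at h3
  -- `3b = c`, and among the other elements of `{±b, ±c}` only `-c` could triple to `c`; so `c`
  -- survives modulo 3. Then `b` survives too, which forces `b = -3c` and `10b = 0`.
  have hmem := hsym _ h3 (by
    intro x hx
    rw [Set.mem_ofPred_eq] at hx ⊢
    rwa [card_filter_nsmul_neg (fun s hs => neg_mem_quad hs)]) (by
    simp only [Set.mem_ofPred_eq, hd.card_filter_quad, nsmul_eq_mul, Nat.cast_ofNat]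
    have e1 : 3 * b = c := by linear_combination -hc
    have e2 : ¬ 3 * -b = c := fun h => hc0 (by linear_combination -h - e1)
    have e3 : ¬ 3 * c = c := fun h => hc0 (by linear_combination h)
    rw [if_pos e1, if_neg e2, if_neg e3]
    split_ifs <;> norm_num)
  have h10 : 10 * b = 0 := by
    rw [Set.mem_ofPred_eq] at hmem
    have hne : ((quad b c).filter fun s => 3 • s = b).Nonempty := by
      rw [Finset.nonempty_iff_ne_empty]
      intro h
      rw [h] at hmem
      simp at hmem
    obtain ⟨s, hs⟩ := hne
    rw [Finset.mem_filter, mem_quad, nsmul_eq_mul, Nat.cast_ofNat] at hs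
    obtain ⟨hs | hs | hs | hs, h⟩ := hs <;> rw [hs] at h
    · exact absurd (by linear_combination h) hb0
    · exact absurd (by linear_combination hc - h) hbc'
    · exact absurd (by linear_combination h - hc) h2'
    · linear_combination -h - 3 * hc
  -- Since `10b = 0`, all four elements of `{±b, ±c}` have the same multiple by 5; as `5 ∤ 4`, the
  -- singleton `{5b}` is invariant in grade 1.
  have h5 := hT.frobenius 5
  rw [show ((5 : ℕ) : ZMod 2) = 1 from rfl, one_mul] at h5
  have hL : Lin γ (5 * b) 1 (5 * b) := by
    refine Inv.lin_of_singleton (h5.congr ?_)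
    ext x
    simp only [Set.mem_ofPred_eq, hd.card_filter_quad, nsmul_eq_mul, Nat.cast_ofNat,
      Set.mem_singleton_iff]
    rw [show 5 * -b = 5 * b by linear_combination -h10,
      show 5 * c = 5 * b by linear_combination 5 * hc + h10,
      show 5 * -c = 5 * b by linear_combination -5 * hc - 2 * h10]
    by_cases hx : 5 * b = x
    · simp [hx]
    · simp [hx, Ne.symm hx]
  by_cases h5b : 5 * b = 0
  · rw [h5b] at hL
    exact U.ne hL
  obtain ⟨t, k, h0, ht, hka, hk, hLt⟩ := U.exists_half hS hA
  have h5t : 5 * b = t := half_unique h5b (by linear_combination h10) h0 ht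
  rw [h5t] at hL
  rcases Nat.even_or_odd k with hke | hko
  · rw [ZMod.natCast_eq_zero_iff_even.2 hke] at hLt
    exact U.not_lin_zero_one ht hLt hL
  -- For odd `k`, the relations `k • a = 5b` and `c = 3b` give all three generators the same parity.
  · have hpar := U.parity_ne U.even hS
    have e1 := congrArg (ZMod.castHom U.even (ZMod 2)) (hka.trans h5t.symm)
    have e2 := congrArg (ZMod.castHom U.even (ZMod 2)) hc
    rw [nsmul_eq_mul, map_mul, map_mul, map_natCast, ZMod.natCast_eq_one_iff_odd.2 hko,
      map_ofNat, show (5 : ZMod 2) = 1 from rfl, one_mul, one_mul] at e1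
    rw [map_add, map_add, CharTwo.add_self_eq_zero, zero_add] at e2
    exact hpar ⟨e1, e2.symm⟩

omit [NeZero n] in
/-- If the image of the step `(x, i)` is unchanged along edges, then `γ` carries translation by
`(x, i)` to a translation. -/
theorem exists_lin (hS : S = pm a b c) {x : ZMod n} {i : ZMod 2}
    (h : ∀ s, s = a ∨ s = b ∨ s = c → ∀ j v,
      γ (j + 1 + i) (v + s + x) - γ (j + 1) (v + s) = γ (j + i) (v + x) - γ j v) :
    ∃ y, Lin γ x i y := by
  let ψ : ZMod 2 → ZMod n → ZMod n := fun j v => γ (j + i) (v + x) - γ j v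
  have hneg : ∀ s, (∀ j v, ψ (j + 1) (v + s) = ψ j v) → ∀ j v, ψ (j + 1) (v + -s) = ψ j v := by
    intro s hs j v
    have := hs (j + 1) (v + -s)
    rwa [grade_add_self, neg_add_cancel_right, eq_comm] at this
  have hψ : ∀ s ∈ S, ∀ j v, ψ (j + 1) (v + s) = ψ j v := by
    intro s hs
    rw [hS, mem_pm] at hs
    rcases hs with rfl | rfl | rfl | rfl | rfl | rfl
    · exact h _ (by simp)
    · exact hneg _ (h _ (by simp))
    · exact h _ (by simp)
    · exact hneg _ (h _ (by simp))
    · exact h _ (by simp)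
    · exact hneg _ (h _ (by simp))
  refine ⟨ψ 0 0, fun j v => ?_⟩
  rw [← U.const ψ hψ j v]
  simp only [ψ]
  abel

theorem family_of_lin_gens (hS : S = pm a b c) (ha : ∃ y, Lin γ a 1 y) (hb : ∃ y, Lin γ b 1 y)
    (hc : ∃ y, Lin γ c 1 y) : Family6 n S ∨ Family7 n S := by
  refine U.family_of_lin hS fun s hs => ?_
  have hneg : ∀ s, (∃ y, Lin γ s 1 y) → ∃ y, Lin γ (-s) 1 y := by
    rintro s ⟨y, hy⟩
    exact ⟨_, hy.neg⟩
  rw [hS, mem_pm] at hs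
  rcases hs with rfl | rfl | rfl | rfl | rfl | rfl
  exacts [ha, hneg _ ha, hb, hneg _ hb, hc, hneg _ hc]

-- Differences of elements of `{±y}` are `0` and `±2y`, none of which is `2x`.
omit [NeZero n] U in
theorem step_of_pairs {x y : ZMod n} (hx : Inv γ 1 {x, -x}) (hy : Inv γ 1 {y, -y}) (hx0 : x ≠ -x)
    (hxy : x + x ≠ y + y) (hxy' : x + x ≠ -(y + y)) (j : ZMod 2) (v : ZMod n) :
    γ (j + 1 + 1) (v + y + x) - γ (j + 1) (v + y) = γ (j + 1) (v + x) - γ j v := by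
  refine (hx.parallelogram hy (by simp) ?_ j v).1
  rintro t (rfl | ht) t' (rfl | ht') h
  · exact hx0 (by linear_combination -h)
  · rw [Set.mem_singleton_iff] at ht'
    exact hxy (by linear_combination -h - ht')
  · rw [Set.mem_singleton_iff] at ht
    exact hxy' (by linear_combination -h + ht)
  · rw [Set.mem_singleton_iff] at ht ht'
    exact hx0 (by linear_combination -h + ht - ht')

theorem family_of_three_pairs (hS : S = pm a b c) (hA : Inv γ 1 {a, -a}) (hB : Inv γ 1 {b, -b})
    (hC : Inv γ 1 {c, -c}) (h1 : a + a ≠ b + b) (h1' : a + a ≠ -(b + b)) (h2 : a + a ≠ c + c)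
    (h2' : a + a ≠ -(c + c)) (h3 : b + b ≠ c + c) (h3' : b + b ≠ -(c + c)) :
    Family6 n S ∨ Family7 n S := by
  obtain ⟨ha0, hb0, hc0, -⟩ := (U.distinct hS).ne
  refine U.family_of_lin_gens hS ?_ ?_ ?_ <;> apply U.exists_lin hS
  · rintro s (rfl | rfl | rfl) j v
    · exact hA.straight ha0 j v
    · exact step_of_pairs hA hB ha0 h1 h1' j v
    · exact step_of_pairs hA hC ha0 h2 h2' j v
  · rintro s (rfl | rfl | rfl) j v
    · exact step_of_pairs hB hA hb0 h1.symm (fun h => h1' (by linear_combination h)) j v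
    · exact hB.straight hb0 j v
    · exact step_of_pairs hB hC hb0 h3 h3' j v
  · rintro s (rfl | rfl | rfl) j v
    · exact step_of_pairs hC hA hc0 h2.symm (fun h => h2' (by linear_combination h)) j v
    · exact step_of_pairs hC hB hc0 h3.symm (fun h => h3' (by linear_combination h)) j v
    · exact hC.straight hc0 j v

/-- The case in which `{±a}` is invariant and there are no relations of length four affecting
the remaining pairs. -/
theorem family_of_pair_generic (hS : S = pm a b c) (hA : Inv γ 1 {a, -a})
    (hQ : ∀ s ∈ (quad b c : Set (ZMod n)), ∀ u ∈ (quad b c : Set (ZMod n)),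
      ∀ w ∈ (quad b c : Set (ZMod n)), s + s = u + w → u = s)
    (hd : ∀ t ∈ (quad b c : Set (ZMod n)), ∀ t' ∈ (quad b c : Set (ZMod n)), t - t' ≠ a + a) :
    Family6 n S ∨ Family7 n S := by
  obtain ⟨ha0, hb0, hc0, -⟩ := (U.distinct hS).ne
  have hT := U.inv_quad hS hA
  have hb : b ∈ (quad b c : Set (ZMod n)) := by simp [mem_quad]
  have hc : c ∈ (quad b c : Set (ZMod n)) := by simp [mem_quad]
  have hp : ∀ s ∈ (quad b c : Set (ZMod n)), ∀ t ∈ (quad b c : Set (ZMod n)), ∀ j v,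
      γ (j + 1 + 1) (v + t + s) - γ (j + 1) (v + t) = γ (j + 1) (v + s) - γ j v := by
    intro s hs t ht j v
    refine hT.parallelogram_of_sum hQ (fun s hs => neg_mem_quad hs) ?_ hs ht j v
    intro s hs t ht u hu w hw
    exact pigeonhole_pm (a := a) (quad_subset_pm hs) (quad_subset_pm ht) (quad_subset_pm hu)
      (quad_subset_pm hw)
  refine U.family_of_lin_gens hS ?_ ?_ ?_ <;> apply U.exists_lin hS
  · rintro s (rfl | rfl | rfl) j v
    · exact hA.straight ha0 j v
    · exact (hA.parallelogram hT hb hd j v).1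
    · exact (hA.parallelogram hT hc hd j v).1
  · rintro s (rfl | rfl | rfl) j v
    · exact (hA.parallelogram hT hb hd j v).2
    · exact hp _ hb _ hb j v
    · exact hp _ hb _ hc j v
  · rintro s (rfl | rfl | rfl) j v
    · exact (hA.parallelogram hT hc hd j v).2
    · exact hp _ hc _ hb j v
    · exact hp _ hc _ hc j v

omit [NeZero n] in
/-- If `{±a}` is invariant and `2a = 2b`, then `{±b}` is invariant too. -/
theorem inv_of_two_mul_eq (hS : S = pm a b c) (hA : Inv γ 1 {a, -a})
    (h4 : b + b + b + b ≠ 0) (h3 : c ≠ b + b + b) (h3' : -c ≠ b + b + b) (h2 : b + b ≠ c + c)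
    (h2' : b + b ≠ -(c + c)) (hab2 : a + a = b + b) : Inv γ 1 {b, -b} := by
  obtain ⟨ha0, hb0, hc0, hab, hab', hac, hac', hbc, hbc'⟩ := (U.distinct hS).ne
  have hT := U.inv_quad hS hA
  have hst := hT.transporter hA
  rw [show (1 : ZMod 2) + 1 = 0 from rfl] at hst
  -- Only the shift by `a - b` carries `{±a}` into `{±b, ±c}`, and its image is `{±b}`.
  have hset : {x | ∀ u ∈ ({a, -a} : Set (ZMod n)), x + u ∈ (quad b c : Set (ZMod n))} =
      {a - b} := by
    ext x
    simp only [Set.mem_ofPred_eq, Set.mem_insert_iff, Set.mem_singleton_iff, forall_eq_or_imp,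
      forall_eq, Finset.mem_coe, mem_quad]
    clear hst hT hA U hS
    constructor
    · rintro ⟨h1 | h1 | h1 | h1, h5 | h5 | h5 | h5⟩ <;> grind
    · rintro rfl
      exact ⟨Or.inl (by linear_combination hab2), Or.inr (Or.inl (by ring))⟩
  rw [hset] at hst
  have := hA.add hst
  rw [add_zero] at this
  refine this.congr ?_
  ext x
  simp only [Set.add_singleton, Set.image_insert_eq, Set.image_singleton, Set.mem_insert_iff,
    Set.mem_singleton_iff]
  rw [show a + (a - b) = b by linear_combination hab2, show -a + (a - b) = -b by ring]

/-- The case in which `{±a}` is invariant and `2a = b + c`. -/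
theorem family_of_two_mul_eq_add (hS : S = pm a b c) (hA : Inv γ 1 {a, -a})
    (h2' : b + b ≠ -(c + c)) (h3 : -c ≠ b + b + b) (h3' : -b ≠ c + c + c)
    (habc : a + a = b + c) :
    Family6 n S ∨ Family7 n S := by
  obtain ⟨ha0, hb0, hc0, hab, hab', hac, hac', hbc, hbc'⟩ := (U.distinct hS).ne
  have hT := U.inv_quad hS hA
  have hst := hT.transporter hA
  rw [show (1 : ZMod 2) + 1 = 0 from rfl] at hst
  -- `c, a, b` is an arithmetic progression with difference `t`. The transporter of `{±a}` into
  -- `{±b, ±c}` is exactly `{±t}`, so `a` in grade 1 and `t` in grade 0 can replace the three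
  -- generators.
  obtain ⟨t, ht⟩ : ∃ t, t = b - a := ⟨_, rfl⟩
  have hb : b = a + t := by linear_combination -ht
  have hc : c = a + -t := by linear_combination ht - habc
  have hset : {x | ∀ u ∈ ({a, -a} : Set (ZMod n)), x + u ∈ (quad b c : Set (ZMod n))} =
      {t, -t} := by
    ext x
    simp only [Set.mem_ofPred_eq, Set.mem_insert_iff, Set.mem_singleton_iff, forall_eq_or_imp,
      forall_eq, Finset.mem_coe, mem_quad]
    clear hst hT hA U hS
    constructor
    · rintro ⟨h1 | h1 | h1 | h1, h5 | h5 | h5 | h5⟩ <;> grind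
    · rintro (rfl | rfl)
      · exact ⟨Or.inl (by linear_combination -hb), by right; right; right; linear_combination hc⟩
      · exact ⟨by right; right; left; linear_combination -hc, by right; left; linear_combination hb⟩
  rw [hset] at hst
  have ht0 : t ≠ -t := fun h => hbc (by rw [hb, hc, ← h])
  have hdiff : ∀ u ∈ ({t, -t} : Set (ZMod n)), ∀ u' ∈ ({t, -t} : Set (ZMod n)),
      u - u' ≠ a + a := by
    rintro u (rfl | hu) u' (rfl | hu') h
    · exact ha0 (by linear_combination -h)
    · rw [Set.mem_singleton_iff] at hu'
      exact hc0 (by linear_combination -h - hu' + 2 * hc)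
    · rw [Set.mem_singleton_iff] at hu
      exact hb0 (by linear_combination -h + hu + 2 * hb)
    · rw [Set.mem_singleton_iff] at hu hu'
      exact ha0 (by linear_combination -h + hu - hu')
  have step : ∀ u ∈ ({t, -t} : Set (ZMod n)), ∀ j v,
      γ (j + 1) (v + u + a) - γ j (v + u) = γ (j + 1) (v + a) - γ j v := by
    intro u hu j v
    have := (hA.parallelogram hst hu hdiff j v).1
    rwa [add_zero] at this
  have stepa : ∀ u ∈ ({t, -t} : Set (ZMod n)), ∀ j v,
      γ (j + 1 + 1) (v + (a + u) + a) - γ (j + 1) (v + (a + u)) = γ (j + 1) (v + a) - γ j v := by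
    intro u hu j v
    rw [← add_assoc, step u hu, hA.straight ha0]
  have stept : ∀ j v, γ (j + 1) (v + a + t) - γ (j + 1) (v + a) = γ j (v + t) - γ j v := by
    intro j v
    have := (hA.parallelogram hst (show t ∈ _ by simp) hdiff j v).2
    rwa [add_zero, add_zero] at this
  have strt : ∀ j v, γ j (v + t + t) - γ j (v + t) = γ j (v + t) - γ j v := by
    intro j v
    have := hst.straight ht0 j v
    rwa [add_zero, add_zero] at this
  obtain ⟨ya, hya⟩ : ∃ y, Lin γ a 1 y := by
    apply U.exists_lin hS
    rintro s (rfl | rfl | rfl) j v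
    · exact hA.straight ha0 j v
    · rw [hb]; exact stepa t (by simp) j v
    · rw [hc]; exact stepa (-t) (by simp) j v
  obtain ⟨yt, hyt⟩ : ∃ y, Lin γ t 0 y := by
    apply U.exists_lin hS
    rintro s (rfl | rfl | rfl) j v
    · rw [add_zero, add_zero]; exact stept j v
    · rw [add_zero, add_zero, hb, ← add_assoc, strt, stept]
    · rw [add_zero, add_zero, hc, ← add_assoc]
      have := strt (j + 1) (v + a + -t)
      rw [neg_add_cancel_right] at this ⊢
      rw [← this, stept]
  refine U.family_of_lin_gens hS ⟨ya, hya⟩ ⟨ya + yt, ?_⟩ ⟨ya + -yt, ?_⟩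
  · rw [hb]; simpa using hya.add hyt
  · rw [hc]; simpa using hya.add hyt.neg

end UnstablePair

end CirculantDoubleCover

/-! ### Separating generators by invariant sets; conclusion for an invariant pair. -/

namespace CirculantDoubleCover

variable {n : ℕ} {a b c : ZMod n} {S : Finset (ZMod n)} {γ : ZMod 2 → Equiv.Perm (ZMod n)}

theorem exists_pm_of_mem (hS : S = pm a b c) {x : ZMod n} (hx : x ∈ S) :
    ∃ y z, S = pm x y z := by
  subst hS
  rw [mem_pm] at hx
  rcases hx with rfl | rfl | rfl | rfl | rfl | rfl
  · exact ⟨_, _, rfl⟩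
  · exact ⟨b, c, pm_neg_left⟩
  · exact ⟨a, c, pm_swap_left⟩
  · exact ⟨a, c, pm_swap_left.trans pm_neg_left⟩
  · exact ⟨a, b, pm_swap_right.trans pm_swap_left⟩
  · exact ⟨a, b, (pm_swap_right.trans pm_swap_left).trans pm_neg_left⟩

theorem exists_pm_of_mem_of_mem (hS : S = pm a b c) {x y : ZMod n} (hx : x ∈ S) (hy : y ∈ S)
    (h : y ≠ x) (h' : y ≠ -x) : ∃ z, S = pm x y z := by
  obtain ⟨u, v, rfl⟩ := exists_pm_of_mem hS hx
  rw [mem_pm] at hy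
  rcases hy with hy | hy | rfl | rfl | rfl | rfl
  · exact absurd hy h
  · exact absurd hy h'
  · exact ⟨_, rfl⟩
  · exact ⟨_, pm_neg_mid⟩
  · exact ⟨_, pm_swap_right⟩
  · exact ⟨_, pm_swap_right.trans pm_neg_mid⟩

/-- A line in direction `x` is mapped to a line in direction `x` or `-x`, so going `m` steps forward
and `m` steps back gives opposite displacements `±m x`. -/
theorem Inv.nsmul_pair {x : ZMod n} {i : ZMod 2} (h : Inv γ i {x, -x}) (hx : x ≠ -x) (m : ℕ) :
    Inv γ (m * i) {m • x, -(m • x)} := by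
  have hline := h.line hx
  have key : ∀ j v, γ (j + i) (v + x) - γ j v = x ∨ γ (j + i) (v + x) - γ j v = -x := by
    intro j v
    simpa using (h j v (v + x)).2 (by simp)
  have h1 : ∀ j v, γ (j + m * i) (v + m • x) - γ j v = m • x ∨
      γ (j + m * i) (v + m • x) - γ j v = -(m • x) := by
    intro j v
    rw [hline]
    rcases key j v with h | h <;> rw [h]
    · exact Or.inl rfl
    · exact Or.inr (smul_neg _ _)
  have h2 : ∀ j v, γ (j + m * i) (v + -(m • x)) - γ j v =
      -(γ (j + m * i) (v + m • x) - γ j v) := by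
    intro j v
    have e1 := hline (j + m * i) (v + -(m • x)) m
    rw [grade_add_self, neg_add_cancel_right] at e1
    have e2 := hline j v m
    have e3 : γ (j + m * i + i) (v + -(m • x) + x) - γ (j + m * i) (v + -(m • x)) =
        γ (j + i) (v + x) - γ j v := by
      have aux : ∀ (l : ℕ) j v, γ (j + l * i + i) (v + l • x + x) - γ (j + l * i) (v + l • x) =
          γ (j + i) (v + x) - γ j v := by
        intro l
        induction l with
        | zero => intro j v; simp
        | succ l ih =>
          intro j v
          have e := h.straight hx (j + l * i) (v + l • x)
          rw [ih] at e
          rw [succ_nsmul, Nat.cast_succ, add_mul, one_mul, ← e]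
          simp only [add_assoc]
      have e := aux m (j + m * i) (v + -(m • x))
      rw [grade_add_self, neg_add_cancel_right] at e
      exact e.symm
    rw [e3, ← e2] at e1
    rw [← e1]
    abel
  intro j v w
  simp only [Set.mem_insert_iff, Set.mem_singleton_iff]
  constructor
  · intro hw
    have hw' : γ (j + m * i) w = γ (j + m * i) (v + m • x) ∨
        γ (j + m * i) w = γ (j + m * i) (v + -(m • x)) := by
      have h3 := h1 j v
      have h4 := h2 j v
      rcases hw with hw | hw <;> rcases h3 with h3 | h3 <;> rw [h3] at h4
      · exact Or.inl (sub_left_injective (hw.trans h3.symm))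
      · exact Or.inr (sub_left_injective (hw.trans (h4.trans (neg_neg _)).symm))
      · exact Or.inr (sub_left_injective (hw.trans h4.symm))
      · exact Or.inl (sub_left_injective (hw.trans h3.symm))
    rw [(γ (j + m * i)).injective.eq_iff, (γ (j + m * i)).injective.eq_iff] at hw'
    rcases hw' with rfl | rfl
    · left; abel
    · right; abel
  · rintro (hw | hw)
    · rw [sub_eq_iff_eq_add'.1 hw]; exact h1 j v
    · rw [sub_eq_iff_eq_add'.1 hw, h2]
      rcases h1 j v with h | h <;> rw [h]
      · exact Or.inr rfl
      · exact Or.inl (neg_neg _)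

namespace UnstablePair

variable (U : UnstablePair S γ)
include U

/-- A symmetric invariant set containing `a` but neither `b` nor `c` separates the pair `±a`. -/
theorem inv_pair_of_separated (hS : S = pm a b c) {D : Set (ZMod n)} (hD : Inv γ 1 D)
    (hneg : ∀ x ∈ D, -x ∈ D) (ha : a ∈ D) (hb : b ∉ D) (hc : c ∉ D) : Inv γ 1 {a, -a} := by
  refine (U.inv.inter hD).congr ?_
  have hneg' : ∀ x, -x ∈ D → x ∈ D := fun x hx => by simpa using hneg _ hx
  ext x
  simp only [Set.mem_inter_iff, Finset.mem_coe, hS, mem_pm, Set.mem_insert_iff,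
    Set.mem_singleton_iff]
  constructor
  · rintro ⟨rfl | rfl | rfl | rfl | rfl | rfl, hx⟩
    · exact Or.inl rfl
    · exact Or.inr rfl
    · exact absurd hx hb
    · exact absurd (hneg' _ hx) hb
    · exact absurd hx hc
    · exact absurd (hneg' _ hx) hc
  · rintro (rfl | rfl)
    · exact ⟨Or.inl rfl, ha⟩
    · exact ⟨Or.inr (Or.inl rfl), hneg _ ha⟩

/-- If no pair `±s` is invariant, then a symmetric invariant set contains all generators or
none. -/
theorem mem_of_mem (hS : S = pm a b c) (hno : ∀ s ∈ S, ¬ Inv γ 1 {s, -s}) {D : Set (ZMod n)}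
    (hD : Inv γ 1 D) (hneg : ∀ x ∈ D, -x ∈ D) {x y : ZMod n} (hx : x ∈ S) (hxD : x ∈ D)
    (hy : y ∈ S) : y ∈ D := by
  by_contra hyD
  obtain ⟨z, hz⟩ := exists_pm_of_mem_of_mem hS hx hy (fun h => hyD (h ▸ hxD))
    (fun h => hyD (h ▸ hneg x hxD))
  -- Either `D` or its complement contains exactly one of the three pairs, which would then be
  -- invariant.
  by_cases hzD : z ∈ D
  · refine hno y hy (U.inv_pair_of_separated (a := y) (b := x) (c := z) (D := Dᶜ)
      (hz.trans pm_swap_left) hD.compl ?_ hyD (fun h => h hxD) (fun h => h hzD))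
    intro u hu hu'
    exact hu (by simpa using hneg _ hu')
  · exact hno x hx (U.inv_pair_of_separated hz hD hneg hxD hyD hzD)

variable [NeZero n]

/-- The case in which some pair `±a` is invariant. -/
theorem family_of_pair (hS : S = pm a b c) (hA : Inv γ 1 {a, -a}) :
    (Family2 n S ∨ Family4 n S ∨ Family5 n S) ∨ Family6 n S ∨ Family7 n S := by
  obtain ⟨ha0, hb0, hc0, hab, hab', hac, hac', hbc, hbc'⟩ := (U.distinct hS).ne
  by_cases h2 : b + b = c + c
  · exact Or.inl (U.family_of_half hS hA h2)
  by_cases h2' : b + b = -(c + c)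
  · exact Or.inl (U.family_of_half (hS.trans pm_neg_right) hA (by linear_combination h2'))
  by_cases hB : Inv γ 1 {b, -b}
  · have hC : Inv γ 1 {c, -c} := by
      refine U.inv_pair_of_separated (hS.trans (pm_swap_right.trans pm_swap_left))
        (hA.union hB).compl ?_ ?_ ?_ ?_
      · intro x hx hx'
        refine hx ?_
        rcases hx' with (h | h) | (h | h)
        · left; right; rw [Set.mem_singleton_iff, ← h, neg_neg]
        · left; left; exact neg_injective h
        · right; right; rw [Set.mem_singleton_iff, ← h, neg_neg]
        · right; left; exact neg_injective h
      · rintro ((h | h) | (h | h))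
        · exact hac h.symm
        · rw [Set.mem_singleton_iff] at h
          exact hac' (by rw [h, neg_neg])
        · exact hbc h.symm
        · rw [Set.mem_singleton_iff] at h
          exact hbc' (by rw [h, neg_neg])
      · exact fun h => h (by simp)
      · exact fun h => h (by simp)
    by_cases h3 : a + a = b + b
    · exact Or.inl (U.family_of_half (hS.trans (pm_swap_right.trans pm_swap_left)) hC h3)
    by_cases h3' : a + a = -(b + b)
    · exact Or.inl (U.family_of_half
        (hS.trans ((pm_swap_right.trans pm_swap_left).trans pm_neg_right)) hC
        (by linear_combination h3'))
    by_cases h4 : a + a = c + c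
    · exact Or.inl (U.family_of_half (hS.trans pm_swap_left) hB h4)
    by_cases h4' : a + a = -(c + c)
    · exact Or.inl (U.family_of_half (hS.trans (pm_swap_left.trans pm_neg_right)) hB
        (by linear_combination h4'))
    exact Or.inr (U.family_of_three_pairs hS hA hB hC h3 h3' h4 h4' h2 h2')
  · have hC : ¬ Inv γ 1 {c, -c} := by
      intro hC
      refine hB (((U.inv_quad hS hA).diff hC).congr ?_)
      ext x
      simp only [Set.mem_sdiff, Finset.mem_coe, mem_quad, Set.mem_insert_iff,
        Set.mem_singleton_iff]
      constructor
      · tauto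
      · rintro (rfl | rfl)
        · exact ⟨Or.inl rfl, fun h => h.elim hbc hbc'⟩
        · refine ⟨Or.inr (Or.inl rfl), fun h => h.elim (fun h => hbc' ?_) (fun h => hbc ?_)⟩
          · rw [← h, neg_neg]
          · exact neg_injective h
    have hrem : ∀ D : Set (ZMod n), Inv γ 1 D → (∀ x ∈ D, -x ∈ D) →
        Inv γ 1 (D \ {a, -a}) ∧ ∀ x ∈ D \ {a, -a}, -x ∈ D \ {a, -a} := by
      intro D hD hneg
      refine ⟨hD.diff hA, fun x hx => ⟨hneg x hx.1, ?_⟩⟩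
      rintro (h | h)
      · exact hx.2 (Or.inr (by rw [Set.mem_singleton_iff, ← h, neg_neg]))
      · exact hx.2 (Or.inl (neg_injective h))
    have hb_mem : ∀ D : Set (ZMod n), b ∈ D → b ∈ D \ {a, -a} := by
      refine fun D hb => ⟨hb, ?_⟩
      rintro (h | h)
      · exact hab h.symm
      · rw [Set.mem_singleton_iff] at h
        exact hab' (by rw [h, neg_neg])
    have hc_mem : ∀ D : Set (ZMod n), c ∈ D → c ∈ D \ {a, -a} := by
      refine fun D hb => ⟨hb, ?_⟩
      rintro (h | h)
      · exact hac h.symm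
      · rw [Set.mem_singleton_iff] at h
        exact hac' (by rw [h, neg_neg])
    -- As `{±b}` and `{±c}` are not invariant, no symmetric invariant set separates them.
    have hsym : ∀ D : Set (ZMod n), Inv γ 1 D → (∀ x ∈ D, -x ∈ D) → c ∈ D → b ∈ D := by
      intro D hD hneg hc
      by_contra hb
      obtain ⟨h1, h2⟩ := hrem D hD hneg
      exact hC (U.inv_pair_of_separated (hS.trans (pm_swap_right.trans pm_swap_left)) h1 h2
        (hc_mem D hc) (fun h => h.2 (by simp)) (fun h => hb h.1))
    have hsym' : ∀ D : Set (ZMod n), Inv γ 1 D → (∀ x ∈ D, -x ∈ D) → b ∈ D → c ∈ D := by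
      intro D hD hneg hb
      by_contra hc
      obtain ⟨h1, h2⟩ := hrem D hD hneg
      exact hB (U.inv_pair_of_separated (hS.trans pm_swap_left) h1 h2
        (hb_mem D hb) (fun h => h.2 (by simp)) (fun h => hc h.1))
    have hS' := hS.trans pm_swap_right
    have h3 : c ≠ b + b + b := U.ne_three_mul hS hA hsym h2'
    have h3' : -c ≠ b + b + b := U.ne_three_mul (hS.trans pm_neg_right) hA
      (fun D hD hneg hc => hsym D hD hneg (by simpa using hneg _ hc))
      (fun h => h2 (by linear_combination h))
    have h3c : b ≠ c + c + c := U.ne_three_mul hS' hA hsym'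
      (fun h => h2' (by linear_combination h))
    have h3c' : -b ≠ c + c + c := U.ne_three_mul (hS'.trans pm_neg_right) hA
      (fun D hD hneg hb => hsym' D hD hneg (by simpa using hneg _ hb))
      (fun h => h2 (by linear_combination -h))
    have h4b : b + b + b + b ≠ 0 := by
      intro h
      rcases U.eq_three_mul_of_order_four hS hA hsym h2 h with h | h
      · exact h3c h
      · exact h3c' h
    have h4c : c + c + c + c ≠ 0 := by
      intro h
      rcases U.eq_three_mul_of_order_four hS' hA hsym' (Ne.symm h2) h with h | h
      · exact h3 h
      · exact h3' h
    have hx : ∀ x, (x = b ∨ x = c) → a + a ≠ x + x ∧ a + a ≠ -(x + x) := by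
      rintro x (rfl | rfl)
      · refine ⟨fun h => hB (U.inv_of_two_mul_eq hS hA h4b h3 h3' h2 h2' h), fun h => hB ?_⟩
        have := U.inv_of_two_mul_eq (b := -x) (hS.trans pm_neg_mid) hA
          (fun h => h4b (by linear_combination -h)) (fun h => h3' (by linear_combination -h))
          (fun h => h3 (by linear_combination -h)) (fun h => h2' (by linear_combination -h))
          (fun h => h2 (by linear_combination -h)) (by linear_combination h)
        rwa [neg_neg, Set.pair_comm] at this
      · refine ⟨fun h => hC (U.inv_of_two_mul_eq hS' hA h4c h3c h3c' (Ne.symm h2)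
          (fun h => h2' (by linear_combination h)) h), fun h => hC ?_⟩
        have := U.inv_of_two_mul_eq (b := -x) (hS'.trans pm_neg_mid) hA
          (fun h => h4c (by linear_combination -h)) (fun h => h3c' (by linear_combination -h))
          (fun h => h3c (by linear_combination -h)) (fun h => h2' (by linear_combination -h))
          (fun h => h2 (by linear_combination h)) (by linear_combination h)
        rwa [neg_neg, Set.pair_comm] at this
    obtain ⟨hxb, hxb'⟩ := hx b (Or.inl rfl)
    obtain ⟨hxc, hxc'⟩ := hx c (Or.inr rfl)
    right
    -- Of the differences `0, ±2b, ±2c, ±b ± c` within `{±b, ±c}`, only the last four can still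
    -- equal `2a`.
    by_cases h5 : a + a = b + c
    · exact U.family_of_two_mul_eq_add hS hA h2' h3' h3c' h5
    by_cases h6 : a + a = b + -c
    · exact U.family_of_two_mul_eq_add (hS.trans pm_neg_right) hA
        (fun h => h2 (by linear_combination h)) (by simpa using h3)
        (fun h => h3c (by linear_combination -h)) h6
    by_cases h7 : a + a = -b + c
    · exact U.family_of_two_mul_eq_add (hS.trans pm_neg_mid) hA
        (fun h => h2 (by linear_combination -h)) (fun h => h3 (by linear_combination -h))
        (by simpa using h3c) h7
    by_cases h8 : a + a = -b + -c
    · exact U.family_of_two_mul_eq_add (hS.trans (pm_neg_mid.trans pm_neg_right)) hA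
        (fun h => h2' (by linear_combination -h)) (fun h => h3' (by linear_combination -h))
        (fun h => h3c' (by linear_combination -h)) h8
    refine U.family_of_pair_generic hS hA
      (quad_two_mul_eq_add hb0 hc0 h4b h4c h2 h2' h3 h3' h3c h3c') ?_
    intro t ht t' ht' h
    rw [Finset.mem_coe, mem_quad] at ht ht'
    clear hrem hb_mem hc_mem hsym hsym' hS hS' hA hB hC hx U
    rcases ht with rfl | rfl | rfl | rfl <;> rcases ht' with rfl | rfl | rfl | rfl <;> grind

end UnstablePair

end CirculantDoubleCover

/-! ### No invariant pair, two generators differing by the element of order two: families 2 and 3.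
-/

namespace CirculantDoubleCover

variable {n : ℕ} {a b c : ZMod n} {S : Finset (ZMod n)}
  {γ : ZMod 2 → Equiv.Perm (ZMod n)}

theorem exists_of_not_dvd_card {p : ℕ} {A : Finset (ZMod n)} {x : ZMod n}
    (h : ¬ p ∣ (A.filter fun s => p • s = x).card) : ∃ s ∈ A, p • s = x := by
  by_contra! hs
  rw [Finset.filter_false_of_mem hs, Finset.card_empty] at h
  exact h (dvd_zero p)

theorem not_dvd_card_of_unique {p : ℕ} (hp : p ≠ 1) {A : Finset (ZMod n)} {x s : ZMod n}
    (hs : s ∈ A) (hx : p • s = x) (h : ∀ u ∈ A, p • u = x → u = s) :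
    ¬ p ∣ (A.filter fun s => p • s = x).card := by
  have : (A.filter fun s => p • s = x) = {s} := by
    ext u
    rw [Finset.mem_filter, Finset.mem_singleton]
    exact ⟨fun hu => h u hu.1 hu.2, by rintro rfl; exact ⟨hs, hx⟩⟩
  rw [this, Finset.card_singleton, Nat.dvd_one]
  exact hp

namespace UnstablePair

variable (U : UnstablePair S γ)
include U

variable [NeZero n]

/-- If `2a = 2b` and no pair `±s` is invariant, then `2c = ±(a + b)`, and the pair `±2c` is
invariant. -/
theorem two_mul_eq_add_of_half (hS : S = pm a b c) (hno : ∀ s ∈ S, ¬ Inv γ 1 {s, -s})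
    (h2 : a + a = b + b) :
    (c + c = a + b ∨ c + c = -(a + b)) ∧ Inv γ 0 ({c + c, -(c + c)} : Set (ZMod n)) := by
  have hd := U.distinct hS
  obtain ⟨ha0, hb0, hc0, hab, hab', hac, hac', hbc, hbc'⟩ := hd.ne
  have : Fact (Nat.Prime 2) := ⟨Nat.prime_two⟩
  have ht0 : b - a ≠ 0 := fun h => hab (by linear_combination -h)
  have ht : b - a + (b - a) = 0 := by linear_combination -h2
  -- If `4c = 0`, then `2c = b - a`, and translation by `b - a` exchanges `a` with `b` and `c` with
  -- `-c`, so it is a period of `S`.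
  have h4c : c + c ≠ -(c + c) := by
    intro h
    have h1 : c + c = b - a := half_unique (fun h' => hc0 (by linear_combination h'))
      (by linear_combination h) ht0 ht
    refine ht0 (U.twinFree _ ?_)
    intro s hs
    rw [hS, mem_pm] at hs ⊢
    rcases hs with rfl | rfl | rfl | rfl | rfl | rfl
    · right; right; left; ring
    · right; right; right; left; linear_combination -h2
    · left; linear_combination -h2
    · right; left; ring
    · right; right; right; right; right; linear_combination h - h1
    · right; right; right; right; left; linear_combination - h1
  -- The doubles of `±a` cancel against those of `±b` modulo 2.
  have hE : Inv γ 0 ({c + c, -(c + c)} : Set (ZMod n)) := by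
    have h1 := U.inv.frobenius 2
    rw [show ((2 : ℕ) : ZMod 2) = 0 from rfl, zero_mul] at h1
    refine h1.congr ?_
    ext x
    simp only [Set.mem_ofPred_eq, hS, hd.card_filter, two_nsmul, Set.mem_insert_iff,
      Set.mem_singleton_iff]
    rw [← h2, show -b + -b = -a + -a by linear_combination h2, show -c + -c = -(c + c) by ring]
    have e : ∀ P Q : Prop, ∀ [Decidable P] [Decidable Q] (r s : ℕ),
        (¬ 2 ∣ (if P then 1 else 0) + (if Q then 1 else 0) + (if P then 1 else 0) +
          (if Q then 1 else 0) + r + s) ↔ ¬ 2 ∣ r + s := by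
      intro P Q _ _ r s
      split_ifs <;> omega
    rw [e]
    by_cases hx2 : c + c = x
    · subst hx2
      simp [Ne.symm h4c, -neg_add_rev]
    · by_cases hx3 : -(c + c) = x
      · subst hx3
        simp [h4c, -neg_add_rev]
      · simp [hx2, hx3, Ne.symm hx2, Ne.symm hx3, -neg_add_rev]
  refine ⟨?_, hE⟩
  have hD := U.inv.add hE
  rw [add_zero] at hD
  have hall : ∀ y ∈ S, y ∈ (S : Set (ZMod n)) + ({c + c, -(c + c)} : Set (ZMod n)) := by
    intro y hy
    refine U.mem_of_mem hS hno hD ?_ (x := c) (by simp [hS, mem_pm])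
      ⟨-c, by simp [hS, mem_pm], c + c, by simp, by simp only; ring⟩ hy
    rintro x ⟨t, ht, e, he, rfl⟩
    refine ⟨-t, U.neg _ ht, -e, ?_, by simp only; ring⟩
    rcases he with rfl | he
    · exact Or.inr rfl
    · left; rw [he, neg_neg]
  have key : ∀ e, e = c + c ∨ e = -(c + c) → (a + a = e ∨ b + b = e) → False := by
    intro e he h
    have h' : a + a = e := h.elim id fun h => h2.trans h
    rcases he with rfl | rfl
    · rcases eq_zero_or_half ht0 ht (show c - a + (c - a) = 0 by linear_combination -h') with h | h
      · exact hac (by linear_combination -h)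
      · exact hbc (by linear_combination -h)
    · rcases eq_zero_or_half ht0 ht (show c + a + (c + a) = 0 by linear_combination h') with h | h
      · exact hac' (by linear_combination h)
      · exact hbc' (by linear_combination h - h2)
  have h4a : b - a ≠ c + c ∧ b - a ≠ -(c + c) :=
    ⟨fun h => h4c (by linear_combination ht - 2 * h),
      fun h => h4c (by linear_combination -ht + 2 * h)⟩
  have h2c : c + c ≠ 0 := fun h => hc0 (by linear_combination h)
  by_contra! hcon
  obtain ⟨hc1, hc2⟩ := hcon
  -- Both `a` and `b` lie in `S + {±2c}`. Unless `2c = ±(a + b)`, each of them must be `±3c`, which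
  -- makes them equal or opposite.
  have hka : a = c + c + c ∨ a = -(c + c + c) := by
    obtain ⟨s, hs, e, he, hse⟩ := hall a (by simp [hS, mem_pm])
    simp only [Finset.mem_coe, hS, mem_pm, Set.mem_insert_iff, Set.mem_singleton_iff] at hs he hse
    have hk := key e he
    rcases hs with rfl | rfl | rfl | rfl | rfl | rfl
    · rcases he with rfl | rfl
      · exact absurd (by linear_combination hse) h2c
      · exact absurd (by linear_combination -hse) h2c
    · exact absurd (Or.inl (by linear_combination -hse)) hk
    · rcases he with rfl | rfl
      · exact absurd (by linear_combination hse) h4a.2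
      · exact absurd (by linear_combination hse) h4a.1
    · rcases he with rfl | rfl
      · exact absurd (by linear_combination hse) hc1
      · exact absurd (by linear_combination -hse) hc2
    · rcases he with rfl | rfl
      · left; linear_combination -hse
      · exact absurd (by linear_combination -hse) hac'
    · rcases he with rfl | rfl
      · exact absurd (by linear_combination -hse) hac
      · right; linear_combination -hse
  have hkb : b = c + c + c ∨ b = -(c + c + c) := by
    obtain ⟨s, hs, e, he, hse⟩ := hall b (by simp [hS, mem_pm])
    simp only [Finset.mem_coe, hS, mem_pm, Set.mem_insert_iff, Set.mem_singleton_iff] at hs he hse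
    have hk := key e he
    rcases hs with rfl | rfl | rfl | rfl | rfl | rfl
    · rcases he with rfl | rfl
      · exact absurd (by linear_combination -hse) h4a.1
      · exact absurd (by linear_combination -hse) h4a.2
    · rcases he with rfl | rfl
      · exact absurd (by linear_combination hse) hc1
      · exact absurd (by linear_combination -hse) hc2
    · rcases he with rfl | rfl
      · exact absurd (by linear_combination hse) h2c
      · exact absurd (by linear_combination -hse) h2c
    · exact absurd (Or.inr (by linear_combination -hse)) hk
    · rcases he with rfl | rfl
      · left; linear_combination -hse
      · exact absurd (by linear_combination -hse) hbc'
    · rcases he with rfl | rfl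
      · exact absurd (by linear_combination -hse) hbc
      · right; linear_combination -hse
  rcases hka with h | h <;> rcases hkb with h' | h'
  · exact hab (h.trans h'.symm)
  · exact hab' (by rw [h, h', neg_neg])
  · exact hab' (by rw [h, h'])
  · exact hab (h.trans h'.symm)

omit [NeZero n] in
/-- The generators cannot form two translates `±x + {q, 2q, 3q}`, with `q` of order four, if the
order of `x` is odd and `±x` is invariant. -/
theorem false_of_quarter {x q : ZMod n} {k : ℕ} (hx : Inv γ 0 ({x, -x} : Set (ZMod n)))
    (hS : ∀ y, y ∈ S ↔ ∃ i : ℕ, ¬ 4 ∣ i ∧ (y = x + i * q ∨ y = -x + i * q))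
    (hq : 4 * q = 0) (hq2 : 2 * q ≠ 0) (hk : Odd k) (hkx : k * x = 0) (hx0 : x ≠ 0) : False := by
  have hZ := U.inv.transporter hx
  rw [add_zero] at hZ
  have hq' : ∀ i : ℕ, 4 ∣ i → (i : ZMod n) * q = 0 := by
    rintro _ ⟨i, rfl⟩
    push_cast
    linear_combination (i : ZMod n) * hq
  -- The shifts carrying `{±x}` into `S` are `q, 2q, 3q`. Any other would give `4x ∈ ⟨q⟩`, so `16x =
  -- 0`, although the order of `x` is odd.
  have hZ' : Inv γ 1 {y : ZMod n | ∃ i : ℕ, ¬ 4 ∣ i ∧ y = i * q} := by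
    refine hZ.congr ?_
    ext y
    simp only [Set.mem_ofPred_eq, Set.mem_insert_iff, Set.mem_singleton_iff, Finset.mem_coe,
      forall_eq_or_imp, forall_eq]
    constructor
    · rintro ⟨h1, h2⟩
      obtain ⟨i, hi, h1 | h1⟩ := (hS _).1 h1
      · exact ⟨i, hi, by linear_combination h1⟩
      obtain ⟨j, hj, h2 | h2⟩ := (hS _).1 h2
      · exfalso
        have h16 : (16 : ℕ) • x = 0 := by
          rw [nsmul_eq_mul]
          push_cast
          linear_combination 4 * h1 - 4 * h2 + ((i : ZMod n) - j) * hq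
        have hk' : k • x = 0 := by rw [nsmul_eq_mul, hkx]
        have hcop : Nat.Coprime (2 ^ 4) k := Nat.Coprime.pow_left 4 hk.coprime_two_left
        have := Nat.dvd_gcd (addOrderOf_dvd_of_nsmul_eq_zero h16)
          (addOrderOf_dvd_of_nsmul_eq_zero hk')
        rw [show (16 : ℕ) = 2 ^ 4 from rfl, hcop, Nat.dvd_one, AddMonoid.addOrderOf_eq_one_iff]
          at this
        exact hx0 this
      · exact ⟨j, hj, by linear_combination h2⟩
    · rintro ⟨i, hi, rfl⟩
      exact ⟨(hS _).2 ⟨i, hi, Or.inl (by ring)⟩, (hS _).2 ⟨i, hi, Or.inr (by ring)⟩⟩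
  -- Threefold sums of `q, 2q, 3q` stay in `⟨q⟩` and include `0 = q + q + 2q`; removing `q, 2q, 3q`
  -- leaves `{0}` in grade 1.
  have h0 := ((hZ'.add hZ').add hZ').diff (hZ'.congr rfl)
  rw [show (1 : ZMod 2) + 1 + 1 = 1 from rfl] at h0
  refine U.ne (Inv.lin_of_singleton (h0.congr ?_))
  ext y
  simp only [Set.mem_sdiff, Set.mem_ofPred_eq, Set.mem_singleton_iff]
  constructor
  · rintro ⟨⟨_, ⟨_, ⟨i, hi, rfl⟩, _, ⟨j, hj, rfl⟩, rfl⟩, _, ⟨l, hl, rfl⟩, rfl⟩, hy⟩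
    by_contra h
    refine hy ⟨i + j + l, fun h4 => h ?_, by push_cast; ring⟩
    have := hq' _ h4
    push_cast at this
    simp only
    linear_combination this
  · rintro rfl
    refine ⟨⟨_, ⟨_, ⟨1, by norm_num, rfl⟩, _, ⟨1, by norm_num, rfl⟩, rfl⟩, _,
      ⟨2, by norm_num, rfl⟩, by simp only; push_cast; linear_combination hq⟩, ?_⟩
    rintro ⟨i, hi, h⟩
    refine hq2 ?_
    rcases Nat.even_or_odd i with ⟨r, hr⟩ | ⟨r, hr⟩
    · have h2 : Odd r := by
        rw [← Nat.not_even_iff_odd]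
        rintro ⟨s, hs⟩
        exact hi ⟨s, by omega⟩
      obtain ⟨s, rfl⟩ := h2
      subst hr
      push_cast at h
      linear_combination -h - (s : ZMod n) * hq
    · subst hr
      push_cast at h
      linear_combination -2 * h - (r : ZMod n) * hq

/-- The case of two generators differing by the element of order two, after normalizing
signs. -/
theorem family_of_half_of_add (hS : S = pm a b c) (h2 : a + a = b + b) (hc : c + c = a + b)
    (hE : Inv γ 0 ({c + c, -(c + c)} : Set (ZMod n))) : Family2 n S ∨ Family3 n S := by
  have hd := U.distinct hS
  obtain ⟨ha0, hb0, hc0, hab, hab', hac, hac', hbc, hbc'⟩ := hd.ne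
  have ht0 : b - a ≠ 0 := fun h => hab (by linear_combination -h)
  have ht : b - a + (b - a) = 0 := by linear_combination -h2
  -- `a, c, b` is an arithmetic progression with difference `q` of order four, so `S = ±c + {-q, 0,
  -- q}`.
  obtain ⟨q, hq⟩ : ∃ q, q = c - a := ⟨_, rfl⟩
  have hqt : b - a = q + q := by rw [hq]; linear_combination -hc
  obtain ⟨h2t, -⟩ := eq_half_of_add_self ht0 ht
  have hpar := U.parity_ne U.even hS
  obtain ⟨χ, hχ, hpar⟩ : ∃ χ : ZMod n →+* ZMod 2, (∀ x, χ x = (x.val : ZMod 2)) ∧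
      ¬ (χ a = χ b ∧ χ b = χ c) := ⟨_, castHom_two_eq_val U.even, hpar⟩
  have hχt : χ (b - a) = 0 := by
    rw [hqt, map_add, CharTwo.add_self_eq_zero]
  have hte := hχt
  rw [hχ, ZMod.natCast_eq_zero_iff_even] at hte
  obtain ⟨k, hk⟩ := hte
  have hn : n = 4 * k := by omega
  have htk : b - a = 2 * (k : ZMod n) := by
    rw [← ZMod.natCast_zmod_val (b - a), hk]; push_cast; ring
  have hk4 : 4 * (k : ZMod n) = 0 := by linear_combination ht - 2 * htk
  rw [map_sub, sub_eq_zero] at hχt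
  have hχq : χ q = 1 := by
    rw [hq, map_sub]
    revert hpar hχt
    generalize χ a = x
    generalize χ b = y
    generalize χ c = z
    revert x y z
    decide
  have hqk : q = k ∨ q = -k := by
    rcases eq_zero_or_half ht0 ht (show q - k + (q - k) = 0 by linear_combination htk - hqt)
      with h | h
    · left; linear_combination h
    · right; linear_combination h + htk + hk4
  have hko : Odd k := by
    rw [← ZMod.natCast_eq_one_iff_odd]
    rcases hqk with h | h <;> rw [h] at hχq
    · simpa using hχq
    · simpa [CharTwo.neg_eq] using hχq
  have hcast : ∀ x : ZMod n, (((x.val : ℕ) : ℤ) : ZMod n) = x := by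
    intro x; rw [Int.cast_natCast, ZMod.natCast_zmod_val]
  have hbt : b = a + 2 * k := by linear_combination htk
  by_cases hco : Odd c.val
  · left
    refine ⟨k, c.val, a.val, hn, ?_, by exact_mod_cast hco, ?_⟩
    · rw [hcast, hcast]
      rw [hS, pm_swap_right, pm_swap_left, pm,
        show -b = -a + 2 * k by linear_combination -hbt - hk4, hbt]
    · have h1 : Even a.val := by
        rw [← ZMod.natCast_eq_zero_iff_even, ← hχ]
        rw [← ZMod.natCast_eq_one_iff_odd, ← hχ] at hco
        rw [hq, map_sub, hco] at hχq
        simpa using hχq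
      exact_mod_cast h1
  · right
    rw [Nat.not_odd_iff_even] at hco
    have hS' : S = pm c (c + k) (c - k) := by
      have hak : a = c - q := by rw [hq]; ring
      have hbk : b = c + q := by linear_combination hqt + hak
      rw [hS, hak, hbk]
      rcases hqk with h | h <;> rw [h]
      · rw [pm_swap_right, pm_swap_left, pm_swap_right]
      · rw [sub_neg_eq_add, ← sub_eq_add_neg, pm_swap_right, pm_swap_left]
    by_cases hc4 : 4 ∣ c.val
    · refine ⟨k, c.val, hn, by rw [hcast]; exact hS', ?_, hko⟩
      rw [Int.modEq_zero_iff_dvd]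
      exact_mod_cast hc4
    -- Here `c ≡ 2 (mod 4)` and `k = 2r + 1`, so `kc = 2k` and `(r + 1) • 2c = (k + 1)c = c + 2k`.
    -- This element `x` has odd order, and recentring at `±x` gives `S = ±x + {k, 2k, 3k}`.
    · exfalso
      obtain ⟨u, hu⟩ := hco
      have huo : Odd u := by
        rw [← Nat.not_even_iff_odd]
        rintro ⟨w, hw⟩
        exact hc4 ⟨w, by omega⟩
      obtain ⟨w, rfl⟩ := huo
      have hcu : c = 2 * (2 * w + 1) := by
        rw [← ZMod.natCast_zmod_val c, hu]; push_cast; ring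
      obtain ⟨r, hr⟩ := hko
      have hkr : (k : ZMod n) = 2 * r + 1 := by rw [hr]; push_cast; ring
      have hkc : k * c = 2 * k := by linear_combination k * hcu + w * hk4
      have hx : (r + 1) • (c + c) = c + 2 * k := by
        rw [nsmul_eq_mul]; push_cast; linear_combination hkc - c * hkr
      have hE' := hE.nsmul_pair (fun h => ?_) (r + 1)
      · rw [mul_zero, hx] at hE'
        refine U.false_of_quarter (q := k) (k := k) hE' (fun y => ?_) hk4
          (fun h => ht0 (htk.trans h)) ⟨r, hr⟩ 
          (by linear_combination hkc + 2 * k * hkr + (r + 1) * hk4)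
          (fun h => hc0 (by linear_combination 2 * h - hk4))
        rw [hS', mem_pm]
        constructor
        · rintro (h | h | h | h | h | h)
          · exact ⟨2, by norm_num, Or.inl (by push_cast; linear_combination h - hk4)⟩
          · exact ⟨2, by norm_num, Or.inr (by push_cast; linear_combination h)⟩
          · exact ⟨3, by norm_num, Or.inl (by push_cast; linear_combination h - hk4)⟩
          · exact ⟨1, by norm_num, Or.inr (by push_cast; linear_combination h)⟩
          · exact ⟨1, by norm_num, Or.inl (by push_cast; linear_combination h - hk4)⟩
          · exact ⟨3, by norm_num, Or.inr (by push_cast; linear_combination h)⟩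
        · rintro ⟨i, hi, h⟩
          have hm : (i : ZMod n) * k = ((i % 4 : ℕ) : ZMod n) * k := by
            conv_lhs => rw [← Nat.div_add_mod i 4]
            push_cast
            linear_combination ((i / 4 : ℕ) : ZMod n) * hk4
          rw [hm] at h
          have : i % 4 = 1 ∨ i % 4 = 2 ∨ i % 4 = 3 := by omega
          rcases this with e | e | e <;> rw [e] at h <;> push_cast at h <;> rcases h with h | h
          · right; right; right; right; left; linear_combination h + hk4
          · right; right; right; left; linear_combination h
          · left; linear_combination h + hk4
          · right; left; linear_combination h
          · right; right; left; linear_combination h + hk4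
          · right; right; right; right; right; linear_combination h
      · exact hc0 (by linear_combination 2 * hkc + hk4 - r * h - 2 * c * hkr)

end UnstablePair

end CirculantDoubleCover

/-! ### No invariant pair and no such generators: families 6 and 7. -/

namespace CirculantDoubleCover

variable {n : ℕ} [NeZero n] {a b c : ZMod n} {S : Finset (ZMod n)}
  {γ : ZMod 2 → Equiv.Perm (ZMod n)}

namespace UnstablePair

variable (U : UnstablePair S γ)
include U

/-- The Frobenius set for `p = 3` is symmetric and invariant, so it contains all of `S` once it
meets `S`. -/
theorem exists_three_nsmul_eq (hS : S = pm a b c) (hno : ∀ s ∈ S, ¬ Inv γ 1 {s, -s})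
    {x y : ZMod n} (hx : x ∈ S) (hy : y ∈ S)
    (h : ¬ 3 ∣ (S.filter fun s => 3 • s = x).card) : ∃ s ∈ S, 3 • s = y := by
  have : Fact (Nat.Prime 3) := ⟨Nat.prime_three⟩
  have h3 := U.inv.frobenius 3
  rw [show ((3 : ℕ) : ZMod 2) = 1 from rfl, one_mul] at h3
  refine exists_of_not_dvd_card (p := 3) (U.mem_of_mem hS hno h3 ?_ hx h hy)
  intro x hx
  rw [Set.mem_ofPred_eq] at hx ⊢
  rwa [card_filter_nsmul_neg U.neg]

section NoHalf

variable (hR3 : ∀ x ∈ S, ∀ y ∈ S, x + x = y + y → x = y ∨ x = -y)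
include hR3

/-- `3(-a) = a`, and parity allows at most one of the pairs `±b`, `±c` to contain a further element
tripling to `a`. So `a` survives modulo 3 and `b` is three times a generator. That generator can
only be `±c`, and then all three parities agree. -/
theorem false_of_order_four_of_parity (hS : S = pm a b c) (hno : ∀ s ∈ S, ¬ Inv γ 1 {s, -s})
    (h4 : a + a = -(a + a))
    (hpar : ZMod.castHom U.even (ZMod 2) a = ZMod.castHom U.even (ZMod 2) b ∨
      ZMod.castHom U.even (ZMod 2) a = ZMod.castHom U.even (ZMod 2) c) : False := by
  have hd := U.distinct hS
  obtain ⟨ha0, hb0, hc0, hab, hab', hac, hac', hbc, hbc'⟩ := hd.ne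
  have ha : a ∈ S := by simp [hS, mem_pm]
  have hb : b ∈ S := by simp [hS, mem_pm]
  have hc : c ∈ S := by simp [hS, mem_pm]
  have hpar' := U.parity_ne U.even hS
  obtain ⟨χ, hpar, hpar'⟩ : ∃ χ : ZMod n →+* ZMod 2, (χ a = χ b ∨ χ a = χ c) ∧
      ¬ (χ a = χ b ∧ χ b = χ c) := ⟨_, hpar, hpar'⟩
  have hodd : ∀ x y : ZMod n, 3 * x = y ∨ 3 * -x = y → χ x = χ y := by
    rintro x y (h | h) <;> rw [← h] <;> simp only [map_mul, map_ofNat, map_neg, CharTwo.neg_eq] <;>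
      rw [show (3 : ZMod 2) = 1 from rfl, one_mul]
  have e1 : ¬ 3 * a = a := fun h => ha0 (by linear_combination h)
  have e2 : 3 * -a = a := by linear_combination -h4
  have h2a : a + a ≠ 0 := fun h => ha0 (by linear_combination h)
  have hcount : ∀ (P Q R T : Prop) [Decidable P] [Decidable Q] [Decidable R] [Decidable T],
      ¬ (P ∧ Q) → ¬ (R ∧ T) → ¬ ((P ∨ Q) ∧ (R ∨ T)) →
      ¬ 3 ∣ 0 + 1 + (if P then 1 else 0) + (if Q then 1 else 0) + (if R then 1 else 0) +
        (if T then 1 else 0) := by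
    intro P Q R T _ _ _ _ h1 h2 h3
    by_cases P <;> by_cases Q <;> by_cases R <;> by_cases T <;> simp_all
  obtain ⟨s, hs, hsb⟩ := U.exists_three_nsmul_eq hS hno ha hb (by
    rw [hS, hd.card_filter]
    simp only [nsmul_eq_mul, Nat.cast_ofNat]
    rw [if_neg e1, if_pos e2]
    have e3 : 3 * b = a → ¬ 3 * -b = a := fun h h' => ha0 (by linear_combination -h - h')
    have e4 : 3 * c = a → ¬ 3 * -c = a := fun h h' => ha0 (by linear_combination -h - h')
    have e5 : ¬ ((3 * b = a ∨ 3 * -b = a) ∧ (3 * c = a ∨ 3 * -c = a)) := by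
      rintro ⟨h, h'⟩
      have h1 := hodd b a h
      have h2 := hodd c a h'
      exact hpar' ⟨h1.symm, h1.trans h2.symm⟩
    exact hcount _ _ _ _ (fun h => e3 h.1 h.2) (fun h => e4 h.1 h.2) e5)
  rw [nsmul_eq_mul, Nat.cast_ofNat] at hsb
  have hb4 : b + b ≠ -(b + b) := by
    intro h
    have := half_unique h2a (by linear_combination h4)
      (fun h => hb0 (by linear_combination h)) (show b + b + (b + b) = 0 by linear_combination h)
    exact (hR3 a ha b hb this).elim hab hab'
  rw [hS, mem_pm] at hs
  rcases hs with hs | hs | hs | hs | hs | hs <;> rw [hs] at hsb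
  · exact hab' (by linear_combination h4 - hsb)
  · exact hab (by linear_combination h4 + hsb)
  · exact hb0 (by linear_combination hsb)
  · exact hb4 (by linear_combination -hsb)
  all_goals
    have h1 := hodd c b (by tauto)
    refine hpar' ⟨?_, h1.symm⟩
    rcases hpar with h | h
    · exact h
    · exact h.trans h1

/-- If `4a = 0`, then `a` and `-a` have the same double, which drops out modulo 2, while `2b`
survives. Since `b = -b + 2b`, also `a = s + 2y` with a surviving double `2y`, so `y ≠ ±a`. Hence
`a` has the parity of the generator `s ≠ ±a`, contrary to the preceding lemma. -/
theorem four_mul_ne_zero (hS : S = pm a b c) (hno : ∀ s ∈ S, ¬ Inv γ 1 {s, -s}) :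
    a + a ≠ -(a + a) := by
  intro h4
  have hd := U.distinct hS
  obtain ⟨ha0, hb0, hc0, hab, hab', hac, hac', hbc, hbc'⟩ := hd.ne
  have ha : a ∈ S := by simp [hS, mem_pm]
  have hb : b ∈ S := by simp [hS, mem_pm]
  have h2a : a + a ≠ 0 := fun h => ha0 (by linear_combination h)
  have hb4 : b + b ≠ -(b + b) := by
    intro h
    have := half_unique h2a (by linear_combination h4)
      (fun h => hb0 (by linear_combination h)) (show b + b + (b + b) = 0 by linear_combination h)
    exact (hR3 a ha b hb this).elim hab hab'
  have : Fact (Nat.Prime 2) := ⟨Nat.prime_two⟩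
  have hE := U.inv.frobenius 2
  rw [show ((2 : ℕ) : ZMod 2) = 0 from rfl, zero_mul] at hE
  have hD := U.inv.add hE
  rw [add_zero] at hD
  have hbE : ¬ 2 ∣ (S.filter fun s => 2 • s = b + b).card := by
    refine not_dvd_card_of_unique (by norm_num) hb (two_nsmul b) ?_
    intro u hu h
    rw [two_nsmul] at h
    rcases hR3 u hu b hb h with h' | h'
    · exact h'
    · rw [h'] at h
      exact absurd (by linear_combination -h) hb4
  have hmem := U.mem_of_mem hS hno hD (by
    rintro x ⟨t, ht, e, he, rfl⟩
    refine ⟨-t, U.neg _ ht, -e, ?_, by simp only; ring⟩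
    rw [Set.mem_ofPred_eq] at he ⊢
    rwa [card_filter_nsmul_neg U.neg]) hb
    ⟨-b, U.neg _ hb, b + b, hbE, by simp only; ring⟩ ha
  obtain ⟨s, hs, e, he, hse⟩ := hmem
  rw [Set.mem_ofPred_eq] at he
  obtain ⟨y, hy, hye⟩ := exists_of_not_dvd_card he
  rw [two_nsmul] at hye
  simp only [← hye] at hse
  have hy2 : y + y ≠ a + a := by
    intro h
    refine he ?_
    rw [← hye, h]
    have : (S.filter fun s => 2 • s = a + a) = {a, -a} := by
      ext u
      rw [Finset.mem_filter, Finset.mem_insert, Finset.mem_singleton, two_nsmul]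
      constructor
      · rintro ⟨hu, h⟩
        exact hR3 u hu a ha h
      · rintro (rfl | rfl)
        · exact ⟨ha, rfl⟩
        · exact ⟨U.neg _ ha, by linear_combination -h4⟩
    rw [this, Finset.card_pair ha0]
  have hya : y ≠ a := fun h => hy2 (by rw [h])
  have hya' : y ≠ -a := fun h => hy2 (by rw [h]; linear_combination -h4)
  obtain ⟨z, hz⟩ := exists_pm_of_mem_of_mem hS ha hy hya hya'
  have hkey : ∀ w, a = y + y + w →
      ZMod.castHom U.even (ZMod 2) a = ZMod.castHom U.even (ZMod 2) w := by
    intro w hw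
    rw [hw, map_add, map_add, CharTwo.add_self_eq_zero, zero_add]
  have hχ := hkey s (by rw [← hse]; ring)
  refine U.false_of_order_four_of_parity hR3 hz hno h4 ?_
  rw [Finset.mem_coe, hz, mem_pm] at hs
  have hy0 : y ≠ -y := fun h => by
    have h1 := (U.distinct hz).ne.2.1
    exact h1 h
  rcases hs with rfl | rfl | rfl | rfl | rfl | rfl
  · exact absurd (by linear_combination hse) hy0
  · exact absurd (by linear_combination hse) hy2
  · exact Or.inl hχ
  · left; rw [hχ, map_neg, CharTwo.neg_eq]
  · exact Or.inr hχ
  · right; rw [hχ, map_neg, CharTwo.neg_eq]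

/-- If `b = 3a`, then `b` survives modulo 3, so `c` is three times a generator. From `±a` this gives
`c = ±b`, from `±b` equal parities, and from `±c` one of `2c = 0`, `4c = 0`. -/
theorem ne_three_mul_self (hS : S = pm a b c) (hno : ∀ s ∈ S, ¬ Inv γ 1 {s, -s}) :
    b ≠ a + a + a := by
  intro h3
  have hd := U.distinct hS
  obtain ⟨ha0, hb0, hc0, hab, hab', hac, hac', hbc, hbc'⟩ := hd.ne
  have hb : b ∈ S := by simp [hS, mem_pm]
  have hc : c ∈ S := by simp [hS, mem_pm]
  have h4b := U.four_mul_ne_zero hR3 (hS.trans pm_swap_left) hno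
  have h4c := U.four_mul_ne_zero hR3 (hS.trans (pm_swap_right.trans pm_swap_left)) hno
  have e1 : 3 * a = b := by linear_combination -h3
  have e2 : ¬ 3 * -a = b := fun h => hb0 (by linear_combination -h - e1)
  have e3 : ¬ 3 * b = b := fun h => hb0 (by linear_combination h)
  have e4 : ¬ 3 * -b = b := fun h => h4b (by linear_combination -h)
  obtain ⟨s, hs, hsc⟩ := U.exists_three_nsmul_eq hS hno hb hc (by
    rw [hS, hd.card_filter]
    simp only [nsmul_eq_mul, Nat.cast_ofNat]
    rw [if_pos e1, if_neg e2, if_neg e3, if_neg e4]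
    by_cases f3 : 3 * c = b
    · have f4 : ¬ 3 * -c = b := fun h => hb0 (by linear_combination -h - f3)
      rw [if_pos f3, if_neg f4]
      norm_num
    · rw [if_neg f3]
      split_ifs <;> norm_num)
  rw [nsmul_eq_mul, Nat.cast_ofNat] at hsc
  have hχ : ∀ x y : ZMod n, y = 3 * x ∨ y = 3 * -x →
      ZMod.castHom U.even (ZMod 2) x = ZMod.castHom U.even (ZMod 2) y := by
    rintro x y (rfl | rfl) <;> simp only [map_mul, map_ofNat, map_neg, CharTwo.neg_eq] <;>
      rw [show (3 : ZMod 2) = 1 from rfl, one_mul]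
  rw [hS, mem_pm] at hs
  rcases hs with hs | hs | hs | hs | hs | hs <;> rw [hs] at hsc
  · exact hbc (e1.symm.trans hsc)
  · exact hbc' (by linear_combination -hsc - e1)
  · exact U.parity_ne U.even hS ⟨hχ a b (Or.inl e1.symm), hχ b c (Or.inl hsc.symm)⟩
  · exact U.parity_ne U.even hS ⟨hχ a b (Or.inl e1.symm), hχ b c (Or.inr hsc.symm)⟩
  · exact hc0 (by linear_combination hsc)
  · exact h4c (by linear_combination -hsc)

theorem ne_three_mul_of_mem (hS : S = pm a b c) (hno : ∀ s ∈ S, ¬ Inv γ 1 {s, -s}) {x y : ZMod n}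
    (hx : x ∈ S) (hy : y ∈ S) : y ≠ x + x + x := by
  intro h
  obtain ⟨u, v, hu⟩ := exists_pm_of_mem hS hx
  have h4 := U.four_mul_ne_zero hR3 hu hno
  have hx0 := (U.distinct hu).ne.1
  by_cases h1 : y = x
  · exact hx0 (by linear_combination h1 - h)
  by_cases h2 : y = -x
  · exact h4 (by linear_combination h2 - h)
  obtain ⟨z, hz⟩ := exists_pm_of_mem_of_mem hS hx hy h1 h2
  exact U.ne_three_mul_self hR3 hz hno h

/-- `b = -b + 2b = -c + 2a` has two representations in `S + 2S`, so `a` has one besides `-a + 2a`,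
say `a = s + 2y`. Every choice is an excluded relation except, up to exchanging `b` and `c`, `s =
-b` and `y = c`; in that case `a - c` is a period of `S`. -/
theorem two_mul_ne_add (hS : S = pm a b c) (hno : ∀ s ∈ S, ¬ Inv γ 1 {s, -s}) :
    a + a ≠ b + c := by
  intro h2
  have hd := U.distinct hS
  obtain ⟨ha0, hb0, hc0, hab, hab', hac, hac', hbc, hbc'⟩ := hd.ne
  have ha : a ∈ S := by simp [hS, mem_pm]
  have hb : b ∈ S := by simp [hS, mem_pm]
  have hc : c ∈ S := by simp [hS, mem_pm]
  have h3 : ∀ x ∈ S, ∀ y ∈ S, y ≠ x + x + x := fun x hx y hy =>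
    U.ne_three_mul_of_mem hR3 hS hno hx hy
  have h4 : ∀ x ∈ S, x + x ≠ -(x + x) := by
    intro x hx
    obtain ⟨u, v, hu⟩ := exists_pm_of_mem hS hx
    exact U.four_mul_ne_zero hR3 hu hno
  have : Fact (Nat.Prime 2) := ⟨Nat.prime_two⟩
  have hE := U.inv.frobenius 2
  rw [show ((2 : ℕ) : ZMod 2) = 0 from rfl, zero_mul] at hE
  have hE' : Inv γ 0 {x : ZMod n | ∃ y ∈ S, y + y = x} := by
    refine hE.congr ?_
    ext x
    simp only [Set.mem_ofPred_eq]
    constructor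
    · intro h
      obtain ⟨y, hy, h⟩ := exists_of_not_dvd_card h
      exact ⟨y, hy, by rw [← h, two_nsmul]⟩
    · rintro ⟨y, hy, rfl⟩
      refine not_dvd_card_of_unique (by norm_num) hy (two_nsmul y) ?_
      intro u hu h
      rw [two_nsmul] at h
      rcases hR3 u hu y hy h with h' | h'
      · exact h'
      · rw [h'] at h
        exact absurd (by linear_combination -h) (h4 y hy)
  have hD := U.inv.add_two hE'
  rw [add_zero] at hD
  have hmem := U.mem_of_mem hS hno hD (by
    rintro x ⟨s, hs, s', hs', hne, ⟨y, hy, hyx⟩, ⟨y', hy', hyx'⟩⟩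
    exact ⟨-s, U.neg _ hs, -s', U.neg _ hs', fun h => hne (neg_injective h),
      ⟨-y, U.neg _ hy, by linear_combination -hyx⟩, ⟨-y', U.neg _ hy', by linear_combination -hyx'⟩⟩)
    hb ⟨-b, U.neg _ hb, -c, U.neg _ hc, fun h => hbc (neg_injective h),
      ⟨b, hb, by ring⟩, ⟨a, ha, by linear_combination h2⟩⟩ ha
  have hex : ∃ s ∈ S, s ≠ -a ∧ ∃ y ∈ S, y + y = a - s := by
    obtain ⟨s, hs, s', hs', hne, hy, hy'⟩ := hmem
    by_cases h : s = -a
    · exact ⟨s', hs', fun h' => hne (h.trans h'.symm), hy'⟩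
    · exact ⟨s, hs, h, hy⟩
  obtain ⟨s, hs, hsa, y, hy, hys⟩ := hex
  have hfin : ∀ b c : ZMod n, b ∈ S → c ∈ S → S = pm a b c → a ≠ c → a + a = b + c →
      (s = b ∨ s = -b) → (y = c ∨ y = -c) → False := by
    intro b c hb hc hS hac h2 hs hy
    rcases hs with rfl | rfl <;> rcases hy with rfl | rfl
    · exact h3 _ (U.neg _ hc) _ hb (by linear_combination 2 * hys + h2)
    · exact h3 _ hc _ ha (by linear_combination h2 + hys)
    · refine hac (sub_eq_zero.1 (U.twinFree (a - y) ?_))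
      intro x hx
      rw [hS, mem_pm] at hx ⊢
      rcases hx with rfl | rfl | rfl | rfl | rfl | rfl
      · right; right; left; linear_combination h2
      · right; right; right; right; right; ring
      · right; right; right; right; left; linear_combination -hys
      · right; left; linear_combination h2
      · left; ring
      · right; right; right; left; linear_combination -hys
    · exact h3 _ (U.neg _ ha) _ hc (by linear_combination h2 - hys)
  have n1 : y ≠ a := by rintro rfl; exact hsa (by linear_combination hys)
  have n2 : y ≠ -a := by rintro rfl; exact h3 a ha s hs (by linear_combination hys)
  have n3 : y ≠ s := by rintro rfl; exact h3 y hs a ha (by linear_combination -hys)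
  have n4 : y ≠ -s := by rintro rfl; exact hsa (by linear_combination -hys)
  have n5 : s ≠ a := by
    rintro rfl
    exact (U.distinct (exists_pm_of_mem hS hy).choose_spec.choose_spec).ne.1
      (by linear_combination hys)
  have hs' : (s = b ∨ s = -b) ∨ (s = c ∨ s = -c) := by
    have := hs
    rw [hS, mem_pm] at this
    tauto
  have hy' : (y = b ∨ y = -b) ∨ (y = c ∨ y = -c) := by
    have := hy
    rw [hS, mem_pm] at this
    tauto
  have hpair : ∀ d, (s = d ∨ s = -d) → (y = d ∨ y = -d) → False := by
    rintro d (rfl | rfl) (rfl | rfl)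
    · exact n3 rfl
    · exact n4 rfl
    · exact n4 (neg_neg _).symm
    · exact n3 rfl
  rcases hs' with hs' | hs' <;> rcases hy' with hy' | hy'
  · exact hpair b hs' hy'
  · exact hfin b c hb hc hS hac h2 hs' hy'
  · exact hfin c b hc hb (hS.trans pm_swap_right) hab (by linear_combination h2) hs' hy'
  · exact hpair c hs' hy'

/-- With all short relations excluded, `2s = u + w` has only trivial solutions in `S`, so all
parallelograms are preserved. -/
theorem family_of_generic (hS : S = pm a b c) (hno : ∀ s ∈ S, ¬ Inv γ 1 {s, -s}) :
    Family6 n S ∨ Family7 n S := by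
  have h3 : ∀ x ∈ S, ∀ y ∈ S, y ≠ x + x + x := fun x hx y hy =>
    U.ne_three_mul_of_mem hR3 hS hno hx hy
  have h4 : ∀ x ∈ S, x ≠ -x ∧ x + x ≠ -(x + x) := by
    intro x hx
    obtain ⟨u, v, hu⟩ := exists_pm_of_mem hS hx
    exact ⟨(U.distinct hu).ne.1, U.four_mul_ne_zero hR3 hu hno⟩
  have hQ : ∀ s ∈ (S : Set (ZMod n)), ∀ u ∈ (S : Set (ZMod n)), ∀ w ∈ (S : Set (ZMod n)),
      s + s = u + w → u = s := by
    intro s hs u hu w hw h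
    rw [Finset.mem_coe] at hs hu hw
    by_contra hus
    have hus' : u ≠ -s := by rintro rfl; exact h3 s hs w hw (by linear_combination -h)
    have hws : w ≠ s := by rintro rfl; exact hus (by linear_combination -h)
    have hws' : w ≠ -s := by rintro rfl; exact h3 s hs u hu (by linear_combination -h)
    have hwu : w ≠ u := by
      rintro rfl
      rcases hR3 s hs w hw h with h' | h'
      · exact hus h'.symm
      · exact hus' (by rw [h', neg_neg])
    have hwu' : w ≠ -u := by rintro rfl; exact (h4 s hs).1 (by linear_combination h)
    obtain ⟨z, hz⟩ := exists_pm_of_mem_of_mem hS hs hu hus hus'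
    have hw' := hw
    rw [hz, mem_pm] at hw'
    rcases hw' with e | e | e | e | e | e
    · exact hws e
    · exact hws' e
    · exact hwu e
    · exact hwu' e
    · rw [← e] at hz
      exact U.two_mul_ne_add hR3 hz hno h
    · have hz' := hz.trans pm_neg_right
      rw [← e] at hz'
      exact U.two_mul_ne_add hR3 hz' hno h
  have hlin : ∀ x ∈ S, ∃ y, Lin γ x 1 y := by
    intro x hx
    refine U.exists_lin hS fun s hs j v => ?_
    refine U.inv.parallelogram_of_sum hQ U.neg (fun s hs t ht u hu w hw => ?_) hx ?_ j v
    · rw [Finset.mem_coe, hS] at hs ht hu hw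
      exact pigeonhole_pm hs ht hu hw
    · rw [Finset.mem_coe, hS, mem_pm]; tauto
  exact U.family_of_lin hS hlin

end NoHalf

/-- A nontrivially unstable circulant graph of valency six belongs to one of the families. -/
theorem mem_families (hS : S = pm a b c) :
    Family1 n S ∨ Family2 n S ∨ Family3 n S ∨ Family4 n S ∨ Family5 n S ∨ Family6 n S ∨
      Family7 n S := by
  by_cases hex : ∃ s ∈ S, Inv γ 1 {s, -s}
  · obtain ⟨s, hs, hinv⟩ := hex
    obtain ⟨y, z, hz⟩ := exists_pm_of_mem hS hs
    have := U.family_of_pair hz hinv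
    tauto
  push Not at hex
  by_cases hR3 : ∀ x ∈ S, ∀ y ∈ S, x + x = y + y → x = y ∨ x = -y
  · have := U.family_of_generic hR3 hS hex
    tauto
  · push Not at hR3
    obtain ⟨x, hx, y, hy, h2, hxy, hxy'⟩ := hR3
    obtain ⟨z, hz⟩ := exists_pm_of_mem_of_mem hS hx hy (Ne.symm hxy)
      (fun h => hxy' (by rw [h, neg_neg]))
    obtain ⟨hc | hc, hE⟩ := U.two_mul_eq_add_of_half hz hex h2
    · have := U.family_of_half_of_add hz h2 hc hE
      tauto
    · have := U.family_of_half_of_add (c := -z) (hz.trans pm_neg_right) h2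
        (by linear_combination -hc) (hE.congr ?_)
      · tauto
      · rw [Set.pair_comm, show -z + -z = -(z + z) by ring, neg_neg]

end UnstablePair

end CirculantDoubleCover

/-! ### Types C.1 and C.4: instability, and the families that have them. -/

namespace CirculantDoubleCover

variable {n : ℕ} {a b c : ZMod n} {S : Finset (ZMod n)}

section Parity

theorem even_or_even_sub_one [NeZero n] (x : ZMod n) : Even x ∨ Even (x - 1) := by
  rcases Nat.even_or_odd' x.val with ⟨r, h | h⟩
  · left
    refine ⟨r, ?_⟩
    rw [← ZMod.natCast_zmod_val x, h]
    push_cast; ring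
  · right
    refine ⟨r, ?_⟩
    rw [← ZMod.natCast_zmod_val x, h]
    push_cast; ring

theorem even_iff_castHom (hn : 2 ∣ n) [NeZero n] (x : ZMod n) :
    Even x ↔ ZMod.castHom hn (ZMod 2) x = 0 := by
  constructor
  · rintro ⟨r, rfl⟩
    rw [map_add, CharTwo.add_self_eq_zero]
  · intro h
    rcases even_or_even_sub_one x with h1 | ⟨r, h1⟩
    · exact h1
    · have := congrArg (ZMod.castHom hn (ZMod 2)) h1
      rw [map_sub, h, map_add, CharTwo.add_self_eq_zero, map_one] at this
      exact absurd this (by decide)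

theorem even_intCast_iff (hn : 2 ∣ n) [NeZero n] (x : ℤ) : Even (x : ZMod n) ↔ Even x := by
  rw [even_iff_castHom hn, map_intCast, ZMod.intCast_zmod_eq_zero_iff_dvd, even_iff_two_dvd]
  rfl

theorem vadd_eq_self_of_forall {A : Finset (ZMod n)} {h : ZMod n} (H : ∀ s ∈ A, h + s ∈ A) :
    h +ᵥ A = A := by
  refine Finset.eq_of_subset_of_card_le ?_ (by rw [Finset.card_vadd_finset])
  intro x hx
  obtain ⟨s, hs, rfl⟩ := Finset.mem_vadd_finset.1 hx
  exact H s hs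

end Parity

theorem mem_evenPart {s : ZMod n} : s ∈ evenPart S ↔ s ∈ S ∧ Even s := by
  classical
  rw [evenPart, Finset.mem_filter]

theorem mem_oddPart {s : ZMod n} : s ∈ oddPart S ↔ s ∈ S ∧ ¬ Even s := by
  classical
  rw [oddPart, Finset.mem_filter]

section Residues

variable [NeZero n]

/-- A way of constructing instability: the two copies of `ℤ_n` are permuted by adding elements that
depend only on the residue class modulo a divisor `m` of `n`. -/
theorem unstable_of_residue {m : ℕ} (χ : ZMod n →+* ZMod m) (hneg : ∀ s ∈ S, -s ∈ S) (h0 : 0 ∉ S)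
    (f g : ZMod m → ZMod n) (hf : Function.Injective fun x => x + χ (f x))
    (hg : Function.Injective fun x => x + χ (g x))
    (H : ∀ s ∈ S, ∀ x, s + g (x + χ s) - f x ∈ S) (hne : f 0 ≠ g 0) : Unstable (cay S) := by
  have hinj : ∀ f : ZMod m → ZMod n, (Function.Injective fun x => x + χ (f x)) →
      Function.Bijective fun v => v + f (χ v) := by
    intro f hf
    rw [← Finite.injective_iff_bijective]
    intro v w h
    have h1 := congrArg χ h
    simp only [map_add] at h1
    have h2 := hf h1
    simp only [h2] at h
    exact add_right_cancel h
  refine unstable_of_mapsTo hneg h0 (Equiv.ofBijective _ (hinj f hf))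
    (Equiv.ofBijective _ (hinj g hg)) ?_ ?_
  · intro v w h
    have := H _ h (χ v)
    rw [map_sub, add_sub_cancel] at this
    simp only [Equiv.ofBijective_apply]
    convert this using 1
    ring
  · intro h
    have := DFunLike.congr_fun h 0
    simp only [Equiv.ofBijective_apply, zero_add, map_zero] at this
    exact hne this

/-- One layer is shifted by `h` on even vertices and the other on odd vertices; odd differences are
unchanged and even ones change by `±h`. -/
theorem WilsonC1.unstable (hneg : ∀ s ∈ S, -s ∈ S) (h0 : 0 ∉ S) (h : WilsonC1 S) :
    Unstable (cay S) := by
  obtain ⟨hn, h, hh0, hh, hS⟩ := h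
  have hn2 := even_iff_two_dvd.1 hn
  have hχh := (even_iff_castHom hn2 h).1 hh
  have hadd : ∀ s ∈ S, Even s → s + h ∈ S := by
    intro s hs he
    have h1 : s ∈ evenPart S := mem_evenPart.2 ⟨hs, he⟩
    have h2 : h +ᵥ s ∈ h +ᵥ evenPart S := Finset.vadd_mem_vadd_finset h1
    rw [hS] at h2
    rw [add_comm]
    exact (mem_evenPart.1 h2).1
  have hsub : ∀ s ∈ S, Even s → s - h ∈ S := by
    intro s hs he
    have h2 := hadd (-s) (hneg s hs) he.neg
    have h3 := hneg _ h2
    rwa [neg_add, neg_neg, ← sub_eq_add_neg] at h3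
  have hz : ∀ x : ZMod 2, x = 0 ∨ x = 1 := by decide
  refine unstable_of_residue (ZMod.castHom hn2 (ZMod 2)) hneg h0 (fun x => if x = 0 then h else 0)
    (fun x => if x = 0 then 0 else h) ?_ ?_ ?_ (by simpa using hh0)
  · intro x y
    simp only [apply_ite (ZMod.castHom hn2 (ZMod 2)), hχh, map_zero, ite_self, add_zero]
    exact id
  · intro x y
    simp only [apply_ite (ZMod.castHom hn2 (ZMod 2)), hχh, map_zero, ite_self, add_zero]
    exact id
  · intro s hs x
    have he := even_iff_castHom hn2 s
    rcases hz (ZMod.castHom hn2 (ZMod 2) s) with h1 | h1 <;> rw [h1] <;> rw [h1] at he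
    · rw [add_zero]
      rcases hz x with rfl | rfl
      · simpa using hsub s hs (he.2 rfl)
      · simpa using hadd s hs (he.2 rfl)
    · rcases hz x with rfl | rfl
      · simpa using hs
      · rw [show (1 : ZMod 2) + 1 = 0 from rfl]
        simpa using hs

/-- The layers are permuted by `v ↦ m v` and `v ↦ m v + n/2`. -/
theorem WilsonC4.unstable (hneg : ∀ s ∈ S, -s ∈ S) (h0 : 0 ∉ S) (h : WilsonC4 S) :
    Unstable (cay S) := by
  obtain ⟨hn, m, hm⟩ := h
  refine unstable_of_mapsTo hneg h0 (Units.mulLeft m)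
    ((Units.mulLeft m).trans (Equiv.addRight ((n / 2 : ℕ) : ZMod n))) ?_ ?_
  · intro v w h
    have h1 : ((n / 2 : ℕ) : ZMod n) +ᵥ (m • (w - v)) ∈ S := by
      rw [← hm]
      exact Finset.vadd_mem_vadd_finset (Finset.smul_mem_smul_finset h)
    rw [Units.smul_def, smul_eq_mul, vadd_eq_add] at h1
    simp only [Equiv.trans_apply, Units.mulLeft_apply, Equiv.coe_addRight]
    convert h1 using 1
    ring
  · intro h
    have h1 := DFunLike.congr_fun h 0
    simp only [Equiv.trans_apply, Units.mulLeft_apply, Equiv.coe_addRight, mul_zero, zero_add] at h1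
    have h2 := (ZMod.natCast_eq_zero_iff _ _).1 h1.symm
    have h3 := NeZero.pos n
    have h4 := Nat.le_of_dvd (by obtain ⟨r, hr⟩ := hn; omega) h2
    omega

end Residues

section Families

theorem wilsonC1_of_forall (hn : 2 ∣ n) {h : ZMod n} (h0 : h ≠ 0) (he : Even h)
    (H : ∀ s ∈ S, Even s → h + s ∈ S) : WilsonC1 S := by
  refine ⟨even_iff_two_dvd.2 hn, h, h0, he, vadd_eq_self_of_forall fun s hs => ?_⟩
  rw [mem_evenPart] at *
  exact ⟨H s hs.1 hs.2, he.add hs.2⟩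

theorem wilsonC4_of_forall (hn : 2 ∣ n) (m : (ZMod n)ˣ)
    (H : ∀ s ∈ S, ((n / 2 : ℕ) : ZMod n) + m * s ∈ S) : WilsonC4 S := by
  refine ⟨even_iff_two_dvd.2 hn, m, ?_⟩
  refine Finset.eq_of_subset_of_card_le ?_
    (by rw [Finset.card_vadd_finset, Finset.card_smul_finset])
  intro x hx
  obtain ⟨y, hy, rfl⟩ := Finset.mem_vadd_finset.1 hx
  obtain ⟨s, hs, rfl⟩ := Finset.mem_smul_finset.1 hy
  exact H s hs

variable [NeZero n]

omit [NeZero n] in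
theorem natCast_ne_zero_of_lt {k : ℕ} (h0 : k ≠ 0) (h : k < n) : (k : ZMod n) ≠ 0 := by
  rw [Ne, ZMod.natCast_eq_zero_iff]
  exact fun h' => absurd (Nat.le_of_dvd (Nat.pos_of_ne_zero h0) h') (by omega)

/-- Here `S_e = {±2k}`, and `h = 4k` exchanges its two elements. -/
theorem Family1.wilsonC1 (h : Family1 n S) : WilsonC1 S := by
  obtain ⟨k, a, b, hn, hS, ha, hb⟩ := h
  have hn0 := NeZero.ne n
  have h2 : 2 ∣ n := ⟨4 * k, by omega⟩
  have h8 : 8 * (k : ZMod n) = 0 := by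
    have := ZMod.natCast_self n
    rw [hn] at this
    rw [hn]
    exact_mod_cast this
  refine wilsonC1_of_forall h2 (h := 4 * k) ?_ ⟨2 * k, by ring⟩ ?_
  · have := natCast_ne_zero_of_lt (n := n) (k := 4 * k) (by omega) (by omega)
    exact_mod_cast this
  · intro s hs he
    have hna : ¬ Even (a : ZMod n) := by rwa [even_intCast_iff h2, Int.not_even_iff_odd]
    have hnb : ¬ Even (b : ZMod n) := by rwa [even_intCast_iff h2, Int.not_even_iff_odd]
    rw [hS, mem_pm] at hs ⊢
    rcases hs with rfl | rfl | rfl | rfl | rfl | rfl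
    · exact absurd he hna
    · exact absurd (by simpa using he) hna
    · exact absurd he hnb
    · exact absurd (by simpa using he) hnb
    · right; right; right; right; right; linear_combination h8
    · right; right; right; right; left; ring

theorem Family2.wilsonC1 (h : Family2 n S) : WilsonC1 S := by
  obtain ⟨k, a, b, hn, hS, ha, hb⟩ := h
  have hn0 := NeZero.ne n
  have h2 : 2 ∣ n := ⟨2 * k, by omega⟩
  have h4 : 4 * (k : ZMod n) = 0 := by
    have := ZMod.natCast_self n
    rw [hn] at this
    rw [hn]
    exact_mod_cast this
  refine wilsonC1_of_forall h2 (h := 2 * k) ?_ ⟨k, by ring⟩ ?_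
  · have := natCast_ne_zero_of_lt (n := n) (k := 2 * k) (by omega) (by omega)
    exact_mod_cast this
  · intro s hs he
    have hna : ¬ Even (a : ZMod n) := by rwa [even_intCast_iff h2, Int.not_even_iff_odd]
    rw [hS] at hs ⊢
    simp only [Finset.mem_insert, Finset.mem_singleton] at hs ⊢
    rcases hs with rfl | rfl | rfl | rfl | rfl | rfl
    · exact absurd he hna
    · exact absurd (by simpa using he) hna
    · right; right; right; right; left; ring
    · right; right; right; right; right; ring
    · right; right; left; linear_combination h4
    · right; right; right; left; linear_combination h4

/-- `x ↦ m x + 2k` fixes `±a` and exchanges the pairs `±b` and `±mb + 2k`, because `m²b = ±b`. -/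
theorem Family6.wilsonC4 (h : Family6 n S) : WilsonC4 S := by
  obtain ⟨k, a, b, m, hn, hS, hm, ha, hb⟩ := h
  have hn0 := NeZero.ne n
  have h4 : 4 * (k : ZMod n) = 0 := by
    have := ZMod.natCast_self n
    rw [hn] at this
    rw [hn]
    exact_mod_cast this
  have hn' : (4 * k : ℤ) = (n : ℤ) := by rw [hn]; push_cast; rfl
  rw [hn'] at hm ha hb
  have hu : IsUnit (m : ZMod n) := by
    rw [ZMod.coe_int_isUnit_iff_isCoprime, Int.isCoprime_iff_gcd_eq_one, Int.gcd_comm]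
    exact hm
  obtain ⟨u, hu⟩ := hu
  have hhalf : ((n / 2 : ℕ) : ZMod n) = 2 * k := by
    rw [show n / 2 = 2 * k by omega]; push_cast; rfl
  have h2k : (2 * k : ZMod n) ≠ 0 := by
    have := natCast_ne_zero_of_lt (n := n) (k := 2 * k) (by omega) (by omega)
    exact_mod_cast this
  have hu2 := unit_mul_half u h2k (by linear_combination h4)
  rw [hu] at hu2
  have ha' := (ZMod.intCast_eq_intCast_iff _ _ _).2 ha
  push_cast at ha'
  have hb' : (m : ZMod n) ^ 2 * b = b ∨ (m : ZMod n) ^ 2 * b = -b := by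
    rcases hb with hb | hb
    · left
      have := (ZMod.intCast_eq_intCast_iff _ _ _).2 hb
      push_cast at this
      rw [this, one_mul]
    · right
      have := (ZMod.intCast_eq_intCast_iff _ _ _).2 hb
      push_cast at this
      linear_combination this
  refine wilsonC4_of_forall ⟨2 * k, by omega⟩ u ?_
  intro s hs
  rw [hhalf, hu]
  rw [hS] at hs ⊢
  simp only [Finset.mem_insert, Finset.mem_singleton] at hs ⊢
  rcases hs with rfl | rfl | rfl | rfl | rfl | rfl
  · left; linear_combination ha' + h4
  · right; left; linear_combination -ha'
  · right; right; right; right; left; ring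
  · right; right; right; right; right; ring
  · right; right
    rcases hb' with h | h
    · left; linear_combination h + hu2 + h4
    · right; left; linear_combination h + hu2 + h4
  · right; right
    rcases hb' with h | h
    · right; left; linear_combination -h + hu2 + h4
    · left; linear_combination -h + hu2 + h4

omit [NeZero n] in
theorem Family7.wilsonC4 (h : Family7 n S) : WilsonC4 S := by
  obtain ⟨k, a, b, c, hn, hS, m, hm, -, ha, hb, hc⟩ := h
  have h8 : 8 * (k : ZMod n) = 0 := by
    have := ZMod.natCast_self n
    rw [hn] at this
    rw [hn]
    exact_mod_cast this
  have hn' : (8 * k : ℤ) = (n : ℤ) := by rw [hn]; push_cast; rfl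
  rw [hn'] at hm ha hb hc
  have hu : IsUnit (m : ZMod n) := by
    rw [ZMod.coe_int_isUnit_iff_isCoprime, Int.isCoprime_iff_gcd_eq_one, Int.gcd_comm]
    exact hm
  obtain ⟨u, hu⟩ := hu
  have hhalf : ((n / 2 : ℕ) : ZMod n) = 4 * k := by
    rw [show n / 2 = 4 * k by omega]; push_cast; rfl
  have ha' := (ZMod.intCast_eq_intCast_iff _ _ _).2 ha
  have hb' := (ZMod.intCast_eq_intCast_iff _ _ _).2 hb
  have hc' := (ZMod.intCast_eq_intCast_iff _ _ _).2 hc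
  push_cast at ha' hb' hc'
  refine wilsonC4_of_forall ⟨4 * k, by omega⟩ u ?_
  intro s hs
  rw [hhalf, hu]
  rw [hS, mem_pm] at hs ⊢
  rcases hs with rfl | rfl | rfl | rfl | rfl | rfl
  · left; linear_combination ha' + h8
  · right; left; linear_combination -ha'
  · right; right; right; left; linear_combination hb' + h8
  · right; right; left; linear_combination -hb'
  · right; right; right; right; right; linear_combination hc' + h8
  · right; right; right; right; left; linear_combination -hc'

end Families

end CirculantDoubleCover

/-! ### Family 3 (type C.2′ and instability) and the instability of family 5. -/

namespace CirculantDoubleCover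

variable {n : ℕ} [NeZero n] {a b c : ZMod n} {S : Finset (ZMod n)}

omit [NeZero n] in
theorem castHom_eq_zero_of_dvd {m : ℕ} (hm : m ∣ n) {x : ZMod n} (h : (m : ZMod n) ∣ x) :
    ZMod.castHom hm (ZMod m) x = 0 := by
  obtain ⟨y, rfl⟩ := h
  rw [map_mul, map_natCast, ZMod.natCast_self, zero_mul]

omit [NeZero n] in
theorem natCast_mul_eq_zero {m k : ℕ} (h : n = m * k) : (m : ZMod n) * k = 0 := by
  have := ZMod.natCast_self n
  rw [← Nat.cast_mul, ← h, this]

section FamilyThree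

theorem odd_zmod_four_cases {k : ℕ} (hk : Odd k) : (k : ZMod 4) = 1 ∨ (k : ZMod 4) = 3 := by
  obtain ⟨r, rfl⟩ := hk
  push_cast
  generalize (r : ZMod 4) = x
  revert x; decide

/-- The witness is `h = k`. The elements of `S` congruent to `0` or `-k` modulo 4 are `±a`, `-(a +
k)` and `a - k`, and adding `k` keeps each in `S`. -/
theorem Family3.wilsonC2' (h : Family3 n S) : WilsonC2' S := by
  obtain ⟨k, a, hn, hS, ha, hk⟩ := h
  have h2 : 2 ∣ n := ⟨2 * k, by omega⟩
  have h4 : 4 ∣ n := ⟨k, hn⟩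
  have h4k : 4 * (k : ZMod n) = 0 := by exact_mod_cast natCast_mul_eq_zero hn
  have hae : Even (a : ZMod n) := by
    rw [even_intCast_iff h2, even_iff_two_dvd]
    exact dvd_trans (by norm_num) (Int.modEq_zero_iff_dvd.1 ha)
  have hχa : ZMod.castHom h4 (ZMod 4) (a : ZMod n) = 0 := by
    rw [map_intCast, ZMod.intCast_zmod_eq_zero_iff_dvd]
    exact Int.modEq_zero_iff_dvd.1 ha
  have hχk : ZMod.castHom h4 (ZMod 4) (k : ZMod n) = (k : ZMod 4) := map_natCast _ _
  have hdvd : ∀ x : ZMod n, (4 : ZMod n) ∣ x → ZMod.castHom h4 (ZMod 4) x = 0 :=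
    fun x hx => castHom_eq_zero_of_dvd h4 (by exact_mod_cast hx)
  have hk4 := odd_zmod_four_cases hk
  refine ⟨h4, k, ?_, vadd_eq_self_of_forall fun s hs => ?_, ?_⟩
  · obtain ⟨r, rfl⟩ := hk
    exact ⟨r, by push_cast; ring⟩
  · rw [mem_oddPart] at hs ⊢
    refine ⟨?_, fun he => hs.2 ?_⟩
    · obtain ⟨hs, hno⟩ := hs
      rw [hS, mem_pm] at hs ⊢
      rcases hs with rfl | rfl | rfl | rfl | rfl | rfl
      · exact absurd hae hno
      · exact absurd hae.neg hno
      · right; right; right; right; left; linear_combination h4k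
      · right; right; right; right; right; ring
      · right; right; left; ring
      · right; right; right; left; linear_combination h4k
    · have := he.sub (⟨k, by ring⟩ : Even (2 * (k : ZMod n)))
      rwa [add_sub_cancel_left] at this
  · intro s hs hd
    replace hd := hd.imp (hdvd _) (hdvd _)
    rw [hS, mem_pm] at hs ⊢
    rcases hs with rfl | rfl | rfl | rfl | rfl | rfl
    · right; right; left; rfl
    · right; right; right; right; right; ring
    · exfalso
      simp only [map_add, hχa, hχk] at hd
      rcases hk4 with h | h <;> rw [h] at hd <;> exact absurd hd (by decide)
    · right; left; ring
    · left; ring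
    · exfalso
      simp only [map_add, map_neg, map_sub, hχa, hχk] at hd
      rcases hk4 with h | h <;> rw [h] at hd <;> exact absurd hd (by decide)

omit [NeZero n] in
/-- The homomorphism `ℤ_m → ℤ_n` sending `1` to `k`, for `n = m * k`. -/
theorem exists_hom {m k : ℕ} (h : n = m * k) : ∃ φ : ZMod m →+ ZMod n, φ 1 = k := by
  refine ⟨ZMod.lift m ⟨zmultiplesHom (ZMod n) (k : ZMod n), ?_⟩, ?_⟩
  · rw [zmultiplesHom_apply, zsmul_eq_mul, Int.cast_natCast, natCast_mul_eq_zero h]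
  · have := ZMod.lift_coe m ⟨zmultiplesHom (ZMod n) (k : ZMod n), by
      rw [zmultiplesHom_apply, zsmul_eq_mul, Int.cast_natCast, natCast_mul_eq_zero h]⟩ 1
    rw [Int.cast_one] at this
    rw [this]
    simp

omit [NeZero n] in
theorem castHom_comp_hom {m k : ℕ} [NeZero m] (hm : m ∣ n) (φ : ZMod m →+ ZMod n) (hφ : φ 1 = k)
    (j : ZMod m) : ZMod.castHom hm (ZMod m) (φ j) = j * k := by
  rw [← ZMod.natCast_zmod_val j, ← nsmul_one, map_nsmul, hφ, map_nsmul, map_natCast, nsmul_eq_mul,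
    nsmul_one]

theorem Family3.unstable (hneg : ∀ s ∈ S, -s ∈ S) (h0 : 0 ∉ S) (h : Family3 n S) :
    Unstable (cay S) := by
  obtain ⟨k, a, hn, hS, ha, hk⟩ := h
  have hn0 := NeZero.ne n
  have h4 : 4 ∣ n := ⟨k, hn⟩
  obtain ⟨φ, hφ⟩ := exists_hom hn
  have hχφ := castHom_comp_hom h4 φ hφ
  obtain ⟨χ, hχ⟩ : ∃ χ, χ = ZMod.castHom h4 (ZMod 4) := ⟨_, rfl⟩
  rw [← hχ] at hχφ
  have hχa : χ (a : ZMod n) = 0 := by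
    rw [map_intCast, ZMod.intCast_zmod_eq_zero_iff_dvd]
    exact Int.modEq_zero_iff_dvd.1 ha
  have hk4 := odd_zmod_four_cases hk
  have hφ3 : φ 3 = -k := by
    rw [show (3 : ZMod 4) = -1 from rfl, map_neg, hφ]
  have hcases : ∀ j : ZMod 4, j ≠ 2 → j = 0 ∨ j = 1 ∨ j = 3 := by decide
  have hmem : ∀ s, s ∈ S ↔ ∃ j : ZMod 4, j ≠ 2 ∧ (s = a + φ j ∨ s = -a + φ j) := by
    intro s
    rw [hS, mem_pm]
    constructor
    · rintro (h | h | h | h | h | h)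
      · exact ⟨0, by decide, Or.inl (by rw [h, map_zero, add_zero])⟩
      · exact ⟨0, by decide, Or.inr (by rw [h, map_zero, add_zero])⟩
      · exact ⟨1, by decide, Or.inl (by rw [h, hφ])⟩
      · exact ⟨3, by decide, Or.inr (by rw [h, hφ3]; ring)⟩
      · exact ⟨3, by decide, Or.inl (by rw [h, hφ3]; ring)⟩
      · exact ⟨1, by decide, Or.inr (by rw [h, hφ]; ring)⟩
    · rintro ⟨j, hj, h⟩
      have hj' : j = 0 ∨ j = 1 ∨ j = 3 := hcases j hj
      rcases hj' with rfl | rfl | rfl <;> rcases h with rfl | rfl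
      · left; rw [map_zero, add_zero]
      · right; left; rw [map_zero, add_zero]
      · right; right; left; rw [hφ]
      · right; right; right; right; right; rw [hφ]; ring
      · right; right; right; right; left; rw [hφ3]; ring
      · right; right; right; left; rw [hφ3]; ring
  -- `κ` stands for `k` modulo 4. One layer exchanges the residue classes `0` and `κ` by adding
  -- `±k`, the other the classes `2` and `κ + 2`. Since `S` consists of the `±a + φ j` with `j ≠ 2`,
  -- only the value 2 must be avoided.
  let e : ZMod 4 → ZMod 4 → ZMod 4 := fun κ x => if x = 0 then 1 else if x = κ then 3 else 0
  have hinj : ∀ κ : ZMod 4, κ = 1 ∨ κ = 3 → ∀ x y, x + e κ x * κ = y + e κ y * κ → x = y := by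
    simp only [e]; decide
  have hinj' : ∀ κ : ZMod 4, κ = 1 ∨ κ = 3 → ∀ x y,
      x + e κ (x + 2) * κ = y + e κ (y + 2) * κ → x = y := by
    simp only [e]; decide
  have hkey : ∀ κ : ZMod 4, κ = 1 ∨ κ = 3 → ∀ x j : ZMod 4, j ≠ 2 →
      j + e κ (x + j * κ + 2) - e κ x ≠ 2 := by
    simp only [e]; decide
  have he : ∀ κ : ZMod 4, κ = 1 ∨ κ = 3 → e κ 0 = 1 ∧ e κ 2 = 0 := by
    simp only [e]; decide
  refine unstable_of_residue χ hneg h0 (fun x => φ (e k x)) (fun x => φ (e k (x + 2))) ?_ ?_ ?_ ?_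
  · intro x y h
    simp only [hχφ] at h
    exact hinj _ hk4 x y h
  · intro x y h
    simp only [hχφ] at h
    exact hinj' _ hk4 x y h
  · intro s hs x
    rw [hmem] at hs ⊢
    obtain ⟨j, hj, h⟩ := hs
    have hχs : χ s = j * k := by
      rcases h with rfl | rfl <;> simp only [map_add, map_neg, hχa, hχφ, neg_zero, zero_add]
    refine ⟨_, hkey _ hk4 x j hj, ?_⟩
    rw [hχs, map_sub, map_add]
    rcases h with rfl | rfl
    · left; ring
    · right; ring
  · simp only [zero_add]
    rw [(he _ hk4).1, (he _ hk4).2, hφ, map_zero]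
    exact natCast_ne_zero_of_lt (by omega) (by omega)

end FamilyThree

section FamilyFive

theorem odd_zmod_eight_cases {k : ℕ} (hk : Odd k) :
    (k : ZMod 8) = 1 ∨ (k : ZMod 8) = 3 ∨ (k : ZMod 8) = 5 ∨ (k : ZMod 8) = 7 := by
  obtain ⟨r, rfl⟩ := hk
  push_cast
  generalize (r : ZMod 8) = x
  revert x; decide

omit [NeZero n] in
/-- If `k` generates the subgroup of order eight, then `±k, ±3k` are its odd elements. -/
theorem mem_of_eq_pm_three_mul {k : ℕ} (hS : S = pm a (k : ZMod n) (3 * k : ZMod n))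
    (φ : ZMod 8 →+ ZMod n) (hφ : φ 1 = k) {s : ZMod n} :
    s ∈ S ↔ (s = a ∨ s = -a) ∨ ∃ j : ZMod 8, (j = 1 ∨ j = 3 ∨ j = -3 ∨ j = -1) ∧ s = φ j := by
  have hφ3 : φ 3 = 3 * k := by
    rw [show (3 : ZMod 8) = 3 • 1 from rfl, map_nsmul, hφ, nsmul_eq_mul]; rfl
  rw [hS, mem_pm]
  constructor
  · rintro (h | h | h | h | h | h)
    · exact Or.inl (Or.inl h)
    · exact Or.inl (Or.inr h)
    · exact Or.inr ⟨1, by decide, by rw [h, hφ]⟩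
    · exact Or.inr ⟨-1, by decide, by rw [h, map_neg, hφ]⟩
    · exact Or.inr ⟨3, by decide, by rw [h, hφ3]⟩
    · exact Or.inr ⟨-3, by decide, by rw [h, map_neg, hφ3]⟩
  · rintro ((h | h) | ⟨j, rfl | rfl | rfl | rfl, rfl⟩)
    · exact Or.inl h
    · exact Or.inr (Or.inl h)
    · right; right; left; rw [hφ]
    · right; right; right; right; left; rw [hφ3]
    · right; right; right; right; right; rw [map_neg, hφ3]
    · right; right; right; left; rw [map_neg, hφ]

theorem Family5.unstable (hneg : ∀ s ∈ S, -s ∈ S) (h0 : 0 ∉ S) (h : Family5 n S) :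
    Unstable (cay S) := by
  obtain ⟨k, a, hn, hS, ha, hk⟩ := h
  have hn0 := NeZero.ne n
  have h8 : 8 ∣ n := ⟨k, hn⟩
  obtain ⟨φ, hφ⟩ := exists_hom hn
  have hχφ := castHom_comp_hom h8 φ hφ
  obtain ⟨χ, hχ⟩ : ∃ χ, χ = ZMod.castHom h8 (ZMod 8) := ⟨_, rfl⟩
  rw [← hχ] at hχφ
  have hχa : χ (a : ZMod n) = 4 := by
    rw [map_intCast, show (4 : ZMod 8) = ((4 : ℤ) : ZMod 8) from rfl,
      ZMod.intCast_eq_intCast_iff]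
    exact ha
  have hk8 := odd_zmod_eight_cases hk
  have hmem := fun s => mem_of_eq_pm_three_mul hS φ hφ (s := s)
  -- One layer exchanges the classes `0` and `2k` modulo 8 by adding `±2k`, the other the classes
  -- `4` and `2k + 4`. Edges `±a` join classes differing by 4, so both ends move alike; odd
  -- multiples of `k` remain odd multiples.
  let e : ZMod 8 → ZMod 8 → ZMod 8 := fun κ x => if x = 0 then 2 else if x = 2 * κ then 6 else 0
  have hinj : ∀ κ : ZMod 8, κ = 1 ∨ κ = 3 ∨ κ = 5 ∨ κ = 7 →
      ∀ x y, x + e κ x * κ = y + e κ y * κ → x = y := by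
    simp only [e]; decide
  have hinj' : ∀ κ : ZMod 8, κ = 1 ∨ κ = 3 ∨ κ = 5 ∨ κ = 7 →
      ∀ x y, x + e κ (x + 4) * κ = y + e κ (y + 4) * κ → x = y := by
    intro κ hκ x y h
    refine add_right_cancel (b := 4) (hinj κ hκ _ _ ?_)
    linear_combination h
  have heven : ∀ κ x, e κ x = 0 ∨ e κ x = 2 ∨ e κ x = 6 := by
    intro κ x
    simp only [e]
    split_ifs <;> tauto
  have hkey : ∀ j x y : ZMod 8, (j = 1 ∨ j = 3 ∨ j = -3 ∨ j = -1) → (x = 0 ∨ x = 2 ∨ x = 6) →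
      (y = 0 ∨ y = 2 ∨ y = 6) → (j + x - y = 1 ∨ j + x - y = 3 ∨ j + x - y = -3 ∨ j + x - y = -1) := by
    decide
  have he : ∀ κ : ZMod 8, κ = 1 ∨ κ = 3 ∨ κ = 5 ∨ κ = 7 → e κ 0 = 2 ∧ e κ 4 = 0 := by
    simp only [e]; decide
  refine unstable_of_residue χ hneg h0 (fun x => φ (e k x)) (fun x => φ (e k (x + 4))) ?_ ?_ ?_ ?_
  · intro x y h
    simp only [hχφ] at h
    exact hinj _ hk8 x y h
  · intro x y h
    simp only [hχφ] at h
    exact hinj' _ hk8 x y h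
  · intro s hs x
    rw [hmem] at hs ⊢
    rcases hs with hs | ⟨j, hj, rfl⟩
    · left
      have hχs : χ s = 4 := by
        rcases hs with rfl | rfl
        · exact hχa
        · rw [map_neg, hχa]; rfl
      have : s + φ (e k (x + χ s + 4)) - φ (e k x) = s := by
        rw [hχs, show x + 4 + 4 = x by rw [add_assoc, show (4 : ZMod 8) + 4 = 0 from rfl, add_zero],
          add_sub_cancel_right]
      rw [this]
      exact hs
    · exact Or.inr ⟨_, hkey _ _ _ hj (heven _ _) (heven _ _), by rw [map_sub, map_add]⟩
  · simp only [zero_add]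
    rw [(he _ hk8).1, (he _ hk8).2, map_zero, show (2 : ZMod 8) = 2 • 1 from rfl, map_nsmul, hφ,
      nsmul_eq_mul, ← Nat.cast_mul]
    exact natCast_ne_zero_of_lt (by omega) (by omega)

end FamilyFive

end CirculantDoubleCover

/-! ### Type C.3′, family 4, and the instability of all families. -/

namespace CirculantDoubleCover

variable {n : ℕ} {S : Finset (ZMod n)}

theorem mem_wilsonR {H : AddSubgroup (ZMod n)} {s : ZMod n} :
    s ∈ wilsonR S H ↔ s ∈ S ∧ ¬ ∀ h ∈ H, s + h ∈ S := by
  classical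
  rw [wilsonR, Finset.mem_filter]

section Order

variable [NeZero n]

theorem addOrderOf_eq_div_gcd (x : ZMod n) : addOrderOf x = n / n.gcd x.val := by
  conv_lhs => rw [← ZMod.natCast_zmod_val x]
  exact ZMod.addOrderOf_coe _ (NeZero.ne n)

theorem gcd_val_neg (x : ZMod n) : n.gcd (-x).val = n.gcd x.val := by
  rw [ZMod.neg_val]
  split_ifs with h
  · rw [h, ZMod.val_zero]
  · exact Nat.gcd_self_sub_right x.val_le

theorem odd_val_div_gcd {x : ZMod n} (h : Even (n / n.gcd x.val)) : Odd (x.val / n.gcd x.val) := by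
  have h1 := Nat.coprime_div_gcd_div_gcd (m := n) (n := x.val) (Nat.gcd_pos_of_pos_left _ (NeZero.pos n))
  rw [← Nat.not_even_iff_odd]
  intro h2
  have := Nat.dvd_gcd (even_iff_two_dvd.1 h) (even_iff_two_dvd.1 h2)
  rw [h1] at this
  omega

theorem wilsonD_eq_gcd {H : AddSubgroup (ZMod n)} {x : ZMod n}
    (hR : ∀ s, s ∈ wilsonR S H ↔ s = x ∨ s = -x) : wilsonD S H = n.gcd x.val := by
  refine Nat.dvd_antisymm ?_ ?_
  · exact Nat.dvd_gcd (Nat.gcd_dvd_left _ _)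
      ((Nat.gcd_dvd_right _ _).trans (Finset.gcd_dvd ((hR x).2 (Or.inl rfl))))
  · refine Nat.dvd_gcd (Nat.gcd_dvd_left _ _) (Finset.dvd_gcd fun r hr => ?_)
    rcases (hR r).1 hr with rfl | rfl
    · exact Nat.gcd_dvd_right _ _
    · rw [← gcd_val_neg]
      exact Nat.gcd_dvd_right _ _

/-- For `R = {±x}` one has `d = gcd(n, x)`; as `n/d` and `x/d` are coprime, `x/d` is odd once `n/d`
is even. -/
theorem wilsonC3'_of_pair (hn : Even n) (H : AddSubgroup (ZMod n)) {x : ZMod n}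
    (hR : ∀ s, s ∈ wilsonR S H ↔ s = x ∨ s = -x) (hx : Even (n / n.gcd x.val))
    (hH : ¬ H ≤ AddSubgroup.zmultiples ((n.gcd x.val : ℕ) : ZMod n) ∨
      H ≤ AddSubgroup.zmultiples ((2 * n.gcd x.val : ℕ) : ZMod n)) : WilsonC3' S := by
  refine ⟨hn, H, ⟨x, (hR x).2 (Or.inl rfl)⟩, ?_, ?_, ?_⟩
  · rwa [wilsonD_eq_gcd hR]
  · intro r hr
    rw [wilsonD_eq_gcd hR]
    rcases (hR r).1 hr with rfl | rfl
    · exact odd_val_div_gcd hx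
    · rw [← gcd_val_neg] at hx ⊢
      exact odd_val_div_gcd hx
  · rwa [wilsonD_eq_gcd hR]

end Order

section FamilyFour

variable [NeZero n]

/-- The arithmetic of an element of order divisible by `4` in `ℤ_{8k}`. -/
theorem exists_gcd_factor {k : ℕ} (hn : n = 8 * k) {x : ZMod n} (hx : 4 ∣ addOrderOf x) :
    ∃ q, n = 4 * n.gcd x.val * q ∧ 4 * k = 2 * n.gcd x.val * q ∧ Even (n / n.gcd x.val) := by
  rw [addOrderOf_eq_div_gcd] at hx
  have heven : Even (n / n.gcd x.val) := even_iff_two_dvd.2 ((by norm_num : 2 ∣ 4).trans hx)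
  obtain ⟨q, hq⟩ := hx
  have h1 : n = n.gcd x.val * (4 * q) := by
    rw [← hq]; exact (Nat.mul_div_cancel' (Nat.gcd_dvd_left _ _)).symm
  have h2 : n = 4 * n.gcd x.val * q := by rw [mul_comm 4, mul_assoc]; exact h1
  refine ⟨q, h2, ?_, heven⟩
  have h3 : 2 * (4 * k) = 2 * (2 * n.gcd x.val * q) := by
    calc 2 * (4 * k) = n := by omega
      _ = 4 * n.gcd x.val * q := h2
      _ = _ := by ring
  exact Nat.eq_of_mul_eq_mul_left (by norm_num) h3

theorem Family4.unstable (hneg : ∀ s ∈ S, -s ∈ S) (h0 : 0 ∉ S) (h : Family4 n S) :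
    Unstable (cay S) := by
  obtain ⟨k, a, b, hn, hS, -, ha⟩ := h
  have hn0 := NeZero.pos n
  obtain ⟨q, h1, h2, heven⟩ := exists_gcd_factor hn ha
  obtain ⟨r, hr⟩ := odd_val_div_gcd heven
  obtain ⟨x, hx⟩ : ∃ x : ZMod n, x = a := ⟨_, rfl⟩
  rw [← hx] at h1 h2 hr hS
  have hd0 : 0 < n.gcd x.val := Nat.gcd_pos_of_pos_left _ hn0
  have hdx : x.val = n.gcd x.val * (2 * r + 1) := by
    rw [← hr]; exact (Nat.mul_div_cancel' (Nat.gcd_dvd_right _ _)).symm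
  generalize n.gcd x.val = d at *
  have hdn : 2 * d ∣ n := ⟨2 * q, by rw [h1]; ring⟩
  have : NeZero (2 * d) := ⟨by omega⟩
  obtain ⟨t, ht⟩ : ∃ t : ZMod n, t = 4 * k := ⟨_, rfl⟩
  have h8 : 8 * (k : ZMod n) = 0 := by exact_mod_cast natCast_mul_eq_zero hn
  have ht2 : t + t = 0 := by rw [ht]; linear_combination h8
  have ht0 : t ≠ 0 := by
    have := natCast_ne_zero_of_lt (n := n) (k := 4 * k) (by omega) (by omega)
    rw [ht]
    exact_mod_cast this
  obtain ⟨χ, hχ⟩ : ∃ χ, χ = ZMod.castHom hdn (ZMod (2 * d)) := ⟨_, rfl⟩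
  have h2d : (2 * d : ZMod (2 * d)) = 0 := by exact_mod_cast ZMod.natCast_self (2 * d)
  have hχx : χ x = d := by
    rw [← ZMod.natCast_zmod_val x, map_natCast, hdx]
    push_cast
    linear_combination (r : ZMod (2 * d)) * h2d
  have hχt : χ t = 0 := by
    have : t = ((4 * k : ℕ) : ZMod n) := by rw [ht]; push_cast; rfl
    rw [this, map_natCast, h2]
    push_cast
    linear_combination (q : ZMod (2 * d)) * h2d
  have hdne : (0 : ZMod (2 * d)) ≠ d := (natCast_ne_zero_of_lt (by omega) (by omega)).symm
  rw [← ht] at hS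
  have hsub : ∀ s ∈ S, s ≠ x → s ≠ -x → s + t ∈ S ∧ s - t ∈ S := by
    intro s hs hsx hsx'
    rw [sub_eq_add_neg, show -t = t by linear_combination -ht2, and_self]
    rw [hS] at hs ⊢
    simp only [Finset.mem_insert, Finset.mem_singleton] at hs ⊢
    rcases hs with rfl | rfl | rfl | rfl | rfl | rfl
    · exact absurd rfl hsx
    · exact absurd rfl hsx'
    · tauto
    · tauto
    · right; right; left; linear_combination ht2
    · right; right; right; left; linear_combination ht2
  have hid : ∀ P : ZMod (2 * d) → Prop, ∀ [DecidablePred P],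
      Function.Injective fun y => y + χ (if P y then t else 0) := by
    intro P _ y z
    simp only [apply_ite χ, hχt, map_zero, ite_self, add_zero]
    exact id
  -- Here `d` is the gcd of `n` and `x`, and `x ≡ d (mod 2d)`, so both ends of an edge `±x` are
  -- shifted by `t` or neither is. The other elements of `S` are permuted by `t`, and `t ≡ 0 (mod
  -- 2d)` because `4` divides the order of `x`.
  refine unstable_of_residue χ hneg h0 (fun y => if y = 0 then t else 0)
    (fun y => if y = d then t else 0) (hid _) (hid _) ?_ ?_
  · intro s hs y
    by_cases hsx : s = x ∨ s = -x
    · have hχs : χ s = d := by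
        rcases hsx with rfl | rfl
        · exact hχx
        · rw [map_neg, hχx]; linear_combination -h2d
      simp only [hχs, add_eq_right, add_sub_cancel_right]
      exact hs
    · rw [not_or] at hsx
      obtain ⟨h3, h4⟩ := hsub s hs hsx.1 hsx.2
      split_ifs
      · rwa [add_sub_cancel_right]
      · rwa [sub_zero]
      · rwa [add_zero]
      · rwa [add_zero, sub_zero]
  · simp only [if_true, if_neg hdne]
    exact ht0

/-- `H = ⟨4k⟩` has order two and `R = {±a}`: twin-freeness keeps `±a` in `R`, as otherwise `4k`
would be a period of `S`. The condition `4 ∣ |a|` gives `H ≤ 2dℤ_n`. -/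
theorem Family4.wilsonC3' (hneg : ∀ s ∈ S, -s ∈ S) (h0 : 0 ∉ S) (h : Family4 n S)
    (htw : TwinFree (cay S)) : WilsonC3' S := by
  obtain ⟨k, a, b, hn, hS, -, ha⟩ := h
  have hn0 := NeZero.pos n
  obtain ⟨q, -, h2, heven⟩ := exists_gcd_factor hn ha
  obtain ⟨x, hx⟩ : ∃ x : ZMod n, x = a := ⟨_, rfl⟩
  rw [← hx] at h2 heven hS
  obtain ⟨t, ht⟩ : ∃ t : ZMod n, t = 4 * k := ⟨_, rfl⟩
  have h8 : 8 * (k : ZMod n) = 0 := by exact_mod_cast natCast_mul_eq_zero hn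
  have ht2 : t + t = 0 := by rw [ht]; linear_combination h8
  have ht0 : t ≠ 0 := by
    have := natCast_ne_zero_of_lt (n := n) (k := 4 * k) (by omega) (by omega)
    rw [ht]
    exact_mod_cast this
  rw [← ht] at hS
  have hadd : ∀ s ∈ S, s ≠ x → s ≠ -x → s + t ∈ S := by
    intro s hs hsx hsx'
    rw [hS] at hs ⊢
    simp only [Finset.mem_insert, Finset.mem_singleton] at hs ⊢
    rcases hs with rfl | rfl | rfl | rfl | rfl | rfl
    · exact absurd rfl hsx
    · exact absurd rfl hsx'
    · tauto
    · tauto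
    · right; right; left; linear_combination ht2
    · right; right; right; left; linear_combination ht2
  have hxS : x ∈ S := by simp [hS]
  have hneg_add : -x + t ∈ S → x + t ∈ S := by
    intro h
    convert hneg _ h using 1
    linear_combination ht2
  have hxt : x + t ∉ S := by
    intro hxt
    have hall : ∀ s ∈ S, s + t ∈ S := by
      intro s hs
      by_cases h1 : s = x
      · rwa [h1]
      by_cases h2 : s = -x
      · rw [h2]
        convert hneg _ hxt using 1
        linear_combination ht2
      exact hadd s hs h1 h2
    refine ht0 (htw 0 t ?_).symm
    ext v
    rw [SimpleGraph.mem_neighborSet, SimpleGraph.mem_neighborSet, cay_adj hneg h0, cay_adj hneg h0,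
      sub_zero]
    constructor
    · intro h
      convert hall _ h using 1
      linear_combination -ht2
    · intro h
      convert hall _ h using 1
      ring
  have hH : ∀ h ∈ AddSubgroup.zmultiples t, h = 0 ∨ h = t := by
    rintro _ ⟨j, rfl⟩
    rcases Int.even_or_odd' j with ⟨i, rfl | rfl⟩
    · left
      simp only [zsmul_eq_mul]
      push_cast
      linear_combination (i : ZMod n) * ht2
    · right
      simp only [zsmul_eq_mul]
      push_cast
      linear_combination (i : ZMod n) * ht2
  have ht_mem : t ∈ AddSubgroup.zmultiples t := AddSubgroup.mem_zmultiples t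
  refine wilsonC3'_of_pair ⟨4 * k, by omega⟩ (AddSubgroup.zmultiples t) (x := x) ?_ heven (Or.inr ?_)
  · intro s
    rw [mem_wilsonR]
    constructor
    · rintro ⟨hs, hno⟩
      by_contra h
      rw [not_or] at h
      refine hno fun u hu => ?_
      rcases hH u hu with rfl | rfl
      · rwa [add_zero]
      · exact hadd s hs h.1 h.2
    · rintro (rfl | rfl)
      · exact ⟨hxS, fun h => hxt (h t ht_mem)⟩
      · exact ⟨hneg _ hxS, fun h => hxt (hneg_add (h t ht_mem))⟩
  · rw [AddSubgroup.zmultiples_le]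
    refine AddSubgroup.mem_zmultiples_iff.2 ⟨q, ?_⟩
    have : t = ((4 * k : ℕ) : ZMod n) := by rw [ht]; push_cast; rfl
    rw [this, h2, zsmul_eq_mul]
    push_cast
    ring

end FamilyFour

/-- `H = ⟨2k⟩` permutes the odd multiples of `k`, so `R = {±a}`. As `4 ∣ d` but `8 ∤ d`, the
quotient `n/d` is even, and `2k ∉ dℤ_n` because `k` is odd. -/
theorem Family5.wilsonC3' [NeZero n] (h : Family5 n S) : WilsonC3' S := by
  obtain ⟨k, a, hn, hS, ha, hk⟩ := h
  have hn0 := NeZero.pos n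
  have h8 : 8 ∣ n := ⟨k, hn⟩
  have h4 : 4 ∣ n := ⟨2 * k, by omega⟩
  obtain ⟨φ, hφ⟩ := exists_hom hn
  have hχφ := castHom_comp_hom h8 φ hφ
  obtain ⟨x, hx⟩ : ∃ x : ZMod n, x = a := ⟨_, rfl⟩
  obtain ⟨χ, hχ⟩ : ∃ χ, χ = ZMod.castHom h8 (ZMod 8) := ⟨_, rfl⟩
  rw [← hχ] at hχφ
  have hχx : χ x = 4 := by
    rw [hx, map_intCast, show (4 : ZMod 8) = ((4 : ℤ) : ZMod 8) from rfl,
      ZMod.intCast_eq_intCast_iff]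
    exact ha
  rw [← hx] at hS
  have hk8 := odd_zmod_eight_cases hk
  have hmem := fun s => mem_of_eq_pm_three_mul hS φ hφ (s := s)
  have h2k : φ 2 = 2 * k := by
    rw [show (2 : ZMod 8) = 2 • 1 from rfl, map_nsmul, hφ, nsmul_eq_mul]; rfl
  have hxval : x.val % 8 = 4 := by
    have : ((x.val : ℕ) : ZMod 8) = ((4 : ℕ) : ZMod 8) := by
      rw [← map_natCast χ, ZMod.natCast_zmod_val, hχx]; rfl
    exact (ZMod.natCast_eq_natCast_iff' _ _ _).1 this
  have hg4 : 4 ∣ n.gcd x.val := Nat.dvd_gcd h4 (by omega)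
  have hg8 : ¬ 8 ∣ n.gcd x.val := by
    intro h
    have := h.trans (Nat.gcd_dvd_right _ _)
    omega
  have heven : Even (n / n.gcd x.val) := by
    have h1 := Nat.mul_div_cancel' (Nat.gcd_dvd_left n x.val)
    generalize n / n.gcd x.val = q at *
    obtain ⟨g, hg⟩ := hg4
    rw [hg] at h1 hg8
    have h2 : g * q = 2 * k := by
      have : 4 * (g * q) = 4 * (2 * k) := by rw [← mul_assoc, h1, hn]; ring
      omega
    have h3 : Even (g * q) := ⟨k, by omega⟩
    rw [Nat.even_mul] at h3
    refine h3.resolve_left ?_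
    rintro ⟨r, rfl⟩
    exact hg8 ⟨r, by ring⟩
  refine wilsonC3'_of_pair ⟨4 * k, by omega⟩ (AddSubgroup.zmultiples (φ 2)) (x := x) ?_ heven
    (Or.inl ?_)
  · have hχ2 : χ (φ 2) = 2 * k := hχφ 2
    have hnot : ∀ y, χ y = 4 → y + φ 2 ∉ S := by
      intro y hy h
      rw [hmem] at h
      rcases h with h | ⟨j, hj, h⟩
      · have h1 : χ (y + φ 2) = 4 := by
          rcases h with h | h <;> rw [h]
          · exact hχx
          · rw [map_neg, hχx]; rfl
        rw [map_add, hy, hχ2] at h1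
        rcases hk8 with e | e | e | e <;> rw [e] at h1 <;> revert h1 <;> decide
      · have h1 := congrArg χ h
        rw [map_add, hy, hχ2, hχφ] at h1
        rcases hk8 with e | e | e | e <;> rw [e] at h1 <;> rcases hj with rfl | rfl | rfl | rfl <;>
          revert h1 <;> decide
    intro s
    rw [mem_wilsonR]
    constructor
    · rintro ⟨hs, hno⟩
      by_contra h
      refine hno ?_
      rintro _ ⟨i, rfl⟩
      obtain ⟨j, hj, rfl⟩ := ((hmem s).1 hs).resolve_left h
      refine (hmem _).2 (Or.inr ⟨j + i * 2, ?_, ?_⟩)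
      · have : ∀ j i : ZMod 8, (j = 1 ∨ j = 3 ∨ j = -3 ∨ j = -1) →
            (j + i * 2 = 1 ∨ j + i * 2 = 3 ∨ j + i * 2 = -3 ∨ j + i * 2 = -1) := by decide
        exact this j i hj
      · simp only
        rw [← zsmul_eq_mul, map_add, map_zsmul]
    · rintro (rfl | rfl)
      · exact ⟨(hmem _).2 (Or.inl (Or.inl rfl)), fun h =>
          hnot _ hχx (h _ (AddSubgroup.mem_zmultiples _))⟩
      · exact ⟨(hmem _).2 (Or.inl (Or.inr rfl)), fun h =>
          hnot _ (by rw [map_neg, hχx]; rfl) (h _ (AddSubgroup.mem_zmultiples _))⟩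
  · rw [AddSubgroup.zmultiples_le, h2k]
    rintro ⟨j, hj⟩
    have h1 := congrArg (ZMod.castHom h4 (ZMod 4)) hj
    obtain ⟨g, hg⟩ := hg4
    simp only [map_zsmul, map_natCast, map_mul, map_ofNat] at h1
    rw [hg, Nat.cast_mul, show ((4 : ℕ) : ZMod 4) = 0 from rfl, zero_mul, smul_zero] at h1
    rcases odd_zmod_four_cases hk with e | e <;> rw [e] at h1 <;> revert h1 <;> decide

theorem unstable_of_mem_families [NeZero n] (hneg : ∀ s ∈ S, -s ∈ S) (h0 : 0 ∉ S)
    (h : Family1 n S ∨ Family2 n S ∨ Family3 n S ∨ Family4 n S ∨ Family5 n S ∨ Family6 n S ∨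
      Family7 n S) : Unstable (cay S) := by
  rcases h with h | h | h | h | h | h | h
  exacts [h.wilsonC1.unstable hneg h0, h.wilsonC1.unstable hneg h0, h.unstable hneg h0,
    h.unstable hneg h0, h.unstable hneg h0, h.wilsonC4.unstable hneg h0,
    h.wilsonC4.unstable hneg h0]

end CirculantDoubleCover

open CirculantDoubleCover in
/-- A valency-6 circulant graph is unstable iff it is trivially unstable or belongs to one of the
seven families; moreover the members of each family have the indicated Wilson type. -/
theorem corollary5p2 (n : ℕ) [NeZero n] (a b c : ZMod n)
    (hval : (cay (pm a b c)).IsRegularOfDegree 6) :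
    (Unstable (cay (pm a b c)) ↔
      TriviallyUnstable (cay (pm a b c)) ∨
        (Family1 n (pm a b c) ∨ Family2 n (pm a b c) ∨ Family3 n (pm a b c) ∨
          Family4 n (pm a b c) ∨ Family5 n (pm a b c) ∨ Family6 n (pm a b c) ∨
          Family7 n (pm a b c))) ∧
    (Family1 n (pm a b c) → WilsonC1 (pm a b c)) ∧
    (Family2 n (pm a b c) → WilsonC1 (pm a b c)) ∧
    (Family3 n (pm a b c) → WilsonC2' (pm a b c)) ∧
    (Family4 n (pm a b c) → TwinFree (cay (pm a b c)) → WilsonC3' (pm a b c)) ∧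
    (Family5 n (pm a b c) → WilsonC3' (pm a b c)) ∧
    (Family6 n (pm a b c) → WilsonC4 (pm a b c)) ∧
    (Family7 n (pm a b c) → WilsonC4 (pm a b c)) := by
  obtain ⟨hcard, h0⟩ := card_of_regular hval
  have hneg : ∀ s ∈ pm a b c, -s ∈ pm a b c := fun s hs => neg_mem_pm hs
  refine ⟨⟨fun hu => ?_, fun h => ?_⟩, Family1.wilsonC1, Family2.wilsonC1, Family3.wilsonC2',
    Family4.wilsonC3' hneg h0, Family5.wilsonC3', Family6.wilsonC4, Family7.wilsonC4⟩
  · by_cases ht : NontriviallyUnstable (cay (pm a b c))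
    · obtain ⟨γ, U⟩ := exists_unstablePair hcard hneg h0 ht
      exact Or.inr (U.mem_families rfl)
    · exact Or.inl ⟨hu, ht⟩
  · rcases h with h | h
    · exact h.1
    · exact unstable_of_mem_families hneg h0 h
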